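/- Let $C$ be a smooth, projective, geometrically irreducible curve over a finite field $\mathbb F_q$, and let $\mathbb K=\mathbb F_q(C)$ be its function field. For each place $v$ of $\mathbb K$ let $\mathbb K_v$ be the completion, $n_v=[\kappa(v):\mathbb F_q]$ the degree of $v$ and $|x|_v=q^{-n_v\,\mathrm{ord}_v(x)}$ the normalized absolute value. Let $\mathbb A_{\mathbb K}$ be the adele ring, $C_{\mathbb K}=\mathbb A_{\mathbb K}^*/\mathbb K^*$ the idele class group, $|\cdot|:C_{\mathbb K}\to\mathbb R_+^*$ the norm induced by $|a|=\prod_v|a_v|_v$, $C_{\mathbb K,1}$ its kernel, $N$ its range, and $N_v=|\mathbb K_v^*|_v$. Let $a^{(v)}\in\mathbb A_{\mathbb K}$ be the adele with component $0$ at $v$ and $1$ at all other places, and let $$\Xi_{\mathbb K}=\bigcup_v C_{\mathbb K}\,a^{(v)}\subset\mathbb A_{\mathbb K}/\mathbb K^*$$ be the set of periodic classical points of the adele class space. Let $\mathrm{Fr}$ be the $q$-Frobenius permutation of $C(\bar{\mathbb F}_q)$. A point of $C(\bar{\mathbb F}_q)$ lies over the place $v$ if the local ring of $C$ at the underlying point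 is the valuation ring of $v$. Then: 1. $\mathbb K^*$ embeds diagonally in $\mathbb A_{\mathbb K}^*$, the norm of ideles is trivial on $\mathbb K^*$ (so that it induces $|\cdot|$ on $C_{\mathbb K}$), and $N=q^{\mathbb Z}$. 2. For every place $v$ one has $n_v>0$, $N_v=q^{n_v\mathbb Z}$ and $N/N_v\simeq\mathbb Z/n_v\mathbb Z$. The stabilizer in $C_{\mathbb K}$ of the class of $a^{(v)}$ in $\Xi_{\mathbb K}/C_{\mathbb K,1}$ is $\{c : |c|\in N_v\}$, so that the orbit of this class is a copy of $N/N_v$. 3. Every point of $C(\bar{\mathbb F}_q)$ lies over exactly one place. For every place $v$ the points over $v$ form exactly one orbit of the integer powers of $\mathrm{Fr}$, and this orbit has $n_v$ elements. 4. There is a bijection $\Phi:\Xi_{\mathbb K}/C_{\mathbb K,1}\to C(\bar{\mathbb F}_q)$ which is equivariant for the action of $C_{\mathbb K}/C_{\mathbb K,1}\simeq q^{\mathbb Z}$ on the left and of $\mathrm{Fr}^{\mathbb Z}$ on the right, that is, $\Phi(c\,x)=\mathrm{Fr}^n(\Phi(x))$ whenever $|c|=q^n$, and for which $\Phi(a^{(v)})$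 lies over $v$ for every place $v$. 5. The identification is non-canonical exactly up to the choice of a point in each Frobenius orbit: for every choice of a point $s(v)\in C(\bar{\mathbb F}_q)$ over each place $v$ there is exactly one such equivariant bijection $\Phi$ with $\Phi(a^{(v)})=s(v)$ for all $v$. -/

import Mathlib

open CategoryTheory AlgebraicGeometry
open scoped NNReal WithZero RestrictedProduct

universe u

namespace AdeleClass

noncomputable section

/-! ### Places, completions, degrees -/

/-- A place of the function field `K`, given by its normalized discrete valuation
`v : K → ℤ ∪ {∞}`, written multiplicatively, so that `v f = exp (- ord_v f)`.  Over a finite field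
every nontrivial absolute value of a function field is equivalent to exactly one of these, and they
are automatically trivial on the constants. -/
structure Place (K : Type*) [Field K] where
  /-- the normalized discrete valuation -/
  val : Valuation K ℤᵐ⁰
  /-- its value group is all of `ℤ` -/
  surjective : Function.Surjective val

namespace Place

variable {K : Type*} [Field K] (v : Place K)

/-- The local field `K_v`. -/
abbrev Completion : Type _ := v.val.Completion

/-- The ring of integers `𝒪_v` of `K_v`. -/
abbrev integers : ValuationSubring v.Completion :=
  (Valued.v : Valuation v.Completion ℤᵐ⁰).valuationSubring

/-- The residue field `κ(v)` of the place `v`. -/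
abbrev Residue : Type _ := IsLocalRing.ResidueField v.val.valuationSubring

variable (Fq : Type*) [Field Fq] [Fintype Fq] [Algebra Fq K]

/-- Constants are integral at every place. -/
lemma val_algebraMap_le_one (c : Fq) : v.val (algebraMap Fq K c) ≤ 1 := by
  have h : v.val (algebraMap Fq K c) ^ Fintype.card Fq = v.val (algebraMap Fq K c) := by
    rw [← map_pow, ← map_pow, FiniteField.pow_card]
  by_contra! hc
  have h2 := lt_self_pow₀ hc (Fintype.one_lt_card (α := Fq))
  rw [h] at h2
  exact lt_irrefl _ h2

/-- The inclusion of the constants into the valuation ring of `v`. -/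
def constants : Fq →+* v.val.valuationSubring :=
  (algebraMap Fq K).codRestrict v.val.valuationSubring.toSubring
    (fun c => v.val_algebraMap_le_one Fq c)

/-- `κ(v)` as an extension of `𝔽_q`. -/
instance : Algebra Fq v.Residue :=
  ((IsLocalRing.residue v.val.valuationSubring).comp (v.constants Fq)).toAlgebra

/-- The degree `n_v = [κ(v) : 𝔽_q]` of the place `v`. -/
def deg : ℕ := Module.finrank Fq v.Residue

/-- The normalized absolute value of `K_v`: `|x|_v = q ^ (- n_v * ord_v x)`, and `|0|_v = 0`. -/
def absVal : v.Completion →*₀ ℝ≥0 :=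
  (WithZeroMulInt.toNNReal (e := (Fintype.card Fq : ℝ≥0) ^ v.deg Fq)
    (pow_ne_zero _ (Nat.cast_ne_zero.2 Fintype.card_ne_zero))).comp
    (Valued.v : Valuation v.Completion ℤᵐ⁰).toMonoidWithZeroHom

/-- The range `N_v ⊆ ℝ_+^*` of the absolute value on `K_v^*`. -/
def normRange : Subgroup ℝ≥0ˣ :=
  (Units.map (v.absVal Fq : v.Completion →* ℝ≥0)).range

end Place

/-- The number `q`, as an element of `ℝ_+^*`. -/
def qUnit (Fq : Type*) [Field Fq] [Fintype Fq] : ℝ≥0ˣ :=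
  Units.mk0 (Fintype.card Fq : ℝ≥0) (Nat.cast_ne_zero.2 Fintype.card_ne_zero)

/-! ### Adeles, ideles, idele classes, adele classes -/

section Adeles

variable (K : Type*) [Field K]

/-- The adele ring `𝔸_K`: the restricted product of the `K_v` with respect to the `𝒪_v`. -/
def Adele : Type _ := Πʳ v : Place K, [v.Completion, v.integers]

instance : CommRing (Adele K) :=
  inferInstanceAs (CommRing (Πʳ v : Place K, [v.Completion, v.integers]))

instance : DFunLike (Adele K) (Place K) (fun v => v.Completion) :=
  inferInstanceAs (DFunLike (Πʳ v : Place K, [v.Completion, v.integers]) _ _)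

@[simp] lemma Adele.one_apply (v : Place K) : (1 : Adele K) v = 1 := rfl

@[simp] lemma Adele.mul_apply (a b : Adele K) (v : Place K) : (a * b) v = a v * b v := rfl

lemma Idele.mul_inv_apply (a : (Adele K)ˣ) (v : Place K) :
    (a : Adele K) v * ((a⁻¹ : (Adele K)ˣ) : Adele K) v = 1 := by
  rw [← Adele.mul_apply, Units.mul_inv, Adele.one_apply]

/-- The group of ideles `𝔸_K^*`. -/
abbrev Idele : Type _ := (Adele K)ˣ

/-- The subgroup `K^*` of principal ideles: all components are one and the same element
of `K^*`. -/
def principal : Subgroup (Idele K) where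
  carrier := {u | ∃ k : Kˣ, ∀ v : Place K, (u : Adele K) v = ((k : K) : v.Completion)}
  one_mem' := ⟨1, fun v => (UniformSpace.Completion.coe_one (WithVal v.val)).symm⟩
  mul_mem' := by
    rintro a b ⟨k, hk⟩ ⟨l, hl⟩
    exact ⟨k * l, fun v => by simp [hk, hl, UniformSpace.Completion.coe_mul]⟩
  inv_mem' := by
    rintro a ⟨k, hk⟩
    refine ⟨k⁻¹, fun v => ?_⟩
    have h1 := Idele.mul_inv_apply K a v
    have h2 : (a : Adele K) v * (((k⁻¹ : Kˣ) : K) : v.Completion) = 1 := by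
      rw [hk, ← UniformSpace.Completion.coe_mul, ← map_mul, Units.mul_inv]
      simp
    exact mul_left_cancel₀ (left_ne_zero_of_mul_eq_one h1) (h1.trans h2.symm)

/-- The idele class group `C_K = 𝔸_K^* / K^*`. -/
abbrev IdeleClass : Type _ := Idele K ⧸ principal K

/-- The adele class space `X_K = 𝔸_K / K^*` (as a set). -/
abbrev AdeleClassSpace : Type _ := MulAction.orbitRel.Quotient (principal K) (Adele K)

/-- `C_K` acts on `X_K` by multiplication. -/
instance : MulAction (IdeleClass K) (AdeleClassSpace K) where
  smul := Quotient.map₂ (fun (u : Idele K) (a : Adele K) => u • a) (by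
    intro u u' hu a a' ha
    obtain ⟨k, rfl⟩ := ha
    have hu' : u⁻¹ * u' ∈ principal K := QuotientGroup.leftRel_apply.1 hu
    refine ⟨⟨u⁻¹ * u', hu'⟩⁻¹ * k, ?_⟩
    simp only [Subgroup.smul_def, Subgroup.coe_mul, Subgroup.coe_inv, smul_smul]
    congr 1
    simp [mul_comm, mul_left_comm])
  one_smul x := by
    induction x using Quotient.inductionOn with
    | _ a => exact congrArg (Quotient.mk _) (one_smul (Idele K) a)
  mul_smul c d x := by
    induction c using Quotient.inductionOn with
    | _ u =>
      induction d using Quotient.inductionOn with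
      | _ w =>
        induction x using Quotient.inductionOn with
        | _ a => exact congrArg (Quotient.mk _) (mul_smul u w a)

variable {K}

open Classical in
/-- The adele `a^(v)` with component `0` at `v` and `1` at all other places. -/
def puncturedOne (v : Place K) : Adele K :=
  ⟨fun w => if w = v then 0 else 1, Filter.Eventually.of_forall fun w => by
    by_cases h : w = v <;> simp [h]⟩

/-- The class of `a^(v)` in `X_K`. -/
def puncturedClass (v : Place K) : AdeleClassSpace K := Quotient.mk _ (puncturedOne v)

variable (K)

/-- The periodic classical points `Ξ_K = ⋃_v C_K a^(v) ⊆ X_K`, with the action of `C_K`. -/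
def Xi : SubMulAction (IdeleClass K) (AdeleClassSpace K) where
  carrier := ⋃ v : Place K, MulAction.orbit (IdeleClass K) (puncturedClass v)
  smul_mem' := by
    intro c x hx
    obtain ⟨v, hv⟩ := Set.mem_iUnion.1 hx
    exact Set.mem_iUnion.2 ⟨v, MulAction.mem_orbit_of_mem_orbit c hv⟩

variable {K}

/-- The class of `a^(v)`, as a point of `Ξ_K`. -/
def Xi.base (v : Place K) : Xi K :=
  ⟨puncturedClass v, Set.mem_iUnion.2 ⟨v, MulAction.mem_orbit_self _⟩⟩

variable (K) (Fq : Type*) [Field Fq] [Fintype Fq] [Algebra Fq K]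

lemma finite_mulSupport_absVal (a : Idele K) :
    (Function.mulSupport fun v : Place K => v.absVal Fq ((a : Adele K) v)).Finite := by
  have h1 := (a : Adele K).2
  have h2 := ((a⁻¹ : Idele K) : Adele K).2
  have h := h1.and h2
  rw [Filter.eventually_cofinite] at h
  refine h.subset fun v hv hc => hv ?_
  have h3 := Idele.mul_inv_apply K a v
  have h4 : Valued.v ((a : Adele K) v) = (1 : ℤᵐ⁰) := by
    refine le_antisymm hc.1 ?_
    have h5 := congrArg (Valued.v : Valuation v.Completion ℤᵐ⁰) h3
    rw [map_mul, map_one] at h5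
    rw [← h5]
    exact mul_le_of_le_one_right' hc.2
  simp only [Place.absVal, MonoidWithZeroHom.comp_apply]
  exact (congrArg _ h4).trans (map_one _)

/-- The norm `|a| = ∏_v |a_v|_v ∈ ℝ_+^*` of an idele. -/
def ideleNorm : Idele K →* ℝ≥0ˣ :=
  MonoidHom.toHomUnits
    { toFun := fun a => ∏ᶠ v : Place K, v.absVal Fq ((a : Adele K) v)
      map_one' := by simp
      map_mul' := fun a b => by
        rw [← finprod_mul_distrib (finite_mulSupport_absVal K Fq a)
          (finite_mulSupport_absVal K Fq b)]
        simp }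

/-- The subgroup `C_{K,1} ⊆ C_K` of idele classes of norm one. -/
def normOne : Subgroup (IdeleClass K) :=
  (ideleNorm K Fq).ker.map (QuotientGroup.mk' (principal K))

/-- The quotient `Ξ_K / C_{K,1}`. -/
abbrev XiQuotient : Type _ := MulAction.orbitRel.Quotient (normOne K Fq) (Xi K)

/-- `C_K` acts on `Ξ_K / C_{K,1}`; the subgroup `C_{K,1}` acts trivially. -/
instance : MulAction (IdeleClass K) (XiQuotient K Fq) where
  smul c := Quotient.map (fun x : Xi K => c • x) (by
    rintro x y ⟨d, rfl⟩
    refine ⟨d, ?_⟩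
    change (d : IdeleClass K) • c • y = c • (d : IdeleClass K) • y
    exact (mul_smul (d : IdeleClass K) c y).symm.trans
      ((congrArg (· • y) (mul_comm (d : IdeleClass K) c)).trans (mul_smul c (d : IdeleClass K) y)))
  one_smul x := by
    induction x using Quotient.inductionOn with
    | _ x => exact congrArg (Quotient.mk _) (one_smul (IdeleClass K) x)
  mul_smul c d x := by
    induction x using Quotient.inductionOn with
    | _ x => exact congrArg (Quotient.mk _) (mul_smul c d x)

variable {K}

/-- The class of `a^(v)` in `Ξ_K / C_{K,1}`. -/
def XiQuotient.base (v : Place K) : XiQuotient K Fq := Quotient.mk _ (Xi.base v)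

end Adeles

/-! ### Curves over a finite field and their geometric points -/

section Curve

variable (Fq : Type u) [Field Fq] (C : Scheme.{u}) [C.Over (Spec (.of Fq))]

/-- The function field `𝔽_q(C)` as an extension of `𝔽_q`, through the structure morphism. -/
instance [IsIntegral C] : Algebra Fq C.functionField :=
  RingHom.toAlgebra
    ((C.presheaf.germ ⊤ (genericPoint C) trivial).hom.comp
      (((C ↘ Spec (.of Fq)).appTop).hom.comp (Scheme.ΓSpecIso (.of Fq)).inv.hom))

/-- `C(𝔽̄_q)`: the morphisms `Spec 𝔽̄_q ⟶ C` over `Spec 𝔽_q`. -/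
def GeomPoint : Type u :=
  {x : Spec (.of (AlgebraicClosure Fq)) ⟶ C //
    x ≫ (C ↘ Spec (.of Fq)) =
      Spec.map (CommRingCat.ofHom (algebraMap Fq (AlgebraicClosure Fq)))}

namespace GeomPoint

variable {Fq C}

/-- An automorphism `σ` of `𝔽̄_q` over `𝔽_q` acts on `C(𝔽̄_q)`: it applies `σ` to the coordinates
of a point. -/
def galois (σ : AlgebraicClosure Fq ≃ₐ[Fq] AlgebraicClosure Fq) (x : GeomPoint Fq C) :
    GeomPoint Fq C :=
  ⟨Spec.map (CommRingCat.ofHom (σ : AlgebraicClosure Fq →+* AlgebraicClosure Fq)) ≫ x.1, by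
    rw [Category.assoc, x.2, ← Spec.map_comp, ← CommRingCat.ofHom_comp]
    congr 2
    ext c
    simp⟩

lemma galois_refl (x : GeomPoint Fq C) : galois AlgEquiv.refl x = x :=
  Subtype.ext ((congrArg (· ≫ x.1) (Spec.map_id _)).trans (Category.id_comp x.1))

lemma galois_galois (σ τ : AlgebraicClosure Fq ≃ₐ[Fq] AlgebraicClosure Fq) (x : GeomPoint Fq C) :
    galois σ (galois τ x) = galois (τ.trans σ) x := by
  apply Subtype.ext
  simp only [galois]
  rw [← Category.assoc, ← Spec.map_comp, ← CommRingCat.ofHom_comp]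
  rfl

variable (Fq C)

/-- The Frobenius permutation of `C(𝔽̄_q)`: it raises the coordinates of a point to the
power `q`. -/
def frobenius [Fintype Fq] : Equiv.Perm (GeomPoint Fq C) where
  toFun := galois (FiniteField.frobeniusAlgEquivOfAlgebraic Fq (AlgebraicClosure Fq))
  invFun := galois (FiniteField.frobeniusAlgEquivOfAlgebraic Fq (AlgebraicClosure Fq)).symm
  left_inv x := by
    rw [galois_galois, AlgEquiv.self_trans_symm, galois_refl]
  right_inv x := by
    rw [galois_galois, AlgEquiv.symm_trans_self, galois_refl]

variable {Fq C}

/-- The point of the scheme `C` underlying a geometric point. -/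
def center (x : GeomPoint Fq C) : C := x.1 (IsLocalRing.closedPoint (AlgebraicClosure Fq))

/-- The geometric point `x` lies over the place `v`: the local ring of `C` at the point
underlying `x` is the valuation ring of `v`, inside the function field. -/
def LiesOver [IsIntegral C] (x : GeomPoint Fq C) (v : Place C.functionField) : Prop :=
  ∀ f : C.functionField, v.val f ≤ 1 ↔
    f ∈ Set.range (algebraMap (C.presheaf.stalk x.center) C.functionField)

end GeomPoint

end Curve

end

end AdeleClass

open AdeleClass

/-! Both sides are sets with a `ℤ`-action whose orbits are indexed by the places, the orbit of `v`
being a copy of `ℤ/n_v`. Once this is known, an equivariant bijection is the same as a choice of one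
point over each place (`existsUnique_equivariant_equiv`).

Adelic side. If `c a^(v)` and `a^(w)` agree modulo `K^*`, the vanishing component forces `v = w`,
and the other components show that `c` is the class of an idele concentrated at `v`. Such ideles
have norms exactly `N_v`, so modulo `C_{K,1}` the stabilizer is `{c : |c| ∈ N_v}`. The norm descends
to `C_K` by the product formula (`Divisor.degree_div`), which comes from counting zeros and poles of
`f` by `[K : F_q(f)]`.

The deep point is `N = q^ℤ`: the degrees `n_v` have no common factor (F. K. Schmidt,
`exists_not_dvd_deg`). Suppose `ℓ > 1` divides all of them, and let `p` be irreducible of degree `ℓ`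
over `F_q`. Geometric irreducibility makes `K' = K[X]/(p)` a field. Since `p` has at least two roots
in each `κ(v)`, and these lift to `K_v`, every `v` has at least two places of `K'` above it with the
same degree over `F_q`. Pairs of effective divisors of `K` then inject into the effective divisors
of `K'`, giving at least about `k q^(ke)` of degree `ke`; but there are only `O(q^n)` of degree `n`.
In terms of zeta functions, that of `K'` would have a double pole. The two counts rest on Riemann's
inequality and on the finiteness of the spaces `L(D)`, developed here directly from valuations.

Geometric side. The local rings of a smooth curve at its non-generic points are discrete valuation
rings, so every geometric point lies over one place; properness gives every place a center. The
points over `v` are the `F_q`-embeddings of `κ(v)` into the algebraic closure, and Frobenius powers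
permute them transitively with stabilizer `n_v ℤ`. -/

namespace AdeleClass
noncomputable section

/-! ### Places, their valuation rings, and weak approximation -/

namespace Place
open WithZero

variable {K : Type*} [Field K] (v w : Place K)

lemma exp_lt_one_iff {n : ℤ} : (exp n : ℤᵐ⁰) < 1 ↔ n < 0 := by
  rw [← exp_zero, exp_lt_exp]

lemma exp_le_one_iff {n : ℤ} : (exp n : ℤᵐ⁰) ≤ 1 ↔ n ≤ 0 := by
  rw [← exp_zero, exp_le_exp]

lemma ne_zero_of_val_eq_exp {v : Place K} {f : K} {n : ℤ} (h : v.val f = exp n) : f ≠ 0 := by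
  rintro rfl
  rw [map_zero] at h
  exact exp_ne_zero h.symm

lemma exists_val_eq_exp (n : ℤ) : ∃ f : K, f ≠ 0 ∧ v.val f = exp n := by
  obtain ⟨f, hf⟩ := v.surjective (exp n)
  exact ⟨f, ne_zero_of_val_eq_exp hf, hf⟩

lemma eq_of_val_eq {v w : Place K} (h : v.val = w.val) : v = w := by
  cases v; cases w; congr

/-- A place is determined by its valuation ring. -/
lemma eq_of_le_one_iff {v w : Place K} (h : ∀ f, v.val f ≤ 1 ↔ w.val f ≤ 1) : v = w := by
  have hE : v.val.IsEquiv w.val := Valuation.isEquiv_iff_val_le_one.2 (fun {x} => h x)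
  obtain ⟨π, hπ0, hπ⟩ := v.exists_val_eq_exp (-1)
  have hw0 : w.val π ≠ 0 := by simpa using hπ0
  set k := log (w.val π) with hk
  have hwπ : w.val π = exp k := (exp_log hw0).symm
  -- `f π ^ n` is a unit for `v`, hence for `w`: so `w` is `v` rescaled by `-k`. As `w` also has
  -- value group `ℤ`, the scale must be `1`.
  have key : ∀ (f : K) (n : ℤ), v.val f = exp n → w.val f = exp (-n * k) := by
    intro f n hf
    have h1 : v.val (f * π ^ n) = 1 := by
      rw [map_mul, map_zpow₀, hf, hπ, ← exp_zsmul, ← exp_add]; simp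
    have h2 := (Valuation.isEquiv_iff_val_eq_one.1 hE).1 h1
    rw [map_mul, map_zpow₀, hwπ, ← exp_zsmul] at h2
    have h3 := eq_inv_of_mul_eq_one_left h2
    rw [h3, ← exp_neg]; simp
  have hklt : k < 0 := by
    have : w.val π < 1 := (Valuation.isEquiv_iff_val_lt_one.1 hE).1 (by rw [hπ, exp_lt_one_iff]; simp)
    rw [hwπ, ← exp_zero] at this
    exact exp_lt_exp.1 this
  obtain ⟨ϖ, hϖ0, hϖ⟩ := w.exists_val_eq_exp (-1)
  have hv0 : v.val ϖ ≠ 0 := by simpa using hϖ0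
  have h4 := key ϖ _ (exp_log hv0).symm
  rw [hϖ, exp_inj] at h4
  have hk1 : k = -1 := by
    have : k ∣ 1 := ⟨log (v.val ϖ), by linarith⟩
    have := Int.le_of_dvd one_pos (neg_dvd.2 this)
    omega
  apply eq_of_val_eq
  ext f
  by_cases hf : f = 0
  · simp [hf]
  have hvf : v.val f ≠ 0 := by simpa using hf
  rw [key f _ (exp_log hvf).symm, hk1]
  simp [exp_log hvf]

/-- A real absolute value attached to a place. -/
def abv : AbsoluteValue K ℝ where
  toFun f := WithZeroMulInt.toNNReal (e := 2) two_ne_zero (v.val f)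
  map_mul' a b := by simp
  nonneg' a := by simp
  eq_zero' a := by simp
  add_le' a b := by
    have hm := (WithZeroMulInt.toNNReal_strictMono (e := 2) one_lt_two).monotone
    have h1 := hm (v.val.map_add a b)
    rw [hm.map_max] at h1
    exact_mod_cast h1.trans (max_le_add_of_nonneg (zero_le) (zero_le))

lemma abv_lt_iff (f g : K) : v.abv f < v.abv g ↔ v.val f < v.val g := by
  have h := (WithZeroMulInt.toNNReal_strictMono (e := 2) one_lt_two).lt_iff_lt
    (a := v.val f) (b := v.val g)
  rw [← h]; exact NNReal.coe_lt_coe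

/-- Weak approximation. -/
lemma exists_approx {ι : Type*} [Finite ι] (p : ι → Place K) (hp : Function.Injective p)
    (a : ι → K) (n : ι → ℤ) : ∃ x : K, ∀ i, (p i).val (x - a i) < exp (n i) := by
  have hne : ∀ i, ((p i).abv).IsNontrivial := fun i => by
    obtain ⟨π, hπ0, hπ⟩ := (p i).exists_val_eq_exp (-1)
    have : (p i).abv π < (p i).abv 1 := by
      rw [abv_lt_iff, hπ, map_one, exp_lt_one_iff]; simp
    rw [map_one] at this
    exact ⟨π, hπ0, this.ne⟩
  have hpair : Pairwise fun i j => ¬ ((p i).abv).IsEquiv ((p j).abv) := by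
    intro i j hij h
    refine hij (hp (eq_of_le_one_iff fun f => ?_))
    have h1 := h.lt_iff_lt (x := 1) (y := f)
    rw [abv_lt_iff, abv_lt_iff, map_one, map_one] at h1
    exact not_lt.symm.trans ((not_congr h1).trans not_lt)
  -- `K` is dense in the product of its copies for pairwise inequivalent nontrivial absolute values.
  -- The elements `y i` turn the integers `n i` into radii of balls.
  have hd := AbsoluteValue.denseRange_algebraMap_pi hne hpair
  choose y hy0 hy using fun i => (p i).exists_val_eq_exp (n i)
  let U : Set ((i : ι) → WithAbs ((p i).abv)) :=
    Set.univ.pi fun i => Metric.ball (WithAbs.toAbs _ (a i)) ((p i).abv (y i))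
  have hU : IsOpen U := isOpen_set_pi Set.finite_univ fun i _ => Metric.isOpen_ball
  obtain ⟨x, hx⟩ := hd.exists_mem_open hU ⟨fun i => WithAbs.toAbs _ (a i), fun i _ =>
    Metric.mem_ball_self ((p i).abv.pos (hy0 i))⟩
  refine ⟨x, fun i => ?_⟩
  have h1 := hx i trivial
  rw [Metric.mem_ball, dist_eq_norm, ← hy, ← abv_lt_iff] at *
  exact h1

end Place

/-! ### Linear independence over `F(s)` by reduction modulo `s` -/

section LinearIndependence
open Polynomial IntermediateField IntermediateField.algebraAdjoinAdjoin

variable {F K : Type*} [Field F] [Field K] [Algebra F K]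

/-- Modulo `sM` a relation `∑ p_i(s) a_i = 0` only sees the constant coefficients, which `H` kills.
Dividing by `s` gives a relation between the shifted polynomials, and the argument repeats. -/
lemma coeff_eq_zero_of_sum_aeval_mul_eq_zero {I : Type*} [Fintype I] {s : K} (hs : s ≠ 0)
    (M : Subalgebra F K) (hsM : s ∈ M) {a : I → K} (ha : ∀ i, a i ∈ M)
    (H : ∀ c : I → F, (∃ y ∈ M, ∑ i, c i • a i = s * y) → c = 0) (n : ℕ) :
    ∀ p : I → F[X], ∑ i, aeval s (p i) * a i = 0 → ∀ i, (p i).coeff n = 0 := by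
  have key : ∀ p : I → F[X], ∑ i, aeval s (p i) * a i = 0 →
      (∀ i, (p i).coeff 0 = 0) ∧ ∑ i, aeval s ((p i).divX) * a i = 0 := by
    intro p hp
    have h1 : ∀ i, aeval s (p i) = s * aeval s ((p i).divX) + algebraMap F K ((p i).coeff 0) := by
      intro i
      conv_lhs => rw [← X_mul_divX_add (p i)]
      rw [map_add, map_mul, aeval_X, aeval_C]
    have h2 : ∑ i, (p i).coeff 0 • a i = s * (-∑ i, aeval s ((p i).divX) * a i) := by
      simp_rw [h1, add_mul, Finset.sum_add_distrib, mul_assoc, ← Finset.mul_sum,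
        ← Algebra.smul_def] at hp
      linear_combination hp
    have h3 : (fun i => (p i).coeff 0) = 0 := by
      refine H _ ⟨_, M.neg_mem (M.sum_mem fun i _ => M.mul_mem ?_ (ha i)), h2⟩
      exact (Algebra.adjoin_le (Set.singleton_subset_iff.2 hsM)) (aeval_mem_adjoin_singleton F s)
    have h4 : ∀ i, (p i).coeff 0 = 0 := fun i => congrFun h3 i
    refine ⟨h4, ?_⟩
    simp only [h4, zero_smul, Finset.sum_const_zero] at h2
    simpa [hs] using h2.symm
  induction n with
  | zero => exact fun p hp => (key p hp).1
  | succ n ih => exact fun p hp i => by simpa using ih _ (key p hp).2 i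

/-- Denominators can be cleared, so only relations over `F[s]` matter. This turns independence over
`F(s)` into independence over `F` in `M/sM`; it is used with `M` a semilocal ring of functions and
with `M` a valuation ring. -/
lemma linearIndependent_adjoin_of_reduction {I : Type*} [Fintype I] {s : K} (hs : s ≠ 0)
    (M : Subalgebra F K) (hsM : s ∈ M) {a : I → K} (ha : ∀ i, a i ∈ M)
    (H : ∀ c : I → F, (∃ y ∈ M, ∑ i, c i • a i = s * y) → c = 0) :
    LinearIndependent F⟮s⟯ a := by
  rw [← LinearIndependent.iff_fractionRing (Algebra.adjoin F {s}) F⟮s⟯]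
  rw [Fintype.linearIndependent_iff]
  intro g hg
  have h1 : ∀ i, ∃ p : F[X], aeval s p = (g i : K) := fun i => by
    exact AlgHom.mem_range _ |>.1 ((Algebra.adjoin_singleton_eq_range_aeval F s).le (g i).2)
  choose p hp using h1
  have h2 : ∑ i, aeval s (p i) * a i = 0 := by
    rw [← hg]
    exact Finset.sum_congr rfl fun i _ => by rw [hp]; rfl
  intro i
  apply Subtype.ext
  rw [← hp, show p i = 0 from Polynomial.ext fun n =>
    coeff_eq_zero_of_sum_aeval_mul_eq_zero hs M hsM ha H n p h2 i]
  simp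

end LinearIndependence

/-! ### Bounding the zeros of a function by the degree over `F_q(s)` -/

namespace Place
open WithZero

variable {K : Type*} [Field K] (v w : Place K)

/-- A uniformizer at `v`. -/
def uniformizer : K := (v.exists_val_eq_exp (-1)).choose

lemma uniformizer_ne_zero : v.uniformizer ≠ 0 := (v.exists_val_eq_exp (-1)).choose_spec.1

lemma val_uniformizer : v.val v.uniformizer = exp (-1) := (v.exists_val_eq_exp (-1)).choose_spec.2

lemma val_uniformizer_zpow (n : ℤ) : v.val (v.uniformizer ^ n) = exp (-n) := by
  rw [map_zpow₀, val_uniformizer, ← exp_zsmul]; simp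

lemma lt_exp_iff_le {x : ℤᵐ⁰} {n : ℤ} : x < exp n ↔ x ≤ exp (n - 1) := by
  by_cases hx : x = 0
  · simp [hx, ]
  · rw [← log_lt_iff_lt_exp hx, ← log_le_iff_le_exp hx]; omega

lemma residue_eq_zero_iff (x : v.val.valuationSubring) :
    IsLocalRing.residue _ x = 0 ↔ v.val (x : K) < 1 := by
  rw [IsLocalRing.residue_eq_zero_iff, ValuationSubring.valuation_lt_one_iff]
  exact (Valuation.isEquiv_iff_val_lt_one.1 v.val.isEquiv_valuation_valuationSubring).symm

variable (Fq : Type*) [Field Fq] [Fintype Fq] [Algebra Fq K]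

/-- The elements with a pole of order at most `n` at `v`. -/
def ball (n : ℤ) : Submodule Fq K where
  carrier := {f | v.val f ≤ exp n}
  add_mem' {a b} ha hb := v.val.map_add_le ha hb
  zero_mem' := by simp
  smul_mem' c f hf := by
    rw [Set.mem_ofPred_eq, Algebra.smul_def, map_mul]
    exact (mul_le_of_le_one_left' (v.val_algebraMap_le_one Fq c)).trans hf

variable {Fq} in
lemma mem_ball {n : ℤ} {f : K} : f ∈ v.ball Fq n ↔ v.val f ≤ exp n := Iff.rfl

/-- The leading coefficient at `v`, in terms of the chosen uniformizer. -/
def leadingCoeff (n : ℤ) : v.ball Fq n →ₗ[Fq] v.Residue where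
  toFun f := IsLocalRing.residue v.val.valuationSubring ⟨f * v.uniformizer ^ n, by
    rw [Valuation.mem_valuationSubring_iff, map_mul, val_uniformizer_zpow]
    calc v.val f.1 * exp (-n) ≤ exp n * exp (-n) := mul_le_mul_left (v.mem_ball.1 f.2) _
      _ = 1 := by rw [← exp_add]; simp⟩
  map_add' f g := by
    rw [← map_add]; congr 1; apply Subtype.ext; simp [add_mul]
  map_smul' c f := by
    rw [RingHom.id_apply, Algebra.smul_def]
    refine (congrArg (IsLocalRing.residue _) (Subtype.ext ?_)).trans
      (map_mul (IsLocalRing.residue _) (v.constants Fq c) _)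
    change (c • (f : K)) * _ = algebraMap Fq K c * (f * _)
    rw [Algebra.smul_def, mul_assoc]

/-- The graded pieces of the filtration by pole order at `v` thus embed in `κ(v)`; all dimension
bounds below come from this. -/
lemma leadingCoeff_eq_zero_iff {n : ℤ} (f : v.ball Fq n) :
    v.leadingCoeff Fq n f = 0 ↔ (f : K) ∈ v.ball Fq (n - 1) := by
  change IsLocalRing.residue _ _ = 0 ↔ _
  rw [residue_eq_zero_iff, mem_ball, ← lt_exp_iff_le, map_mul, val_uniformizer_zpow, exp_neg,
    ← div_eq_mul_inv, div_lt_one₀ exp_pos]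

lemma leadingCoeff_surjective (n : ℤ) : Function.Surjective (v.leadingCoeff Fq n) := by
  intro y
  obtain ⟨x, rfl⟩ := IsLocalRing.residue_surjective y
  refine ⟨⟨x * v.uniformizer ^ (-n), ?_⟩, ?_⟩
  · rw [mem_ball, map_mul, val_uniformizer_zpow, neg_neg]
    exact mul_le_of_le_one_left' x.2
  · change IsLocalRing.residue _ _ = _
    congr 1
    apply Subtype.ext
    simp [zpow_ne_zero _ v.uniformizer_ne_zero]

lemma ball_mono {m n : ℤ} (h : m ≤ n) : v.ball Fq m ≤ v.ball Fq n :=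
  fun _ hf => le_trans (α := ℤᵐ⁰) hf (exp_le_exp.2 h)

open IntermediateField in
/-- The zeros of `s`, counted with multiplicities and degrees, are at most `[K : 𝔽_q(s)]`. -/
theorem sum_mul_le_finrank_adjoin {ι : Type*} [Fintype ι] (p : ι → Place K)
    (hp : Function.Injective p) {s : K} (hs : s ≠ 0) (e d : ι → ℕ)
    (he : ∀ i, (p i).val s ≤ exp (-(e i : ℤ)))
    (b : ∀ i, Fin (d i) → (p i).Residue) (hb : ∀ i, LinearIndependent Fq (b i))
    [FiniteDimensional Fq⟮s⟯ K] : ∑ i, e i * d i ≤ Module.finrank Fq⟮s⟯ K := by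
  classical
  -- One function for each zero `i`, each order `n < e i` and each vector of `b i`: it vanishes to
  -- order `n` at `p i` with that vector as leading coefficient.
  choose u hu using fun (k : Σ i, Fin (e i) × Fin (d i)) =>
    (p k.1).leadingCoeff_surjective Fq (-(k.2.1 : ℤ)) (b k.1 k.2.2)
  -- Weak approximation makes `a k` agree with `u k` at its own place and vanish at the others, each
  -- time up to order `e i`, so that the other places are invisible modulo `s`.
  choose a ha using fun (k : Σ i, Fin (e i) × Fin (d i)) =>
    exists_approx p hp (fun i => if i = k.1 then (u k : K) else 0) (fun i => -(e i : ℤ))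
  have ha1 : ∀ k i, i ≠ k.1 → a k ∈ (p i).ball Fq (-(e i : ℤ)) := fun k i h => by
    have := ha k i
    rw [if_neg h, sub_zero] at this
    exact this.le
  have ha2 : ∀ k, a k - u k ∈ (p k.1).ball Fq (-(k.2.1 : ℤ) - 1) := fun k => by
    have := ha k k.1
    rw [if_pos rfl] at this
    refine ball_mono _ Fq ?_ (show a k - u k ∈ (p k.1).ball Fq (-(e k.1 : ℤ)) from this.le)
    have := k.2.1.2
    omega
  have ha3 : ∀ k, a k ∈ (p k.1).ball Fq (-(k.2.1 : ℤ)) := fun k => by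
    have := add_mem (ball_mono _ Fq (by omega) (ha2 k)) (u k).2
    simpa using this
  have ha4 : ∀ k, (p k.1).leadingCoeff Fq _ ⟨a k, ha3 k⟩ = b k.1 k.2.2 := fun k => by
    rw [← hu, ← sub_eq_zero, ← map_sub, leadingCoeff_eq_zero_iff]
    exact ha2 k
  -- The functions regular at all the `p i`. An element of `sM` vanishes to order `e i` at each `p
  -- i`.
  let M : Subalgebra Fq K :=
    { carrier := {f | ∀ i, (p i).val f ≤ 1}
      mul_mem' := fun {x y} hx hy i => by
        rw [map_mul]; exact mul_le_one' (hx i) (hy i)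
      add_mem' := fun {x y} hx hy i => (p i).val.map_add_le (hx i) (hy i)
      algebraMap_mem' := fun c i => (p i).val_algebraMap_le_one Fq c }
  have hle : ∀ i (n : ℕ) (f : K), f ∈ (p i).ball Fq (-(n : ℤ)) → (p i).val f ≤ 1 :=
    fun i n f hf => le_trans (α := ℤᵐ⁰) hf (by rw [exp_le_one_iff]; omega)
  have hind : LinearIndependent Fq⟮s⟯ a := by
    refine linearIndependent_adjoin_of_reduction hs M (fun i => hle i _ _ (he i))
      (fun k i => ?_) ?_
    · by_cases h : i = k.1
      · subst h; exact hle _ _ _ (ha3 k)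
      · exact hle _ _ _ (ha1 k i h)
    rintro c ⟨y, hy, hsum⟩
    have h1 : ∀ i, ∑ k, c k • a k ∈ (p i).ball Fq (-(e i : ℤ)) := fun i => by
      rw [hsum, mem_ball, map_mul]
      exact (mul_le_of_le_one_right' (hy i)).trans (he i)
    have h2 : ∀ i, ∑ x : Fin (e i) × Fin (d i), c ⟨i, x⟩ • a ⟨i, x⟩ ∈
        (p i).ball Fq (-(e i : ℤ)) := fun i => by
      have h3 := h1 i
      rw [Fintype.sum_sigma, ← Finset.add_sum_erase _ _ (Finset.mem_univ i)] at h3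
      rwa [Submodule.add_mem_iff_left] at h3
      exact Submodule.sum_mem _ fun j hj => Submodule.sum_mem _ fun x _ =>
        Submodule.smul_mem _ _ (ha1 ⟨j, x⟩ i (Finset.ne_of_mem_erase hj).symm)
    -- Once the coefficients of order below `n` vanish, the terms of order `n` must cancel up to
    -- order `n + 1`, so their leading coefficients give a relation between the independent vectors
    -- `b i`.
    have h5 : ∀ i (n : ℕ) (hn : n < e i) (j), c ⟨i, ⟨n, hn⟩, j⟩ = 0 := by
      intro i n
      induction n using Nat.strong_induction_on with
      | _ n ih =>
        intro hn
        have h6 := ball_mono _ Fq (show -(e i : ℤ) ≤ -(n : ℤ) - 1 by omega) (h2 i)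
        rw [Fintype.sum_prod_type, ← Finset.add_sum_erase _ _ (Finset.mem_univ ⟨n, hn⟩),
          Submodule.add_mem_iff_left] at h6
        · have h7 := ((p i).leadingCoeff_eq_zero_iff Fq (n := -(n : ℤ))
            (∑ j, c ⟨i, ⟨n, hn⟩, j⟩ • ⟨a ⟨i, ⟨n, hn⟩, j⟩, ha3 ⟨i, ⟨n, hn⟩, j⟩⟩)).2 (by
              simpa using h6)
          rw [map_sum] at h7
          refine Fintype.linearIndependent_iff.1 (hb i) _ (h7 ▸ Finset.sum_congr rfl fun j _ => ?_)
          rw [map_smul, ha4 ⟨i, ⟨n, hn⟩, j⟩]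
        · refine Submodule.sum_mem _ fun m hm => Submodule.sum_mem _ fun j _ => ?_
          rcases lt_trichotomy m.1 n with h | h | h
          · rw [ih m h m.2 j, zero_smul]; exact zero_mem _
          · exact absurd (Fin.ext h) (Finset.ne_of_mem_erase hm)
          · exact Submodule.smul_mem _ _ (ball_mono _ Fq (by dsimp only; omega) (ha3 ⟨i, m, j⟩))
    ext ⟨i, ⟨n, hn⟩, j⟩
    exact h5 i n hn j
  simpa [Fintype.card_sigma] using hind.fintype_card_le_finrank

end Place

/-- `K` is a finitely generated field extension of `F` of transcendence degree one. -/
class IsFunctionFieldOfCurve (F K : Type*) [Field F] [Field K] [Algebra F K] : Prop extends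
    Algebra.EssFiniteType F K where
  trdeg_eq_one : Algebra.trdeg F K = 1

/-! ### Function fields of one variable: finite residue fields, finitely many zeros and poles -/

section
open IntermediateField Algebra AlgebraicIndependent

variable {F K : Type*} [Field F] [Field K] [Algebra F K]

lemma exists_transcendental_of_trdeg_eq_one (h : Algebra.trdeg F K = 1) :
    ∃ t : K, Transcendental F t := by
  have := trdeg_ne_zero_iff.1 (h ▸ one_ne_zero)
  exact this.transcendental

/-- In transcendence degree one, `t` alone is a transcendence basis, and an algebraic extension that
is essentially of finite type is finite. -/
lemma finiteDimensional_adjoin_of_transcendental [Algebra.EssFiniteType F K]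
    (h : Algebra.trdeg F K = 1) {t : K} (ht : Transcendental F t) :
    FiniteDimensional F⟮t⟯ K := by
  have h1 : AlgebraicIndependent F ![t] := by
    rw [algebraicIndependent_unique_type_iff]
    exact ht
  have h2 : IsTranscendenceBasis F ![t] :=
    h1.isTranscendenceBasis_of_lift_trdeg_le (by simp [h]) (by simp [h])
  have h3 : Algebra.IsAlgebraic F⟮t⟯ K := by
    have := h2.isAlgebraic_field
    rwa [Matrix.range_cons, Matrix.range_empty, Set.union_empty] at this
  have : Algebra.EssFiniteType F⟮t⟯ K := Algebra.EssFiniteType.of_comp F F⟮t⟯ K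
  exact Algebra.finite_of_essFiniteType_of_isAlgebraic
end

namespace Place
open WithZero

variable {K : Type*} [Field K] (v w : Place K)
variable (Fq : Type*) [Field Fq] [Fintype Fq] [Algebra Fq K]

variable {Fq} in
lemma val_le_one_of_isIntegral_adjoin {f x : K} (hf : v.val f ≤ 1)
    (hx : IsIntegral (Algebra.adjoin Fq {f}) x) : v.val x ≤ 1 := by
  have hle : (Algebra.adjoin Fq {f}).toSubring ≤ v.val.valuationSubring.toSubring := by
    intro y hy
    induction hy using Algebra.adjoin_induction with
    | mem y hy => rwa [Set.mem_singleton_iff.1 hy]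
    | algebraMap c => exact v.val_algebraMap_le_one Fq c
    | add a b _ _ ha hb => exact add_mem ha hb
    | mul a b _ _ ha hb => exact mul_mem ha hb
  have h1 : IsIntegral v.val.valuationSubring x :=
    IsIntegral.map_of_comp_eq (Subring.inclusion hle) (RingHom.id K) rfl hx
  obtain ⟨y, rfl⟩ := IsIntegrallyClosed.isIntegral_iff.1 h1
  exact y.2

variable {Fq} in
-- Both `f` and `f⁻¹` are integral over the constants, and valuation rings are integrally closed.
lemma val_eq_one_of_isAlgebraic {f : K} (h0 : f ≠ 0) (hf : IsAlgebraic Fq f) : v.val f = 1 := by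
  have key : ∀ g : K, IsAlgebraic Fq g → v.val g ≤ 1 := fun g hg =>
    v.val_le_one_of_isIntegral_adjoin (Fq := Fq) (f := 0) (by simp) (hg.isIntegral.tower_top)
  refine le_antisymm (key f hf) ?_
  have := key _ hf.inv
  rw [map_inv₀] at this
  exact (inv_le_one₀ (by simpa [zero_lt_iff] using h0)).1 this

variable {Fq} in
lemma transcendental_of_val_ne_one {f : K} (h0 : f ≠ 0) (h : v.val f ≠ 1) :
    Transcendental Fq f := fun hf => h (v.val_eq_one_of_isAlgebraic h0 hf)

variable [IsFunctionFieldOfCurve Fq K]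

omit [Fintype Fq] in
variable {Fq} in
lemma finiteDimensional_adjoin {t : K} (ht : Transcendental Fq t) :
    FiniteDimensional (IntermediateField.adjoin Fq {t}) K :=
  finiteDimensional_adjoin_of_transcendental IsFunctionFieldOfCurve.trdeg_eq_one ht

/-- The bound on zeros, applied to a uniformizer and an arbitrary independent family in `κ(v)`,
bounds the size of the family. -/
instance finite_residue : Module.Finite Fq v.Residue := by
  have := finiteDimensional_adjoin (v.transcendental_of_val_ne_one (Fq := Fq) v.uniformizer_ne_zero
    (by rw [val_uniformizer]; exact (exp_lt_one_iff.2 (by simp)).ne))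
  refine Module.rank_lt_aleph0_iff.1 (lt_of_le_of_lt (rank_le
    (n := Module.finrank (IntermediateField.adjoin Fq {v.uniformizer}) K) fun s hs => ?_)
    (Cardinal.natCast_lt_aleph0))
  have h := sum_mul_le_finrank_adjoin Fq (fun _ : Unit => v) (fun _ _ _ => rfl)
    v.uniformizer_ne_zero (fun _ => 1) (fun _ => s.card) (fun _ => v.val_uniformizer.le)
    (fun _ => Subtype.val ∘ s.equivFin.symm) (fun _ => hs.comp _ s.equivFin.symm.injective)
  simpa using h

lemma deg_pos : 0 < v.deg Fq := Module.finrank_pos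

variable {Fq} in
lemma sum_mul_deg_le {ι : Type*} [Fintype ι] (p : ι → Place K)
    (hp : Function.Injective p) {s : K} (hs : Transcendental Fq s) (e : ι → ℕ)
    (he : ∀ i, (p i).val s ≤ exp (-(e i : ℤ))) :
    ∑ i, e i * (p i).deg Fq ≤ Module.finrank (IntermediateField.adjoin Fq {s}) K := by
  have := finiteDimensional_adjoin hs
  refine sum_mul_le_finrank_adjoin Fq p hp (fun h => ?_) e _ he
    (fun i => Module.finBasis Fq (p i).Residue) (fun i => (Module.finBasis Fq _).linearIndependent)
  subst h
  exact hs isAlgebraic_zero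

end Place

section
variable {K : Type*} [Field K]
open Place WithZero

/-- Each zero contributes at least one to a sum bounded by `[K : F_q(f)]`. -/
lemma finite_val_lt_one (Fq : Type*) [Field Fq] [Fintype Fq] [Algebra Fq K]
    [IsFunctionFieldOfCurve Fq K] {f : K} (hf : f ≠ 0) : {v : Place K | v.val f < 1}.Finite := by
  by_contra hinf
  obtain ⟨v, hv⟩ := Set.Infinite.nonempty hinf
  have hs := v.transcendental_of_val_ne_one (Fq := Fq) hf hv.ne
  obtain ⟨t, ht, hcard⟩ := Set.Infinite.exists_subset_card_eq hinf
    (Module.finrank (IntermediateField.adjoin Fq {f}) K + 1)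
  have h1 := sum_mul_deg_le (fun i : t => i.1) Subtype.val_injective hs (fun _ => 1) (fun i => by
    have : i.1.val f < 1 := ht i.2
    rw [← exp_zero, lt_exp_iff_le] at this
    simpa using this)
  have h2 : ∑ i : t, 1 ≤ ∑ i : t, 1 * i.1.deg Fq :=
    Finset.sum_le_sum fun i _ => by rw [one_mul]; exact i.1.deg_pos Fq
  simp at h1 h2
  omega

lemma finite_val_ne_one (Fq : Type*) [Field Fq] [Fintype Fq] [Algebra Fq K]
    [IsFunctionFieldOfCurve Fq K] {f : K} (hf : f ≠ 0) : {v : Place K | v.val f ≠ 1}.Finite := by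
  refine ((finite_val_lt_one Fq hf).union (finite_val_lt_one Fq (inv_ne_zero hf))).subset ?_
  intro v hv
  rcases lt_or_gt_of_ne hv with h | h
  · exact Or.inl h
  · exact Or.inr (by rw [Set.mem_ofPred_eq, map_inv₀]; exact inv_lt_one_of_one_lt₀ h)
end

namespace Place

variable (A K : Type*) [CommRing A] [IsDomain A] [IsDiscreteValuationRing A] [Field K]
  [Algebra A K] [IsFractionRing A K]

/-- The place of the fraction field of a discrete valuation ring. -/
def ofDVR : Place K where
  val := (IsDiscreteValuationRing.maximalIdeal A).valuation K
  surjective := IsDedekindDomain.HeightOneSpectrum.valuation_surjective K _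

lemma ofDVR_val_le_one_iff (f : K) : (ofDVR A K).val f ≤ 1 ↔ f ∈ Set.range (algebraMap A K) := by
  constructor
  · intro h
    exact IsDiscreteValuationRing.exists_lift_of_le_one h
  · rintro ⟨a, rfl⟩
    exact IsDedekindDomain.HeightOneSpectrum.valuation_le_one _ a

end Place

/-! ### Discreteness of valuation rings, and existence of zeros -/

section
open IntermediateField.algebraAdjoinAdjoin
variable {F K : Type*} [Field F] [Field K] [Algebra F K] [IsFunctionFieldOfCurve F K]

/-- Elements with distinct values in the interval are independent over `F(s)`: nonzero constants are
units, so a nontrivial combination has the largest of the values involved, which exceeds that of `s`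
and keeps it out of `sV`. -/
lemma _root_.ValuationSubring.finite_valuation_gt (V : ValuationSubring K)
    (hF : ∀ c : F, algebraMap F K c ∈ V) {s : K} (hs : Transcendental F s) (hsV : s ∈ V) :
    {γ | V.valuation s < γ ∧ γ ≤ 1}.Finite := by
  classical
  have hs0 : s ≠ 0 := fun h => hs (h ▸ isAlgebraic_zero)
  have := Place.finiteDimensional_adjoin hs
  by_contra hinf
  obtain ⟨t, ht, hcard⟩ := Set.Infinite.exists_subset_card_eq hinf
    (Module.finrank (IntermediateField.adjoin F {s}) K + 1)
  choose x hx using fun γ : t => V.valuation_surjective γ.1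
  let M : Subalgebra F K := { V.toSubring with algebraMap_mem' := hF }
  have hM : ∀ y, y ∈ M ↔ V.valuation y ≤ 1 := fun y => (V.valuation_le_one_iff y).symm
  have hind : LinearIndependent (IntermediateField.adjoin F {s}) x := by
    refine linearIndependent_adjoin_of_reduction hs0 M hsV
      (fun γ => (hM _).2 (by rw [hx]; exact (ht γ.2).2)) ?_
    rintro c ⟨y, hy, hsum⟩
    by_contra hc
    have hne : (Finset.univ.filter fun γ : t => c γ ≠ 0).Nonempty := by
      obtain ⟨γ, hγ⟩ := Function.ne_iff.1 hc
      exact ⟨γ, by simpa using hγ⟩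
    have hcv : ∀ c : F, c ≠ 0 → V.valuation (algebraMap F K c) = 1 := fun c hc => by
      refine le_antisymm ((V.valuation_le_one_iff _).2 (hF c)) ?_
      have := (V.valuation_le_one_iff _).2 (hF c⁻¹)
      rw [map_inv₀, map_inv₀] at this
      exact (inv_le_one₀ (by simpa [zero_lt_iff] using hc)).1 this
    obtain ⟨γ, hγ, hmax⟩ := Finset.exists_max_image _ (fun γ : t => γ.1) hne
    have h1 : V.valuation (∑ δ, c δ • x δ) = γ.1 := by
      have hval : ∀ δ, c δ ≠ 0 → V.valuation (c δ • x δ) = δ.1 := fun δ hδ => by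
        rw [Algebra.smul_def, map_mul, hcv _ hδ, one_mul, hx]
      rw [← hval γ (by simpa using hγ)]
      refine Valuation.map_sum_eq_of_lt _ (Finset.mem_univ γ) ?_
      intro δ hδ
      rw [hval γ (by simpa using hγ)]
      by_cases hδ0 : c δ = 0
      · simpa [hδ0] using (lt_of_le_of_lt zero_le (ht γ.2).1)
      · rw [hval δ hδ0]
        exact lt_of_le_of_ne (hmax δ (by simpa using hδ0))
          fun h => (Finset.mem_sdiff.1 hδ).2 (by simpa using Subtype.ext h)
    have h2 : V.valuation (s * y) ≤ V.valuation s := by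
      rw [map_mul]; exact mul_le_of_le_one_right' ((hM y).1 hy)
    rw [← hsum, h1] at h2
    exact absurd (ht γ.2).1 h2.not_gt
  have := hind.fintype_card_le_finrank
  simp [hcard] at this

/-- Some nonzero `p(s)` makes `p(s) x⁻¹` integral over `F[s]`, hence an element of `V`; and `p(s)`
has the value of `s ^ N`, where `N` is the order of `p` at `0`. -/
lemma _root_.ValuationSubring.exists_pow_le_valuation (V : ValuationSubring K)
    (hF : ∀ c : F, algebraMap F K c ∈ V) {s : K} (hs : Transcendental F s)
    (hsV : V.valuation s < 1) {x : K} (hx : x ≠ 0) :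
    ∃ N : ℕ, V.valuation s ^ N ≤ V.valuation x := by
  have := Place.finiteDimensional_adjoin hs
  have hle : (Algebra.adjoin F {s}).toSubring ≤ V.toSubring := by
    intro y hy
    induction hy using Algebra.adjoin_induction with
    | mem y hy =>
      rw [Set.mem_singleton_iff.1 hy]; exact (V.valuation_le_one_iff _).1 hsV.le
    | algebraMap c => exact hF c
    | add a b _ _ ha hb => exact add_mem ha hb
    | mul a b _ _ ha hb => exact mul_mem ha hb
  have hx1 : IsAlgebraic (Algebra.adjoin F {s}) x⁻¹ := by
    have := Algebra.IsAlgebraic.trans (Algebra.adjoin F {s}) (IntermediateField.adjoin F {s}) K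
    exact Algebra.IsAlgebraic.isAlgebraic _
  obtain ⟨⟨y, hy⟩, hy0, hint⟩ := hx1.exists_integral_multiple
  have hyV : y * x⁻¹ ∈ V := by
    have h1 : IsIntegral V (y * x⁻¹) :=
      IsIntegral.map_of_comp_eq (Subring.inclusion hle) (RingHom.id K) rfl hint
    obtain ⟨z, hz⟩ := IsIntegrallyClosed.isIntegral_iff.1 h1
    rw [← hz]; exact z.2
  have hyx : V.valuation y ≤ V.valuation x := by
    have := (V.valuation_le_one_iff _).2 hyV
    rwa [map_mul, map_inv₀, ← div_eq_mul_inv, div_le_one₀ (by simpa [zero_lt_iff] using hx)] at this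
  rw [Algebra.adjoin_singleton_eq_range_aeval] at hy
  obtain ⟨p, rfl⟩ := hy
  have hp0 : p ≠ 0 := by
    rintro rfl
    exact hy0 (Subtype.ext (map_zero _))
  obtain ⟨q, hq, hdvd⟩ := Polynomial.exists_eq_pow_rootMultiplicity_mul_and_not_dvd p hp0 0
  rw [map_zero, sub_zero] at hq hdvd
  refine ⟨p.rootMultiplicity 0, le_trans (le_of_eq ?_) hyx⟩
  suffices h : V.valuation (Polynomial.aeval s q) = 1 by
    conv_rhs => rw [hq]
    change _ = V.valuation (Polynomial.aeval s _)
    rw [map_mul, map_pow, Polynomial.aeval_X, map_mul, map_pow, h, mul_one]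
  rw [Polynomial.X_dvd_iff] at hdvd
  conv_lhs => rw [← Polynomial.X_mul_divX_add q]
  rw [map_add, map_mul, Polynomial.aeval_X, Polynomial.aeval_C]
  have hc : V.valuation (algebraMap F K (q.coeff 0)) = 1 := by
    refine le_antisymm ((V.valuation_le_one_iff _).2 (hF _)) ?_
    have := (V.valuation_le_one_iff _).2 (hF (q.coeff 0)⁻¹)
    rw [map_inv₀, map_inv₀] at this
    exact (inv_le_one₀ (by simpa [zero_lt_iff] using hdvd)).1 this
  refine (V.valuation.map_add_eq_of_lt_right ?_).trans hc
  rw [hc, map_mul]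
  refine (mul_le_of_le_one_right' ((V.valuation_le_one_iff _).2 (hle ?_))).trans_lt hsV
  exact Polynomial.aeval_mem_adjoin_singleton F s

/-- Finitely many values lie between that of `s` and `1`, so there is a largest value below `1`,
attained at some `π`. Powers of `π` drop below `s` and powers of `s` below anything nonzero, so
every nonzero element of `V` is a unit times a power of `π`. -/
lemma _root_.ValuationSubring.isDiscreteValuationRing_of_transcendental (V : ValuationSubring K)
    (hF : ∀ c : F, algebraMap F K c ∈ V) {s : K} (hs : Transcendental F s)
    (hsV : V.valuation s < 1) : IsDiscreteValuationRing V := by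
  have hs0 : s ≠ 0 := fun h => hs (h ▸ isAlgebraic_zero)
  have hvs : 0 < V.valuation s := by simpa [zero_lt_iff] using hs0
  have hfin := V.finite_valuation_gt hF hs ((V.valuation_le_one_iff _).1 hsV.le)
  have hT : {γ | V.valuation s ≤ γ ∧ γ < 1}.Finite := by
    refine (hfin.insert (V.valuation s)).subset fun γ hγ => ?_
    rcases hγ.1.eq_or_lt with h | h
    · exact Or.inl h.symm
    · exact Or.inr ⟨h, hγ.2.le⟩
  obtain ⟨γ, hγ, hmax⟩ := hT.exists_maximal ⟨_, le_rfl, hsV⟩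
  obtain ⟨π, rfl⟩ := V.valuation_surjective γ
  have hmax' : ∀ δ, δ < 1 → δ ≤ V.valuation π := fun δ hδ => by
    rcases le_total (V.valuation π) δ with h | h
    · exact hmax ⟨hγ.1.trans h, hδ⟩ h
    · exact h
  have hπ0 : 0 < V.valuation π := hvs.trans_le hγ.1
  have hπ0' : π ≠ 0 := by rintro rfl; simp at hπ0
  have harch : ∃ M : ℕ, V.valuation π ^ M ≤ V.valuation s := by
    by_contra! hc
    refine Set.infinite_of_injective_forall_mem
      (pow_right_injective₀ hπ0 hγ.2.ne) (fun M => ?_) hfin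
    exact ⟨hc M, pow_le_one₀ hπ0.le hγ.2.le⟩
  obtain ⟨M, hM⟩ := harch
  have halg : ∀ x : K, x ≠ 0 → ∃ N : ℕ, V.valuation s ^ N ≤ V.valuation x := fun x hx =>
    V.exists_pow_le_valuation hF hs hsV hx
  refine IsDiscreteValuationRing.ofHasUnitMulPowIrreducibleFactorization
    ⟨⟨π, (V.valuation_le_one_iff _).1 hγ.2.le⟩, ⟨?_, ?_⟩, ?_⟩
  · rw [V.valuation_eq_one_iff]
    exact hγ.2.ne
  · intro a b hab
    by_contra! hc
    have key : ∀ a : V, ¬ IsUnit a → V.valuation a < 1 := fun a ha =>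
      lt_of_le_of_ne (V.valuation_le_one a) fun h => ha ((V.valuation_eq_one_iff a).2 h)
    have h1 : V.valuation π = V.valuation a * V.valuation b := by
      rw [← map_mul]; exact congrArg (fun z : V => V.valuation (z : K)) hab
    have ha0 : 0 < V.valuation (a : K) := by
      rw [zero_lt_iff]; intro h; rw [h, zero_mul] at h1; exact hπ0.ne' h1
    have h2 : V.valuation π < V.valuation a := by
      rw [h1]; exact mul_lt_of_lt_one_right ha0 (key b hc.2)
    exact absurd (hmax' _ (key a hc.1)) h2.not_ge
  · intro x hx
    have hx0 : (x : K) ≠ 0 := fun h => hx (Subtype.ext h)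
    obtain ⟨N, hN⟩ := halg x hx0
    have hex : ∃ n : ℕ, V.valuation π ^ (n + 1) < V.valuation x := by
      refine ⟨M * N, lt_of_lt_of_le ?_ (((pow_mul _ M N).trans_le
        (pow_le_pow_left₀ zero_le hM N)).trans hN)⟩
      exact pow_lt_pow_right_of_lt_one₀ hπ0 hγ.2 (Nat.lt_succ_self _)
    classical
    -- The least `n` with `π ^ (n + 1)` below `x` still has `x` at most `π ^ n`, so `x / π ^ n` has
    -- a value above that of `π` and at most `1`, that is `1`.
    have hn := Nat.find_spec hex
    set n := Nat.find hex with hn_def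
    have hle : V.valuation x ≤ V.valuation π ^ n := by
      rcases Nat.eq_zero_or_pos n with h | h
      · rw [h, pow_zero]; exact V.valuation_le_one x
      · have := Nat.find_min hex (m := n - 1) (by omega)
        rwa [Nat.sub_add_cancel h, not_lt] at this
    have hquot : V.valuation (x / π ^ n) = 1 := by
      have hlt : V.valuation π < V.valuation (x / π ^ n) := by
        rw [map_div₀, map_pow, lt_div_iff₀ (pow_pos hπ0 n), ← pow_succ']
        exact hn
      refine le_antisymm ?_ (not_lt.1 fun h => absurd (hmax' _ h) hlt.not_ge)
      rw [map_div₀, map_pow]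
      exact div_le_one_of_le₀ hle zero_le
    refine ⟨n, ?_⟩
    have hmem : x / π ^ n ∈ V := (V.valuation_le_one_iff _).1 hquot.le
    refine ⟨((V.valuation_eq_one_iff ⟨_, hmem⟩).2 hquot).unit, Subtype.ext ?_⟩
    change π ^ n * (x / π ^ n) = x
    field_simp

open Place IntermediateField.algebraAdjoinAdjoin in
/-- Every transcendental element has a zero. -/
theorem exists_place_val_lt_one {s : K} (hs : Transcendental F s) :
    ∃ v : Place K, v.val s < 1 := by
  let A := (Algebra.adjoin F {s}).toSubring
  let s' : A := ⟨s, Algebra.self_mem_adjoin_singleton F s⟩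
  have hI : Ideal.span {s'} ≠ ⊤ := by
    rw [Ne, Ideal.span_singleton_eq_top, isUnit_iff_exists_inv]
    rintro ⟨⟨y, hy⟩, h⟩
    change y ∈ Algebra.adjoin F {s} at hy
    rw [Algebra.adjoin_singleton_eq_range_aeval] at hy
    obtain ⟨p, rfl⟩ := hy
    have h1 : Polynomial.aeval s (Polynomial.X * p - 1) = 0 := by
      have := congrArg Subtype.val h
      simp only [map_sub, map_mul, Polynomial.aeval_X, map_one]
      exact sub_eq_zero.2 this
    have h2 := transcendental_iff.1 hs _ h1
    have := congrArg (Polynomial.eval 0) h2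
    simp at this
  -- As `s` is not a unit in `F[s]`, some valuation ring contains `F[s]` with `s` among its
  -- nonunits; the previous lemma makes it discrete.
  obtain ⟨V, hAV, hIV⟩ := Ideal.image_subset_nonunits_valuationSubring _ hI
  have hsV : V.valuation s < 1 :=
    V.mem_nonunits_iff.1 (hIV ⟨s', Ideal.mem_span_singleton_self _, rfl⟩)
  have := V.isDiscreteValuationRing_of_transcendental
    (fun c => hAV (Subalgebra.algebraMap_mem (Algebra.adjoin F {s}) c)) hs hsV
  refine ⟨ofDVR V K, ?_⟩
  have hs0 : s ≠ 0 := fun h => hs (h ▸ isAlgebraic_zero)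
  by_contra! hc
  have : (ofDVR V K).val s⁻¹ ≤ 1 := by
    rw [map_inv₀]; exact inv_le_one_of_one_le₀ hc
  rw [ofDVR_val_le_one_iff] at this
  obtain ⟨y, hy⟩ := this
  have h3 := (V.valuation_le_one_iff _).2 y.2
  change V.valuation (algebraMap V K y) ≤ 1 at h3
  rw [hy, map_inv₀] at h3
  exact absurd ((inv_le_one₀ (by simpa [zero_lt_iff] using hs0)).1 h3) hsV.not_ge

end

/-- Divisors, as finitely supported functions on the places. -/
abbrev Divisor (K : Type*) [Field K] : Type _ := Place K →₀ ℤ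

/-! ### Divisors and the finiteness of the spaces `L(D)` -/

namespace Divisor
open WithZero Place

variable {K : Type*} [Field K] (Fq : Type*) [Field Fq] [Fintype Fq] [Algebra Fq K]

/-- The degree of a divisor. -/
def degree : Divisor K →ₗ[ℤ] ℤ := Finsupp.linearCombination ℤ fun v => (v.deg Fq : ℤ)

lemma degree_single (v : Place K) (n : ℤ) :
    degree Fq (Finsupp.single v n) = n * v.deg Fq := by
  simp [degree]

/-- The Riemann-Roch space `L(D)`. -/
def space (D : Divisor K) : Submodule Fq K := ⨅ v : Place K, v.ball Fq (D v)

variable {Fq} in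
lemma mem_space {D : Divisor K} {f : K} : f ∈ space Fq D ↔ ∀ v : Place K, v.val f ≤ exp (D v) := by
  simp [space, mem_ball]

lemma space_mono {D E : Divisor K} (h : D ≤ E) : space Fq D ≤ space Fq E := fun _ hf =>
  mem_space.2 fun v => (mem_space.1 hf v).trans (exp_le_exp.2 (h v))

/-- An effective divisor as a divisor. -/
def ofNat : (Place K →₀ ℕ) →+ Divisor K := Finsupp.mapRange.addMonoidHom (Nat.castAddMonoidHom ℤ)

@[simp] lemma ofNat_apply (E : Place K →₀ ℕ) (v : Place K) : ofNat E v = E v := rfl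

lemma ofNat_single (v : Place K) (n : ℕ) : ofNat (Finsupp.single v n) = Finsupp.single v (n : ℤ) :=
  Finsupp.mapRange_single (hf := Nat.cast_zero)

lemma ofNat_injective : Function.Injective (ofNat (K := K)) := fun D E h => by
  ext v
  have := DFunLike.congr_fun h v
  simpa using this

lemma exists_ofNat_eq {D : Divisor K} (h : 0 ≤ D) : ∃ E, ofNat E = D :=
  ⟨D.mapRange Int.toNat rfl, by ext v; simpa using h v⟩

variable [IsFunctionFieldOfCurve Fq K]

/-- The leading coefficient at `v` maps `L(D + v)` to `κ(v)`, with kernel inside `L(D)`. -/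
lemma finrank_space_add_single (D : Divisor K) (v : Place K) [Module.Finite Fq (space Fq D)] :
    Module.Finite Fq (space Fq (D + Finsupp.single v 1)) ∧
      Module.finrank Fq (space Fq (D + Finsupp.single v 1)) ≤
        Module.finrank Fq (space Fq D) + v.deg Fq := by
  have hle : space Fq (D + Finsupp.single v 1) ≤ v.ball Fq (D v + 1) := fun f hf => by
    have := mem_space.1 hf v
    rwa [Finsupp.add_apply, Finsupp.single_eq_same] at this
  let φ := (v.leadingCoeff Fq (D v + 1)).comp (Submodule.inclusion hle)
  have hker : φ.ker ≤ (space Fq D).comap (Submodule.subtype _) := by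
    intro f hf
    have hf' : (f : K) ∈ v.ball Fq (D v + 1 - 1) :=
      (leadingCoeff_eq_zero_iff v Fq (Submodule.inclusion hle f)).1 hf
    rw [add_sub_cancel_right] at hf'
    rw [Submodule.mem_comap, mem_space]
    intro w
    by_cases h : w = v
    · subst h; exact hf'
    · have := mem_space.1 f.2 w
      rwa [Finsupp.add_apply, Finsupp.single_eq_of_ne h, add_zero] at this
  let ψ : φ.ker →ₗ[Fq] space Fq D :=
    { toFun := fun f => ⟨f.1.1, hker f.2⟩
      map_add' := fun _ _ => rfl
      map_smul' := fun _ _ => rfl }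
  have hψ : Function.Injective ψ := fun f g h => by
    have := congrArg Subtype.val h
    exact Subtype.ext (Subtype.ext this)
  have hkfin : Module.Finite Fq φ.ker := Module.Finite.of_injective ψ hψ
  have hfin : Module.Finite Fq (space Fq (D + Finsupp.single v 1)) := by
    have : Module.Finite Fq φ.range := inferInstance
    have : Module.Finite Fq (_ ⧸ φ.ker) := Module.Finite.equiv φ.quotKerEquivRange.symm
    exact Module.Finite.of_submodule_quotient φ.ker
  refine ⟨hfin, ?_⟩
  rw [← LinearMap.finrank_range_add_finrank_ker φ, add_comm]
  exact add_le_add (LinearMap.finrank_le_finrank_of_injective hψ) (Submodule.finrank_le _)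

lemma finrank_space_add_ofNat (E : Place K →₀ ℕ) : ∀ D : Divisor K,
    Module.Finite Fq (space Fq D) →
    Module.Finite Fq (space Fq (D + ofNat E)) ∧
      (Module.finrank Fq (space Fq (D + ofNat E)) : ℤ) ≤
        Module.finrank Fq (space Fq D) + degree Fq (ofNat E) := by
  induction E using Finsupp.induction_linear with
  | zero =>
    intro D hD
    rw [map_zero, map_zero, add_zero, add_zero]
    exact ⟨hD, le_rfl⟩
  | add E₁ E₂ h₁ h₂ =>
    intro D hD
    obtain ⟨hf₁, hr₁⟩ := h₁ D hD
    obtain ⟨hf₂, hr₂⟩ := h₂ _ hf₁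
    rw [map_add, ← add_assoc]
    refine ⟨hf₂, hr₂.trans ?_⟩
    rw [map_add, ← add_assoc]
    exact add_le_add_left hr₁ _
  | single v n =>
    induction n with
    | zero =>
      intro D hD
      rw [Finsupp.single_zero, map_zero, map_zero, add_zero, add_zero]
      exact ⟨hD, le_rfl⟩
    | succ n ih =>
      intro D hD
      obtain ⟨hf₁, hr₁⟩ := ih D hD
      obtain ⟨hf₂, hr₂⟩ := finrank_space_add_single Fq (D + ofNat (Finsupp.single v n)) v
      have h : D + ofNat (Finsupp.single v n) + Finsupp.single v 1 =
          D + ofNat (Finsupp.single v (n + 1)) := by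
        rw [Finsupp.single_add, map_add, add_assoc, ofNat_single v 1, Nat.cast_one]
      rw [h] at hf₂ hr₂
      refine ⟨hf₂, ?_⟩
      zify at hr₂
      have h1 : degree Fq (ofNat (Finsupp.single v n)) = n * v.deg Fq := by
        rw [ofNat_single, degree_single]
      have h2 : degree Fq (ofNat (Finsupp.single v (n + 1))) = (n + 1) * v.deg Fq := by
        rw [ofNat_single, degree_single]; push_cast; rfl
      rw [h1] at hr₁
      rw [h2]
      linarith

omit [Fintype Fq] in
/-- An element without poles is algebraic over the constants. -/
lemma _root_.AdeleClass.isAlgebraic_of_forall_val_le_one {f : K} (h : ∀ v : Place K, v.val f ≤ 1) :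
    IsAlgebraic Fq f := by
  by_contra hf
  have hf' : Transcendental Fq f⁻¹ := fun h => hf (inv_inv f ▸ h.inv)
  obtain ⟨v, hv⟩ := exists_place_val_lt_one hf'
  rw [map_inv₀] at hv
  have hf0 : f ≠ 0 := fun h => hf (h ▸ isAlgebraic_zero)
  exact absurd (h v) (not_le.2 ((inv_lt_one₀ (by simpa [zero_lt_iff] using hf0)).1 hv))

omit [Fintype Fq] in
lemma _root_.AdeleClass.exists_transcendental : ∃ t : K, Transcendental Fq t :=
  exists_transcendental_of_trdeg_eq_one IsFunctionFieldOfCurve.trdeg_eq_one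

lemma _root_.AdeleClass.nonempty_place (Fq : Type*) [Field Fq] [Algebra Fq K] [IsFunctionFieldOfCurve Fq K] :
    Nonempty (Place K) := by
  obtain ⟨t, ht⟩ := exists_transcendental (K := K) Fq
  obtain ⟨v, -⟩ := exists_place_val_lt_one ht
  exact ⟨v⟩

/-- Functions without poles are algebraic, so the nonzero ones have no zeros either, and the residue
at a single place is injective on `L(0)`. -/
lemma finite_space_zero : Module.Finite Fq (space Fq (0 : Divisor K)) := by
  obtain ⟨t, ht⟩ := exists_transcendental (K := K) Fq
  obtain ⟨w, -⟩ := exists_place_val_lt_one ht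
  have hle : space Fq (0 : Divisor K) ≤ w.ball Fq 0 := fun f hf => mem_space.1 hf w
  refine Module.Finite.of_injective ((w.leadingCoeff Fq 0).comp (Submodule.inclusion hle)) ?_
  rw [← LinearMap.ker_eq_bot, LinearMap.ker_eq_bot']
  intro f hf
  have hf' : w.val f ≤ exp (0 - 1) :=
    (leadingCoeff_eq_zero_iff w Fq (Submodule.inclusion hle f)).1 hf
  by_contra hf0
  have halg := isAlgebraic_of_forall_val_le_one Fq (fun v => (mem_space.1 f.2 v).trans (by simp))
  rw [w.val_eq_one_of_isAlgebraic (fun h => hf0 (Subtype.ext h)) halg, ← exp_zero,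
    exp_le_exp] at hf'
  simp at hf'

instance finite_space (D : Divisor K) : Module.Finite Fq (space Fq D) := by
  obtain ⟨E, hE⟩ := exists_ofNat_eq (D := D ⊔ 0) le_sup_right
  have := (finrank_space_add_ofNat Fq E 0 (finite_space_zero Fq)).1
  rw [zero_add, hE] at this
  exact Module.Finite.of_injective (Submodule.inclusion (space_mono Fq (le_sup_left : D ≤ D ⊔ 0)))
    (Submodule.inclusion_injective _)

lemma finrank_space_le_add {D E : Divisor K} (h : D ≤ E) :
    (Module.finrank Fq (space Fq E) : ℤ) ≤
      Module.finrank Fq (space Fq D) + (degree Fq E - degree Fq D) := by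
  obtain ⟨N, hN⟩ := exists_ofNat_eq (sub_nonneg.2 h)
  have := (finrank_space_add_ofNat Fq N D inferInstance).2
  rwa [hN, add_sub_cancel, map_sub] at this

end Divisor

/-! ### Principal divisors, the product formula and Riemann's inequality -/

namespace Divisor
open WithZero Place

variable {K : Type*} [Field K] (Fq : Type*) [Field Fq] [Fintype Fq] [Algebra Fq K]

variable {Fq} in
lemma _root_.AdeleClass.Place.val_aeval_lt_one_iff (v : Place K) {t : K} (ht : v.val t ≤ 1) (p : Polynomial Fq) :
    v.val (Polynomial.aeval t p) < 1 ↔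
      Polynomial.aeval (IsLocalRing.residue v.val.valuationSubring ⟨t, ht⟩) p = 0 := by
  have h1 : Polynomial.aeval t p =
      ((Polynomial.eval₂ (v.constants Fq) ⟨t, ht⟩ p : v.val.valuationSubring) : K) :=
    (Polynomial.hom_eval₂ p (v.constants Fq) v.val.valuationSubring.subtype ⟨t, ht⟩).symm
  have h2 : Polynomial.aeval (IsLocalRing.residue v.val.valuationSubring ⟨t, ht⟩) p =
      IsLocalRing.residue _ (Polynomial.eval₂ (v.constants Fq) ⟨t, ht⟩ p) :=
    (Polynomial.hom_eval₂ p (v.constants Fq) (IsLocalRing.residue _) ⟨t, ht⟩).symm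
  rw [h1, h2, residue_eq_zero_iff]

lemma exists_le_nat (D : Divisor K) : ∃ n : ℕ, ∀ v, D v ≤ n := by
  refine ⟨∑ v ∈ D.support, (D v).toNat, fun v => ?_⟩
  by_cases hv : v ∈ D.support
  · have := Finset.single_le_sum (f := fun v => (D v).toNat) (fun _ _ => Nat.zero_le _) hv
    zify at this ⊢
    exact (Int.self_le_toNat _).trans this
  · rw [Finsupp.notMem_support_iff.1 hv]; positivity

variable [IsFunctionFieldOfCurve Fq K]

/-- The divisor of a nonzero function. -/
def div (f : K) : Divisor K :=
  Finsupp.ofSupportFinite (fun v => -log (v.val f)) (by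
    -- Since `log 0 = 0`, the zero function receives the zero divisor.
    by_cases hf : f = 0
    · simp [hf, Function.support]
    · refine (finite_val_ne_one Fq hf).subset fun v hv h => hv ?_
      simp [h])

lemma div_apply (f : K) (v : Place K) : div Fq f v = -log (v.val f) := rfl

lemma val_eq_exp {f : K} (hf : f ≠ 0) (v : Place K) : v.val f = exp (-(div Fq f v)) := by
  rw [div_apply, neg_neg, exp_log (by simpa using hf)]

lemma div_one : div Fq (1 : K) = 0 := by
  ext v; simp [div_apply]

lemma div_mul {f g : K} (hf : f ≠ 0) (hg : g ≠ 0) : div Fq (f * g) = div Fq f + div Fq g := by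
  ext v
  rw [Finsupp.add_apply, div_apply, div_apply, div_apply, map_mul,
    log_mul (by simpa using hf) (by simpa using hg), neg_add]

lemma div_inv (f : K) : div Fq f⁻¹ = -div Fq f := by
  ext v
  rw [Finsupp.neg_apply, div_apply, div_apply, map_inv₀, log_inv]

lemma div_eq_zero_of_isAlgebraic {f : K} (hf : IsAlgebraic Fq f) : div Fq f = 0 := by
  ext v
  by_cases h0 : f = 0
  · simp [h0, div_apply]
  · rw [div_apply, v.val_eq_one_of_isAlgebraic h0 hf]; simp

/-- Multiplication by `h` is the injection. Together with the same bound for `h⁻¹` it gives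
invariance under linear equivalence. -/
lemma finrank_space_le_sub_div (D : Divisor K) {h : K} (hh : h ≠ 0) :
    Module.finrank Fq (space Fq D) ≤ Module.finrank Fq (space Fq (D - div Fq h)) := by
  let φ : space Fq D →ₗ[Fq] space Fq (D - div Fq h) :=
    ((LinearMap.mulLeft Fq h).comp (Submodule.subtype _)).codRestrict _ (fun f => by
      rw [mem_space]
      intro v
      rw [Finsupp.sub_apply, sub_eq_neg_add, exp_add, ← val_eq_exp Fq hh]
      exact (map_mul v.val _ _).trans_le (mul_le_mul_right (mem_space.1 f.2 v) _))
  refine LinearMap.finrank_le_finrank_of_injective (f := φ) fun f g hfg => ?_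
  have : h * (f : K) = h * g := congrArg Subtype.val hfg
  exact Subtype.ext (mul_left_cancel₀ hh this)

/-- Here `div f ⊔ 0` is the divisor of zeros; likewise `div f⁻¹ ⊔ 0` is that of poles. -/
lemma degree_div_sup_le {f : K} (hf : Transcendental Fq f) :
    degree Fq (div Fq f ⊔ 0) ≤ Module.finrank (IntermediateField.adjoin Fq {f}) K := by
  have hf0 : f ≠ 0 := fun h => hf (h ▸ isAlgebraic_zero)
  have h1 := sum_mul_deg_le (fun i : (div Fq f ⊔ 0).support => i.1) Subtype.val_injective hf
    (fun i => (div Fq f i.1).toNat) (fun i => by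
      rw [val_eq_exp Fq hf0, exp_le_exp]
      have h2 : (div Fq f ⊔ 0) i.1 ≠ 0 := Finsupp.mem_support_iff.1 i.2
      have h3 : max (div Fq f i.1) 0 ≠ 0 := h2
      omega)
  rw [degree, Finsupp.linearCombination_apply, Finsupp.sum]
  zify at h1
  refine le_trans (le_of_eq ?_) h1
  rw [← Finset.sum_coe_sort]
  refine Finset.sum_congr rfl fun i _ => ?_
  rw [smul_eq_mul, Int.toNat_eq_max]
  rfl

open IntermediateField.algebraAdjoinAdjoin in
-- Choose a basis `y_j` of `K` over `F_q(f)` made of elements integral over `F_q[f]`. Its poles lie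
-- among those of `f`, so `c` can be chosen with all `y_j` in `L(cP)`, and the products `f^i y_j`
-- with `i ≤ n` are independent elements of `L((n + c)P)`.
lemma exists_mul_le_finrank_space {f : K} (hf : Transcendental Fq f) : ∃ c : ℕ, ∀ n : ℕ,
    Module.finrank (IntermediateField.adjoin Fq {f}) K * (n + 1) ≤
      Module.finrank Fq (space Fq ((n + c) • (div Fq f⁻¹ ⊔ 0))) := by
  have hf0 : f ≠ 0 := fun h => hf (h ▸ isAlgebraic_zero)
  have hfin := finiteDimensional_adjoin hf
  have halg := Algebra.IsAlgebraic.trans (Algebra.adjoin Fq {f})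
    (IntermediateField.adjoin Fq {f}) K
  let b := Module.finBasis (IntermediateField.adjoin Fq {f}) K
  choose a ha0 hint using fun j => (halg.isAlgebraic (b j)).exists_integral_multiple
  let y := fun j => (a j : K) * b j
  have hy : LinearIndependent (IntermediateField.adjoin Fq {f}) y := by
    have hne : ∀ j, algebraMap (Algebra.adjoin Fq {f}) (IntermediateField.adjoin Fq {f}) (a j) ≠ 0 :=
      fun j h => ha0 j (FaithfulSMul.algebraMap_injective _ (IntermediateField.adjoin Fq {f})
        (h.trans (map_zero _).symm))
    exact b.linearIndependent.units_smul (fun j => Units.mk0 _ (hne j))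
  set P := div Fq f⁻¹ ⊔ 0 with hP
  have hP0 : ∀ v, 0 ≤ P v := fun v => le_max_right _ _
  have hPf : ∀ v : Place K, v.val f ≤ exp (P v) := fun v => by
    rw [val_eq_exp Fq hf0, exp_le_exp, ← Finsupp.neg_apply, ← div_inv]
    exact le_max_left _ _
  choose c hc using fun j => exists_le_nat (div Fq (y j)⁻¹)
  have hyc : ∀ j (v : Place K), v.val (y j) ≤ exp ((∑ j, c j : ℕ) * P v) := fun j v => by
    have hy0 : y j ≠ 0 := hy.ne_zero j
    rcases (hP0 v).eq_or_lt with h | h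
    · rw [← h, mul_zero, exp_zero]
      have := hPf v
      rw [← h, exp_zero] at this
      exact v.val_le_one_of_isIntegral_adjoin this (hint j)
    · rw [val_eq_exp Fq hy0, exp_le_exp, ← Finsupp.neg_apply, ← div_inv]
      have h1 : c j ≤ ∑ j, c j := Finset.single_le_sum (fun _ _ => Nat.zero_le _) (Finset.mem_univ j)
      have h2 : ((∑ j, c j : ℕ) : ℤ) * 1 ≤ (∑ j, c j : ℕ) * P v :=
        mul_le_mul_of_nonneg_left h (by positivity)
      have h3 := hc j v
      zify at h1 h2
      push_cast at *
      linarith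
  refine ⟨∑ j, c j, fun n => ?_⟩
  have hpow : LinearIndependent Fq
      (fun i : Fin (n + 1) => (IntermediateField.AdjoinSimple.gen Fq f) ^ (i : ℕ)) := by
    have h1 : LinearIndependent Fq fun i : ℕ => f ^ i := by
      have := (Polynomial.basisMonomials Fq).linearIndependent.map'
        (Polynomial.aeval f).toLinearMap (LinearMap.ker_eq_bot.2 (transcendental_iff_injective.1 hf))
      simpa [Function.comp_def] using this
    exact LinearIndependent.of_comp (IntermediateField.adjoin Fq {f}).val.toLinearMap
      (h1.comp _ Fin.val_injective)
  have hind := linearIndependent_smul hpow hy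
  have hmem : ∀ x : Fin (n + 1) × Fin (Module.finrank (IntermediateField.adjoin Fq {f}) K),
      (IntermediateField.AdjoinSimple.gen Fq f) ^ (x.1 : ℕ) • y x.2 ∈
        space Fq ((n + ∑ j, c j) • P) := fun x => by
    rw [mem_space]
    intro v
    have h1 : (IntermediateField.AdjoinSimple.gen Fq f) ^ (x.1 : ℕ) • y x.2 = f ^ (x.1 : ℕ) * y x.2 :=
      rfl
    rw [h1, map_mul, map_pow, Finsupp.smul_apply, add_smul, exp_add, nsmul_eq_mul, nsmul_eq_mul]
    refine mul_le_mul' ?_ (hyc x.2 v)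
    calc v.val f ^ (x.1 : ℕ) ≤ exp (P v) ^ (x.1 : ℕ) := pow_le_pow_left₀ zero_le (hPf v) _
      _ = exp ((x.1 : ℕ) * P v) := by rw [← exp_nsmul, nsmul_eq_mul]
      _ ≤ exp (n * P v) := exp_le_exp.2 (mul_le_mul_of_nonneg_right (by have := x.1.2; omega) (hP0 v))
  have hind' : LinearIndependent Fq fun x => (⟨_, hmem x⟩ : space Fq ((n + ∑ j, c j) • P)) :=
    LinearIndependent.of_comp (Submodule.subtype _) hind
  have := hind'.fintype_card_le_finrank
  simpa [mul_comm] using this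

/-- The number of poles of `f`, with multiplicities, is `[K : 𝔽_q(f)]`. -/
theorem degree_poles {f : K} (hf : Transcendental Fq f) :
    degree Fq (div Fq f⁻¹ ⊔ 0) = Module.finrank (IntermediateField.adjoin Fq {f}) K := by
  have hadj : IntermediateField.adjoin Fq {f⁻¹} = IntermediateField.adjoin Fq {f} := by
    apply le_antisymm <;> rw [IntermediateField.adjoin_simple_le_iff]
    · exact inv_mem (IntermediateField.mem_adjoin_simple_self Fq f)
    · have := inv_mem (IntermediateField.mem_adjoin_simple_self Fq f⁻¹)
      rwa [inv_inv] at this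
  have hf' : Transcendental Fq f⁻¹ := fun h => hf (inv_inv f ▸ h.inv)
  refine le_antisymm ?_ ?_
  · have := degree_div_sup_le Fq hf'
    rwa [hadj] at this
  · obtain ⟨c, hc⟩ := exists_mul_le_finrank_space Fq hf
    set m := Module.finrank (IntermediateField.adjoin Fq {f}) K
    set P := div Fq f⁻¹ ⊔ 0
    have h1 : ∀ n : ℕ, (m : ℤ) * (n + 1) ≤
        Module.finrank Fq (space Fq (0 : Divisor K)) + (n + c) * degree Fq P := fun n => by
      have h2 := finrank_space_le_add Fq (D := 0) (E := (n + c) • P)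
        (nsmul_nonneg (le_sup_right) _)
      rw [map_nsmul, map_zero, sub_zero] at h2
      have h3 := hc n
      zify at h3
      refine h3.trans (h2.trans (le_of_eq ?_))
      rw [nsmul_eq_mul]; push_cast; rfl
    by_contra! hlt
    set l := Module.finrank Fq (space Fq (0 : Divisor K))
    -- If `deg P ≤ m - 1`, the inequality gives `n + m + c ≤ l + c m` for every `n`, which fails at
    -- this value.
    have h4 := h1 (l + c * m)
    have h5 : degree Fq P ≤ m - 1 := by omega
    have h6 : ((l + c * m : ℕ) + c : ℤ) * degree Fq P ≤ ((l + c * m : ℕ) + c : ℤ) * (m - 1) :=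
      mul_le_mul_of_nonneg_left h5 (by positivity)
    have hm : 0 < m :=
      have := finiteDimensional_adjoin hf
      Module.finrank_pos
    zify at hm
    push_cast at *
    linarith

/-- The product formula. -/
theorem degree_div (f : K) : degree Fq (div Fq f) = 0 := by
  by_cases hf : IsAlgebraic Fq f
  · rw [div_eq_zero_of_isAlgebraic Fq hf, map_zero]
  have hf' : Transcendental Fq f⁻¹ := fun h => hf (inv_inv f ▸ h.inv)
  have h1 := degree_poles Fq hf
  have h2 := degree_poles Fq hf'
  have hadj : IntermediateField.adjoin Fq {f⁻¹} = IntermediateField.adjoin Fq {f} := by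
    apply le_antisymm <;> rw [IntermediateField.adjoin_simple_le_iff]
    · exact inv_mem (IntermediateField.mem_adjoin_simple_self Fq f)
    · have := inv_mem (IntermediateField.mem_adjoin_simple_self Fq f⁻¹)
      rwa [inv_inv] at this
  rw [hadj, ← h1, inv_inv, div_inv] at h2
  -- Zeros minus poles: both have degree `[K : F_q(f)] = [K : F_q(f⁻¹)]`.
  have h3 : div Fq f = (div Fq f ⊔ 0) - (-div Fq f ⊔ 0) := by
    ext v
    change div Fq f v = max (div Fq f v) 0 - max (-div Fq f v) 0
    omega
  rw [h3, map_sub, h2, sub_self]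

/-- Where `t` is integral its residue is a root of some nonzero polynomial `p` over `F_q`, and
`p(t)` vanishes there. Products of such polynomials in `t` acquire any prescribed zeros away from
the poles of `t`. -/
lemma exists_div_ge {t : K} (ht : Transcendental Fq t) (E : Place K →₀ ℕ) :
    ∃ h : K, h ≠ 0 ∧ h ∈ Algebra.adjoin Fq {t} ∧
      ∀ v : Place K, v.val t ≤ 1 → (E v : ℤ) ≤ div Fq h v := by
  have hnn : ∀ h : K, h ≠ 0 → h ∈ Algebra.adjoin Fq {t} → ∀ v : Place K, v.val t ≤ 1 →
      0 ≤ div Fq h v := fun h h0 hm v hv => by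
    have := v.val_le_one_of_isIntegral_adjoin (Fq := Fq) hv
      (isIntegral_algebraMap (x := (⟨h, hm⟩ : Algebra.adjoin Fq {t})))
    change v.val h ≤ 1 at this
    rw [val_eq_exp Fq h0, exp_le_one_iff] at this
    omega
  induction E using Finsupp.induction_linear with
  | zero => exact ⟨1, one_ne_zero, one_mem _, fun v _ => by simp [div_one]⟩
  | add E₁ E₂ h₁ h₂ =>
    obtain ⟨g₁, h0₁, hm₁, h₁⟩ := h₁
    obtain ⟨g₂, h0₂, hm₂, h₂⟩ := h₂
    refine ⟨g₁ * g₂, mul_ne_zero h0₁ h0₂, mul_mem hm₁ hm₂, fun v hv => ?_⟩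
    rw [div_mul Fq h0₁ h0₂, Finsupp.add_apply, Finsupp.add_apply, Nat.cast_add]
    exact add_le_add (h₁ v hv) (h₂ v hv)
  | single w n =>
    induction n with
    | zero => exact ⟨1, one_ne_zero, one_mem _, fun v _ => by simp [div_one]⟩
    | succ n ih =>
      obtain ⟨g, h0, hm, hg⟩ := ih
      by_cases hw : w.val t ≤ 1
      · obtain ⟨p, hp0, hp⟩ := Algebra.IsAlgebraic.isAlgebraic (R := Fq)
          (IsLocalRing.residue w.val.valuationSubring ⟨t, hw⟩)
        rw [← w.val_aeval_lt_one_iff hw] at hp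
        have hpt : Polynomial.aeval t p ≠ 0 := fun h => hp0 (transcendental_iff.1 ht p h)
        have hpm := Polynomial.aeval_mem_adjoin_singleton Fq (p := p) t
        refine ⟨g * Polynomial.aeval t p, mul_ne_zero h0 hpt, mul_mem hm hpm, fun v hv => ?_⟩
        rw [div_mul Fq h0 hpt, Finsupp.single_add, Finsupp.add_apply, Finsupp.add_apply,
          Nat.cast_add]
        refine add_le_add (hg v hv) ?_
        by_cases hvw : v = w
        · subst hvw
          rw [val_eq_exp Fq hpt, exp_lt_one_iff] at hp
          rw [Finsupp.single_eq_same]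
          push_cast
          omega
        · rw [Finsupp.single_eq_of_ne hvw]
          exact hnn _ hpt hpm v hv
      · refine ⟨g, h0, hm, fun v hv => ?_⟩
        have hvw : v ≠ w := by rintro rfl; exact hw hv
        rw [Finsupp.single_eq_of_ne hvw]
        exact hnn _ h0 hm v hv

/-- Riemann's inequality. -/
theorem exists_degree_sub_le_finrank_space :
    ∃ g : ℤ, ∀ D : Divisor K, degree Fq D - g ≤ Module.finrank Fq (space Fq D) := by
  obtain ⟨t, ht⟩ := exists_transcendental (K := K) Fq
  have ht0 : t ≠ 0 := fun h => ht (h ▸ isAlgebraic_zero)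
  obtain ⟨c, hc⟩ := exists_mul_le_finrank_space Fq ht
  rw [← Nat.cast_id (Module.finrank (IntermediateField.adjoin Fq {t}) K)] at hc
  have hdeg := degree_poles Fq ht
  set m := Module.finrank (IntermediateField.adjoin Fq {t}) K
  set P := div Fq t⁻¹ ⊔ 0
  -- Subtracting `div h` leaves positive coefficients only at poles of `t`, so the result lies below
  -- `(n + c)P`, of degree `(n + c)m`. As `L((n + c)P)` has dimension at least `m(n + 1)`, the
  -- difference of these two numbers is the constant.
  refine ⟨(c - 1) * m, fun D => ?_⟩
  obtain ⟨E, hE⟩ := exists_ofNat_eq (D := D ⊔ 0) le_sup_right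
  obtain ⟨h, h0, -, hh⟩ := exists_div_ge Fq ht E
  obtain ⟨n, hn⟩ := exists_le_nat (D - div Fq h)
  have hle : D - div Fq h ≤ (n + c) • P := fun v => by
    rw [Finsupp.smul_apply, nsmul_eq_mul]
    have hP0 : 0 ≤ P v := le_max_right _ _
    by_cases hv : v.val t ≤ 1
    · have h1 := hh v hv
      have h2 : D v ≤ E v := by
        have : ofNat E v = max (D v) 0 := DFunLike.congr_fun hE v
        rw [ofNat_apply] at this
        omega
      calc (D - div Fq h) v ≤ 0 := by rw [Finsupp.sub_apply]; omega
        _ ≤ _ := by positivity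
    · have hP1 : 1 ≤ P v := by
        rw [not_le, val_eq_exp Fq ht0, ← exp_zero, exp_lt_exp] at hv
        have : P v = max (div Fq t⁻¹ v) 0 := rfl
        rw [div_inv, Finsupp.neg_apply] at this
        omega
      calc (D - div Fq h) v ≤ n := hn v
        _ ≤ ((n + c : ℕ) : ℤ) * 1 := by push_cast; omega
        _ ≤ _ := mul_le_mul_of_nonneg_left hP1 (by positivity)
  have h1 := finrank_space_le_add Fq hle
  have h2 := hc n
  have h3 := finrank_space_le_sub_div Fq (D - div Fq h) (inv_ne_zero h0)
  rw [div_inv, sub_neg_eq_add, sub_add_cancel] at h3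
  rw [map_sub, degree_div, sub_zero, map_nsmul, hdeg, nsmul_eq_mul] at h1
  zify at h2 h3
  push_cast at *
  linarith

end Divisor

/-! ### Counting effective divisors -/

namespace Divisor
open WithZero Place

variable {K : Type*} [Field K] (Fq : Type*) [Field Fq] [Fintype Fq] [Algebra Fq K]

variable (K) in
/-- The effective divisors of degree `n`. -/
def effective (n : ℕ) : Set (Place K →₀ ℕ) := {E | degree Fq (ofNat E) = n}

lemma degree_ofNat (E : Place K →₀ ℕ) :
    degree Fq (ofNat E) = ((E.sum fun v n => n * v.deg Fq : ℕ) : ℤ) := by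
  induction E using Finsupp.induction_linear with
  | zero => simp
  | add E F hE hF =>
    rw [map_add, map_add, hE, hF, Finsupp.sum_add_index' (by simp) (by intros; ring), Nat.cast_add]
  | single v n => rw [ofNat_single, degree_single, Finsupp.sum_single_index (by simp), Nat.cast_mul]

variable {Fq} in
lemma mul_deg_le {n : ℕ} {E : Place K →₀ ℕ} (hE : E ∈ effective K Fq n) (v : Place K) :
    E v * v.deg Fq ≤ n := by
  have h : degree Fq (ofNat E) = n := hE
  rw [degree_ofNat, Nat.cast_inj] at h
  rw [← h, Finsupp.sum]
  by_cases hv : v ∈ E.support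
  · exact Finset.single_le_sum (f := fun v => E v * v.deg Fq) (fun _ _ => Nat.zero_le _) hv
  · rw [Finsupp.notMem_support_iff.1 hv]; simp

lemma exists_ne_zero_mem_space {D : Divisor K} (h : 0 < Module.finrank Fq (space Fq D)) :
    ∃ f ∈ space Fq D, f ≠ 0 := by
  have := Module.nontrivial_of_finrank_pos h
  obtain ⟨f, hf⟩ := exists_ne (0 : space Fq D)
  exact ⟨f, f.2, fun h => hf (Subtype.ext h)⟩

variable [IsFunctionFieldOfCurve Fq K]

/-- Degrees up to `N` divide `N!`. If `t` is a unit at such a place, its residue is a root of `X ^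
(q ^ N!) - X`, so the place is a zero of that polynomial in `t`; otherwise it is a zero or pole of
`t`. -/
lemma finite_deg_le (N : ℕ) : {v : Place K | v.deg Fq ≤ N}.Finite := by
  obtain ⟨t, ht⟩ := exists_transcendental (K := K) Fq
  have ht0 : t ≠ 0 := fun h => ht (h ▸ isAlgebraic_zero)
  let p : Polynomial Fq := Polynomial.X ^ (Fintype.card Fq ^ N.factorial) - Polynomial.X
  have hp : p ≠ 0 := FiniteField.X_pow_card_pow_sub_X_ne_zero Fq N.factorial_ne_zero Fintype.one_lt_card
  have hpt : Polynomial.aeval t p ≠ 0 := fun h => hp (transcendental_iff.1 ht p h)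
  refine ((finite_val_ne_one Fq ht0).union (finite_val_ne_one Fq hpt)).subset fun v hv => ?_
  by_cases h : v.val t = 1
  · refine Or.inr (ne_of_lt ?_)
    rw [v.val_aeval_lt_one_iff h.le]
    have := Module.finite_of_finite Fq (M := v.Residue)
    have := Fintype.ofFinite v.Residue
    obtain ⟨k, hk⟩ := Nat.dvd_factorial (v.deg_pos Fq) hv
    have hcard : Fintype.card v.Residue = Fintype.card Fq ^ v.deg Fq :=
      Module.card_eq_pow_finrank
    simp only [p, map_sub, map_pow, Polynomial.aeval_X]
    rw [hk, pow_mul, ← hcard, FiniteField.pow_card_pow, sub_self]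
  · exact Or.inl h

lemma finite_effective (n : ℕ) : (effective K Fq n).Finite := by
  classical
  let T := (finite_deg_le (K := K) Fq n).toFinset
  refine (Set.finite_Icc 0 (Finsupp.indicator T fun _ _ => n)).subset fun E hE => ⟨zero_le, fun v => ?_⟩
  have h1 := mul_deg_le hE v
  have h2 := v.deg_pos Fq
  rw [Finsupp.indicator_apply]
  split_ifs with hv
  · nlinarith
  · by_contra hE0
    refine hv ((Set.Finite.mem_toFinset _).2 ?_)
    have : 1 ≤ E v := by omega
    change v.deg Fq ≤ n
    nlinarith

variable {Fq} in
lemma exists_ofNat_eq_add_div {D : Divisor K} {f : K} (hf : f ∈ space Fq D) (h0 : f ≠ 0) :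
    ∃ E, ofNat E = D + div Fq f := by
  refine exists_ofNat_eq fun v => ?_
  have := mem_space.1 hf v
  rw [val_eq_exp Fq h0, exp_le_exp] at this
  rw [Finsupp.add_apply, Finsupp.zero_apply]
  omega

variable {Fq} in
lemma mem_space_of_nonneg {D : Divisor K} {f : K} (h0 : f ≠ 0) (h : 0 ≤ D + div Fq f) :
    f ∈ space Fq D := by
  rw [mem_space]
  intro v
  have := h v
  rw [Finsupp.add_apply, Finsupp.zero_apply] at this
  rw [val_eq_exp Fq h0, exp_le_exp]
  omega

/-- If `L(D)` is nonzero, `D` is linearly equivalent to an effective divisor of degree `n`, which is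
reached from `0` by adding places. -/
lemma finrank_space_le {D : Divisor K} {n : ℕ} (hD : degree Fq D = n) :
    Module.finrank Fq (space Fq D) ≤ n + Module.finrank Fq (space Fq (0 : Divisor K)) := by
  rcases Nat.eq_zero_or_pos (Module.finrank Fq (space Fq D)) with h | h
  · omega
  obtain ⟨f, hf, h0⟩ := exists_ne_zero_mem_space Fq h
  obtain ⟨E, hE⟩ := exists_ofNat_eq_add_div hf h0
  have h1 := finrank_space_le_sub_div Fq D (inv_ne_zero h0)
  rw [div_inv, sub_neg_eq_add, ← hE] at h1
  have h2 := (finrank_space_add_ofNat Fq E 0 inferInstance).2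
  rw [zero_add, hE, map_add, degree_div, hD, ← hE] at h2
  omega

lemma card_space (D : Divisor K) :
    Nat.card (space Fq D) = Fintype.card Fq ^ Module.finrank Fq (space Fq D) := by
  rw [Module.natCard_eq_pow_finrank (K := Fq), Nat.card_eq_fintype_card]

instance finite_coe_space (D : Divisor K) : Finite (space Fq D) := Module.finite_of_finite Fq

/-- There are at most `C q^n` effective divisors of degree `n`. -/
theorem exists_ncard_effective_le :
    ∃ C : ℕ, ∀ n : ℕ, (effective K Fq n).ncard ≤ C * Fintype.card Fq ^ n := by
  obtain ⟨g, hg⟩ := exists_degree_sub_le_finrank_space (K := K) Fq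
  obtain ⟨w⟩ := nonempty_place (K := K) Fq
  -- A multiple of a place with degree `r > g`, so that by Riemann's inequality every divisor of
  -- degree `r` has a nonzero section.
  let k := (g + 1).toNat
  let r := k * w.deg Fq
  have hkr : g + 1 ≤ r := by
    have h1 := w.deg_pos Fq
    have h2 : k ≤ r := Nat.le_mul_of_pos_right k h1
    omega
  let E₀ : Divisor K := Finsupp.single w (k : ℤ)
  have hE₀ : degree Fq E₀ = r := by rw [degree_single]; rfl
  set l := Module.finrank Fq (space Fq (0 : Divisor K))
  refine ⟨(effective K Fq r).ncard * Fintype.card Fq ^ l, fun n => ?_⟩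
  rcases (effective K Fq n).eq_empty_or_nonempty with h | ⟨B, hB⟩
  · rw [h, Set.ncard_empty]; exact Nat.zero_le _
  have hB' : degree Fq (ofNat B) = n := hB
  -- With `B` of degree `n` fixed, `E - B + E₀` has degree `r`, hence is equivalent to one of
  -- finitely many effective `F`. Then `E` is recovered from `F` and the function `f⁻¹` in `L(F + B
  -- - E₀)`, a space of dimension at most `n + l`.
  have key : ∀ E : effective K Fq n, ∃ (F : effective K Fq r) (f : K), f ≠ 0 ∧
      ofNat F.1 = ofNat E.1 - ofNat B + E₀ + div Fq f := by
    rintro ⟨E, hE⟩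
    have hE' : degree Fq (ofNat E) = n := hE
    have hdeg : degree Fq (ofNat E - ofNat B + E₀) = r := by
      rw [map_add, map_sub, hE', hB', hE₀]; ring
    have h1 := hg (ofNat E - ofNat B + E₀)
    rw [hdeg] at h1
    obtain ⟨f, hf, h0⟩ := exists_ne_zero_mem_space Fq (D := ofNat E - ofNat B + E₀) (by omega)
    obtain ⟨F, hF⟩ := exists_ofNat_eq_add_div hf h0
    refine ⟨⟨F, ?_⟩, f, h0, hF⟩
    change degree Fq (ofNat F) = r
    rw [hF, map_add, degree_div, hdeg, add_zero]
  choose F f hf0 hF using key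
  have hmem : ∀ E, (f E)⁻¹ ∈ space Fq (ofNat (F E).1 + ofNat B - E₀) := fun E => by
    refine mem_space_of_nonneg (inv_ne_zero (hf0 E)) ?_
    rw [div_inv, hF]
    have : ofNat E.1 - ofNat B + E₀ + div Fq (f E) + ofNat B - E₀ + -div Fq (f E) = ofNat E.1 := by
      abel
    rw [this]
    exact fun v => Int.natCast_nonneg _
  let φ : effective K Fq n → Σ F : effective K Fq r, space Fq (ofNat F.1 + ofNat B - E₀) :=
    fun E => ⟨F E, (f E)⁻¹, hmem E⟩
  have hφ : Function.Injective φ := by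
    intro E E' h
    have h1 : F E = F E' := congrArg Sigma.fst h
    have h2 : (f E)⁻¹ = (f E')⁻¹ := congrArg (fun x => (x.2 : K)) h
    have h3 := hF E
    rw [h1, hF E', inv_inj.1 h2] at h3
    have h4 : ofNat E.1 = ofNat E'.1 := by
      have := add_right_cancel (add_right_cancel h3)
      exact (sub_left_inj.1 this).symm
    exact Subtype.ext (ofNat_injective h4)
  have := (finite_effective (K := K) Fq r).to_subtype
  have := Fintype.ofFinite (effective K Fq r)
  calc (effective K Fq n).ncard = Nat.card (effective K Fq n) := rfl
    _ ≤ Nat.card (Σ F : effective K Fq r, space Fq (ofNat F.1 + ofNat B - E₀)) :=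
      Nat.card_le_card_of_injective φ hφ
    _ = ∑ F : effective K Fq r, Nat.card (space Fq (ofNat F.1 + ofNat B - E₀)) := Nat.card_sigma
    _ ≤ ∑ F : effective K Fq r, Fintype.card Fq ^ (n + l) := by
      refine Finset.sum_le_sum fun F _ => ?_
      rw [card_space]
      refine Nat.pow_le_pow_right Fintype.card_pos (finrank_space_le Fq ?_)
      have hF' : degree Fq (ofNat F.1) = r := F.2
      rw [map_sub, map_add, hF', hB', hE₀]
      ring
    _ = _ := by
      rw [Finset.sum_const, smul_eq_mul, Finset.card_univ, ← Nat.card_eq_fintype_card, pow_add]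
      change (effective K Fq r).ncard * _ = _
      ring

/-- There are at least `c q^n` effective divisors of degree `n`, if `n` is a multiple of the degree
of a place. -/
theorem exists_le_ncard_effective (w : Place K) :
    ∃ c : ℕ, ∀ k : ℕ, Fintype.card Fq ^ (k * w.deg Fq) ≤
      c * (effective K Fq (k * w.deg Fq)).ncard := by
  obtain ⟨g, hg⟩ := exists_degree_sub_le_finrank_space (K := K) Fq
  set l := Module.finrank Fq (space Fq (0 : Divisor K))
  refine ⟨Fintype.card Fq ^ g.toNat * (2 * Fintype.card Fq ^ l), fun k => ?_⟩
  let D : Divisor K := ofNat (Finsupp.single w k)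
  have hD : degree Fq D = (k * w.deg Fq : ℕ) := by
    simp only [D]
    rw [ofNat_single, degree_single]; push_cast; rfl
  set n := k * w.deg Fq
  have hne : 1 ≤ (effective K Fq n).ncard :=
    (Set.ncard_pos (finite_effective Fq n)).2 ⟨_, hD⟩
  have key : ∀ f : {f : space Fq D // f ≠ 0}, ∃ E : effective K Fq n,
      ofNat E.1 = D + div Fq (f.1 : K) := by
    rintro ⟨⟨f, hf⟩, h0⟩
    obtain ⟨E, hE⟩ := exists_ofNat_eq_add_div hf (fun h => h0 (Subtype.ext h))
    refine ⟨⟨E, ?_⟩, hE⟩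
    change degree Fq (ofNat E) = n
    rw [hE, map_add, degree_div, hD, add_zero]
  choose E hE using key
  have hne0 : ∀ f : {f : space Fq D // f ≠ 0}, (f.1 : K) ≠ 0 := fun f h => f.2 (Subtype.ext h)
  -- Sections with the same divisor differ by elements of `L(0)`: fixing one representative per
  -- divisor bounds the fibres of `f ↦ D + div f` by `q ^ l`.
  have hrep : ∀ F : effective K Fq n, ∃ h : K, h ≠ 0 ∧ ∀ f, E f = F → div Fq h = div Fq (f.1 : K) := by
    intro F
    by_cases hF : ∃ f, E f = F
    · obtain ⟨f, rfl⟩ := hF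
      refine ⟨f.1, hne0 f, fun f' hf' => ?_⟩
      have h1 := hE f
      rw [← hf', hE f'] at h1
      exact (add_left_cancel h1).symm
    · exact ⟨1, one_ne_zero, fun f hf => absurd ⟨f, hf⟩ hF⟩
  choose h hh0 hh using hrep
  have hmem : ∀ f, (f.1 : K) * (h (E f))⁻¹ ∈ space Fq (0 : Divisor K) := fun f => by
    refine mem_space_of_nonneg (mul_ne_zero (hne0 f) (inv_ne_zero (hh0 _))) ?_
    rw [div_mul Fq (hne0 f) (inv_ne_zero (hh0 _)), div_inv, hh _ f rfl]
    simp
  let φ : {f : space Fq D // f ≠ 0} → effective K Fq n × space Fq (0 : Divisor K) :=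
    fun f => (E f, ⟨_, hmem f⟩)
  have hφ : Function.Injective φ := by
    intro f f' hff
    have h1 : E f = E f' := congrArg Prod.fst hff
    have h2 : (f.1 : K) * (h (E f))⁻¹ = (f'.1 : K) * (h (E f'))⁻¹ :=
      congrArg (fun x => (x.2 : K)) hff
    rw [h1] at h2
    exact Subtype.ext (Subtype.ext (mul_right_cancel₀ (inv_ne_zero (hh0 _)) h2))
  have := (finite_effective (K := K) Fq n).to_subtype
  have h1 := Nat.card_le_card_of_injective φ hφ
  rw [Nat.card_prod, card_space] at h1
  change _ ≤ (effective K Fq n).ncard * Fintype.card Fq ^ l at h1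
  have h2 : Nat.card (space Fq D) = Nat.card {f : space Fq D // f ≠ 0} + 1 := by
    classical
    have := Fintype.ofFinite (space Fq D)
    rw [Nat.card_eq_fintype_card, Nat.card_eq_fintype_card, Fintype.card_subtype_compl,
      Fintype.card_subtype_eq, Nat.sub_add_cancel Fintype.card_pos]
  have h3 : 1 ≤ Fintype.card Fq ^ l := Nat.one_le_pow _ _ Fintype.card_pos
  -- The factor `2` absorbs the zero section, which has no effective divisor.
  have h4 : Fintype.card Fq ^ Module.finrank Fq (space Fq D) ≤
      2 * ((effective K Fq n).ncard * Fintype.card Fq ^ l) := by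
    rw [← card_space, h2]
    nlinarith
  have h5 : n ≤ g.toNat + Module.finrank Fq (space Fq D) := by
    have := hg D
    rw [hD] at this
    omega
  calc Fintype.card Fq ^ n ≤ Fintype.card Fq ^ (g.toNat + Module.finrank Fq (space Fq D)) :=
        Nat.pow_le_pow_right Fintype.card_pos h5
    _ = Fintype.card Fq ^ g.toNat * Fintype.card Fq ^ Module.finrank Fq (space Fq D) := pow_add ..
    _ ≤ Fintype.card Fq ^ g.toNat * (2 * ((effective K Fq n).ncard * Fintype.card Fq ^ l)) :=
        Nat.mul_le_mul_left _ h4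
    _ = _ := by ring

/-- There is no extension in which all places split, without change of the constants. -/
theorem not_injective_sumElim {K' : Type*} [Field K'] [Algebra Fq K'] [IsFunctionFieldOfCurve Fq K']
    (w₁ w₂ : Place K → Place K') (h₁ : ∀ v, (w₁ v).deg Fq = v.deg Fq)
    (h₂ : ∀ v, (w₂ v).deg Fq = v.deg Fq) : ¬ Function.Injective (Sum.elim w₁ w₂) := by
  intro hinj
  obtain ⟨w⟩ := nonempty_place (K := K) Fq
  obtain ⟨c, hc⟩ := exists_le_ncard_effective Fq w
  obtain ⟨C, hC⟩ := exists_ncard_effective_le (K := K') Fq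
  have hdeg : ∀ (w' : Place K → Place K') (h : ∀ v, (w' v).deg Fq = v.deg Fq) (E : Place K →₀ ℕ),
      degree Fq (ofNat (E.mapDomain w')) = degree Fq (ofNat E) := by
    intro w' h E
    induction E using Finsupp.induction_linear with
    | zero => simp
    | add E F hE hF => rw [Finsupp.mapDomain_add, map_add, map_add, map_add, map_add, hE, hF]
    | single v n => rw [Finsupp.mapDomain_single, ofNat_single, ofNat_single, degree_single,
        degree_single, h]
  set e := w.deg Fq
  have key : ∀ k : ℕ, (k + 1) * Fintype.card Fq ^ (k * e) ≤
      c ^ 2 * (C * Fintype.card Fq ^ (k * e)) := by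
    intro k
    -- The `k + 1` ways of splitting the degree `k e` give the extra factor of `k + 1` on the left.
    -- Injectivity of `Sum.elim w₁ w₂` keeps the two summands apart, so both divisors can be read
    -- off their sum.
    let φ : (Σ i : Fin (k + 1), effective K Fq (i * e) × effective K Fq ((k - i) * e)) →
        effective K' Fq (k * e) := fun x =>
      ⟨x.2.1.1.mapDomain w₁ + x.2.2.1.mapDomain w₂, by
        have a₁ : degree Fq (ofNat x.2.1.1) = _ := x.2.1.2
        have a₂ : degree Fq (ofNat x.2.2.1) = _ := x.2.2.2
        change degree Fq (ofNat _) = _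
        rw [map_add, map_add, hdeg _ h₁, hdeg _ h₂, a₁, a₂, ← Nat.cast_add, ← add_mul,
          Nat.add_sub_cancel' (by omega)]⟩
    have hval : ∀ (x y : Place K →₀ ℕ), x.mapDomain w₁ + y.mapDomain w₂ =
        (x.mapDomain Sum.inl + y.mapDomain Sum.inr).mapDomain (Sum.elim w₁ w₂) := by
      intro x y
      rw [Finsupp.mapDomain_add, ← Finsupp.mapDomain_comp, ← Finsupp.mapDomain_comp]
      rfl
    have hl : ∀ (x y : Place K →₀ ℕ) (v : Place K),
        (x.mapDomain Sum.inl + y.mapDomain Sum.inr : Place K ⊕ Place K →₀ ℕ) (Sum.inl v) = x v := by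
      intro x y v
      rw [Finsupp.add_apply, Finsupp.mapDomain_apply Sum.inl_injective,
        Finsupp.mapDomain_of_notMem_range _ _ (by simp), add_zero]
    have hr : ∀ (x y : Place K →₀ ℕ) (v : Place K),
        (x.mapDomain Sum.inl + y.mapDomain Sum.inr : Place K ⊕ Place K →₀ ℕ) (Sum.inr v) = y v := by
      intro x y v
      rw [Finsupp.add_apply, Finsupp.mapDomain_apply Sum.inr_injective,
        Finsupp.mapDomain_of_notMem_range _ _ (by simp), zero_add]
    have hφ : Function.Injective φ := by
      rintro ⟨i, ⟨D, hD⟩, ⟨E, hE⟩⟩ ⟨j, ⟨D', hD'⟩, ⟨E', hE'⟩⟩ h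
      have h1 := congrArg Subtype.val h
      change D.mapDomain w₁ + E.mapDomain w₂ = D'.mapDomain w₁ + E'.mapDomain w₂ at h1
      rw [hval, hval] at h1
      have h2 := Finsupp.mapDomain_injective hinj h1
      have h3 : D = D' := by
        ext v; rw [← hl D E, h2, hl]
      have h4 : E = E' := by
        ext v; rw [← hr D E, h2, hr]
      subst h3 h4
      have h5 : (i : ℕ) = j := by
        have b : degree Fq (ofNat D) = _ := hD
        have b' : degree Fq (ofNat D) = _ := hD'
        rw [b, Nat.cast_inj] at b'
        exact Nat.eq_of_mul_eq_mul_right (w.deg_pos Fq) b'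
      have := Fin.ext h5
      subst this
      rfl
    have fin1 := fun n => (finite_effective (K := K) Fq n).to_subtype
    have fin2 := (finite_effective (K := K') Fq (k * e)).to_subtype
    have h1 := Nat.card_le_card_of_injective φ hφ
    rw [Nat.card_sigma] at h1
    simp only [Nat.card_prod] at h1
    have h2 : ∀ i : Fin (k + 1), Fintype.card Fq ^ (k * e) ≤
        c ^ 2 * (Nat.card (effective K Fq (i * e)) * Nat.card (effective K Fq ((k - i) * e))) := by
      intro i
      have b₁ := hc i
      have b₂ := hc (k - i)
      calc Fintype.card Fq ^ (k * e) = Fintype.card Fq ^ (i * e) * Fintype.card Fq ^ ((k - i) * e) := by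
            rw [← pow_add, ← add_mul, Nat.add_sub_cancel' (by omega)]
        _ ≤ _ := Nat.mul_le_mul b₁ b₂
        _ = _ := by rw [pow_two]; exact mul_mul_mul_comm ..
    calc (k + 1) * Fintype.card Fq ^ (k * e) = ∑ i : Fin (k + 1), Fintype.card Fq ^ (k * e) := by simp
      _ ≤ _ := Finset.sum_le_sum fun i _ => h2 i
      _ = _ := (Finset.mul_sum ..).symm
      _ ≤ _ := Nat.mul_le_mul_left _ (h1.trans (hC _))
  -- After cancelling the power of `q`, `key` says `k + 1 ≤ c ^ 2 * C`, which is false for this `k`.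
  have h1 := key (c ^ 2 * C)
  rw [← mul_assoc] at h1
  have := Nat.le_of_mul_le_mul_right h1 (pow_pos Fintype.card_pos _)
  omega

end Divisor

/-! ### Completions and Teichmüller lifts -/

namespace Place
open WithZero Filter Topology

variable {K : Type*} [Field K] (v : Place K)

/-- The embedding of `K` into the local field `K_v`. -/
def embed : K →+* v.Completion :=
  UniformSpace.Completion.coeRingHom.comp ((WithVal.equiv v.val).symm : K →+* WithVal v.val)

lemma embed_apply (k : K) : v.embed k = (k : v.Completion) := rfl

lemma valued_embed (k : K) : Valued.v (v.embed k) = v.val k := by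
  rw [embed_apply, Valued.valuedCompletion_apply]; rfl

lemma valued_surjective : Function.Surjective (Valued.v : Valuation v.Completion ℤᵐ⁰) := fun γ => by
  obtain ⟨k, hk⟩ := v.surjective γ
  exact ⟨v.embed k, (v.valued_embed k).trans hk⟩

lemma setOf_valued_sub_lt_mem_nhds (x : v.Completion) (n : ℤ) :
    {y | Valued.v (y - x) < (exp n : ℤᵐ⁰)} ∈ 𝓝 x := by
  obtain ⟨c, hc⟩ := v.valued_surjective (exp n)
  rw [Valued.mem_nhds]
  refine ⟨Units.mk0 ((Valued.v : Valuation v.Completion ℤᵐ⁰).restrict c) ?_, fun y hy => ?_⟩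
  · rw [Ne, Valuation.restrict_eq_zero_iff, hc]; exact exp_ne_zero
  · have := (Valuation.restrict_lt_iff _).1 hy
    rwa [hc] at this

lemma exists_valued_sub_embed_lt (x : v.Completion) (n : ℤ) :
    ∃ k : K, Valued.v (v.embed k - x) < (exp n : ℤᵐ⁰) := by
  obtain ⟨y, hy, hyx⟩ := UniformSpace.Completion.denseRange_coe.inter_nhds_nonempty
    (v.setOf_valued_sub_lt_mem_nhds x n)
  obtain ⟨k, rfl⟩ := hy
  exact ⟨WithVal.equiv v.val k, hyx⟩

lemma tendsto_zero_of_forall_eventually_lt {f : ℕ → v.Completion}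
    (h : ∀ n : ℤ, ∀ᶠ i in atTop, Valued.v (f i) < (exp n : ℤᵐ⁰)) : Tendsto f atTop (𝓝 0) := by
  rw [(Valued.hasBasis_nhds_zero v.Completion ℤᵐ⁰).tendsto_right_iff]
  rintro γ -
  obtain ⟨n, hn⟩ : ∃ n : ℤ, MonoidWithZeroHom.ValueGroup₀.embedding γ.1 = (exp n : ℤᵐ⁰) := by
    refine ⟨log _, (exp_log ?_).symm⟩
    simp
  filter_upwards [h n] with i hi
  rw [Valuation.restrict_lt_iff_lt_embedding, hn]
  exact hi

lemma nonarchimedeanAddGroup_completion : NonarchimedeanAddGroup v.Completion where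
  is_nonarchimedean U hU := by
    obtain ⟨γ, hγ⟩ := Valued.mem_nhds_zero.1 hU
    exact ⟨⟨(Valued.v : Valuation v.Completion ℤᵐ⁰).restrict.ltAddSubgroup γ,
      Valued.isOpen_ball _ γ.1⟩, hγ⟩

lemma tendsto_pow_pow {d : v.Completion} (hd : Valued.v d < (1 : ℤᵐ⁰)) {Q : ℕ} (hQ : 1 < Q) :
    Tendsto (fun i : ℕ => d ^ Q ^ i) atTop (𝓝 0) := by
  refine v.tendsto_zero_of_forall_eventually_lt fun n => ?_
  filter_upwards [eventually_ge_atTop (1 - n).toNat] with i hi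
  have h1 : Valued.v d ≤ (exp (-1) : ℤᵐ⁰) := by
    rw [← exp_zero] at hd
    rcases eq_or_ne (Valued.v d : ℤᵐ⁰) 0 with h | h
    · rw [h]; exact zero_le
    · rw [← exp_log h] at hd ⊢
      rw [exp_lt_exp] at hd
      rw [exp_le_exp]; omega
  have h2 : (1 - n) ≤ (Q ^ i : ℕ) := by
    have := Nat.lt_pow_self hQ (n := i)
    omega
  rw [map_pow]
  calc _ ≤ (exp (-1) : ℤᵐ⁰) ^ Q ^ i := pow_le_pow_left₀ zero_le h1 _
    _ = exp ((Q ^ i : ℕ) • (-1)) := (exp_nsmul ..).symm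
    _ < _ := by
      rw [exp_lt_exp, nsmul_eq_mul]; omega

variable {Fq : Type*} [Field Fq] [Fintype Fq] [Algebra Fq K] [Finite v.Residue]

/-- A root in the residue field of a polynomial with constant coefficients lifts to the
completion: the Teichmüller lift. -/
lemma exists_root_lift (p : Polynomial Fq) {a : K} (ha : v.val a ≤ 1)
    (hp : Polynomial.aeval (IsLocalRing.residue v.val.valuationSubring ⟨a, ha⟩) p = 0) :
    ∃ τ : v.Completion, p.eval₂ (v.embed.comp (algebraMap Fq K)) τ = 0 ∧
      Valued.v (τ - v.embed a) < (1 : ℤᵐ⁰) := by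
  have := Fintype.ofFinite v.Residue
  set m := Module.finrank Fq v.Residue
  have hQ : Fintype.card v.Residue = Fintype.card Fq ^ m := Module.card_eq_pow_finrank
  set Q := Fintype.card v.Residue
  have hQ1 : 1 < Q := Fintype.one_lt_card
  -- `Q` is a power of `q`, so raising to the power `Q ^ i` is additive and fixes the constants. It
  -- therefore commutes with differences and with polynomials over `F_q`.
  obtain ⟨G, hG⟩ : ∃ G : ℕ → (K →ₐ[Fq] K), ∀ i x, G i x = x ^ Q ^ i := by
    have h : ∀ (j : ℕ) (x : K), (FiniteField.frobeniusAlgHom Fq K ^ j) x = x ^ Fintype.card Fq ^ j := by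
      intro j x
      induction j with
      | zero => simp
      | succ j ih => rw [pow_succ', AlgHom.mul_apply, ih, pow_succ, pow_mul]; rfl
    exact ⟨fun i => FiniteField.frobeniusAlgHom Fq K ^ (m * i), fun i x => by rw [h, hQ, ← pow_mul]⟩
  have hd : v.val (a ^ Q - a) < 1 := by
    rw [← residue_eq_zero_iff v ⟨a ^ Q - a, sub_mem (pow_mem (show a ∈ v.val.valuationSubring from ha) Q) ha⟩]
    change IsLocalRing.residue v.val.valuationSubring (⟨a, ha⟩ ^ Q - ⟨a, ha⟩) = 0
    rw [map_sub, map_pow, FiniteField.pow_card, sub_self]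
  -- The sequence has increments `(a ^ Q - a) ^ (Q ^ i)`, which tend to zero because `a ^ Q` and `a`
  -- have the same residue; its limit is the Teichmüller lift. The values of `p` along it are `p(a)
  -- ^ (Q ^ i)` and also tend to zero.
  let x : ℕ → v.Completion := fun i => v.embed (a ^ Q ^ i)
  have hx : ∀ i, x (i + 1) - x i = (v.embed (a ^ Q - a)) ^ Q ^ i := fun i => by
    change v.embed _ - v.embed _ = _
    rw [← map_sub, ← map_pow, ← hG i (a ^ Q - a), map_sub (G i), hG, hG, ← pow_mul, pow_succ, mul_comm]
  have hcauchy : CauchySeq x := by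
    have := v.nonarchimedeanAddGroup_completion
    apply NonarchimedeanAddGroup.cauchySeq_of_tendsto_sub_nhds_zero
    simp only [hx]
    exact v.tendsto_pow_pow (by rwa [valued_embed]) hQ1
  obtain ⟨τ, hτ⟩ := cauchySeq_tendsto_of_complete hcauchy
  refine ⟨τ, ?_, ?_⟩
  · have h1 : Tendsto (fun i => p.eval₂ (v.embed.comp (algebraMap Fq K)) (x i)) atTop
        (𝓝 (p.eval₂ (v.embed.comp (algebraMap Fq K)) τ)) :=
      ((p.continuous_eval₂ _).tendsto τ).comp hτ
    have h2 : ∀ i, p.eval₂ (v.embed.comp (algebraMap Fq K)) (x i) =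
        (v.embed (Polynomial.aeval a p)) ^ Q ^ i := fun i => by
      rw [← map_pow, ← hG i (Polynomial.aeval a p), ← Polynomial.aeval_algHom_apply, hG]
      exact (Polynomial.hom_eval₂ p _ _ _).symm
    simp only [h2] at h1
    exact tendsto_nhds_unique h1
      (v.tendsto_pow_pow (by rw [valued_embed]; exact (val_aeval_lt_one_iff v ha p).2 hp) hQ1)
  · obtain ⟨i, hi⟩ := ((hτ.eventually (v.setOf_valued_sub_lt_mem_nhds τ 0)).and
      (eventually_ge_atTop 0)).exists
    have h1 : ∀ i, Valued.v (x i - v.embed a) < (1 : ℤᵐ⁰) := fun i => by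
      rw [← map_sub, valued_embed]
      induction i with
      | zero => simp
      | succ i ih =>
        have : a ^ Q ^ (i + 1) - a = (a ^ Q - a) ^ Q ^ i + (a ^ Q ^ i - a) := by
          rw [← hG i (a ^ Q - a), map_sub (G i), hG, hG, ← pow_mul, pow_succ, mul_comm]; ring
        rw [this]
        refine v.val.map_add_lt ?_ ih
        rw [map_pow]
        exact pow_lt_one₀ zero_le hd (pow_ne_zero _ (by omega))
    have h2 : τ - v.embed a = -(x i - τ) + (x i - v.embed a) := by ring
    rw [h2]
    refine Valuation.map_add_lt _ ?_ (h1 i)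
    rw [Valuation.map_neg, ← exp_zero]
    exact hi.1

end Place

open Algebra in
theorem IsFunctionFieldOfCurve.of_finite (F : Type*) {K L : Type u} [Field F] [Field K] [Field L]
    [Algebra F K] [Algebra F L] [Algebra K L] [IsScalarTower F K L] [Module.Finite K L]
    [h : IsFunctionFieldOfCurve F K] : IsFunctionFieldOfCurve F L where
  toEssFiniteType := Algebra.EssFiniteType.comp F K L
  trdeg_eq_one := by
    have := trdeg_add_eq F K (A := L)
    rw [trdeg_eq_zero (R := K), add_zero] at this
    rw [← this, h.trdeg_eq_one]

/-- There is an irreducible polynomial of every positive degree over a finite field. -/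
lemma exists_irreducible_natDegree_eq (F : Type*) [Field F] [Finite F] {n : ℕ} (hn : 0 < n) :
    ∃ p : Polynomial F, Irreducible p ∧ p.natDegree = n := by
  obtain ⟨r, hr⟩ := CharP.exists F
  have : Fact r.Prime := ⟨CharP.char_is_prime F r⟩
  have : NeZero n := ⟨hn.ne'⟩
  obtain ⟨α, hα⟩ := Field.exists_primitive_element F (FiniteField.Extension F r n)
  have hint : IsIntegral F α := Algebra.IsIntegral.isIntegral α
  refine ⟨minpoly F α, minpoly.irreducible hint, ?_⟩
  rw [← IntermediateField.adjoin.finrank hint, hα, IntermediateField.finrank_top']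
  exact FiniteField.finrank_extension F r n

/-- An irreducible polynomial whose degree divides that of a finite extension has at least two
roots there, when it is not linear. -/
lemma exists_roots_ne {F κ : Type*} [Field F] [Finite F] [Field κ] [Algebra F κ]
    [Module.Finite F κ] {p : Polynomial F} (hp : Irreducible p) (h1 : 1 < p.natDegree)
    (hdvd : p.natDegree ∣ Module.finrank F κ) :
    ∃ a b : κ, a ≠ b ∧ Polynomial.aeval a p = 0 ∧ Polynomial.aeval b p = 0 := by
  have := Fact.mk hp
  have hfin : Module.finrank F (AdjoinRoot p) = p.natDegree := finrank_quotient_span_eq_natDegree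
  have := Module.finite_of_finite F (M := κ)
  have : Module.Finite F (AdjoinRoot p) := Module.finite_of_finrank_pos (by omega)
  have := Module.finite_of_finite F (M := AdjoinRoot p)
  have hcard : Nat.card (AdjoinRoot p →ₐ[F] κ) = p.natDegree := by
    rw [FiniteField.natCard_algHom_of_finrank_dvd (hfin ▸ hdvd), hfin]
  have : Nontrivial (AdjoinRoot p →ₐ[F] κ) := by
    have : Finite (AdjoinRoot p →ₐ[F] κ) := Nat.finite_of_card_ne_zero (by omega)
    rw [← Finite.one_lt_card_iff_nontrivial]; omega
  obtain ⟨f, g, hfg⟩ := exists_pair_ne (AdjoinRoot p →ₐ[F] κ)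
  exact ⟨f (AdjoinRoot.root p), g (AdjoinRoot.root p), fun h => hfg (AdjoinRoot.algHom_ext h),
    AdjoinRoot.aeval_algHom_eq_zero p f, AdjoinRoot.aeval_algHom_eq_zero p g⟩

/-! ### Splitting of places in a constant extension -/

namespace Place
open WithZero

section
variable {K L : Type*} [Field K] [Field L] [Algebra K L] (v : Place K)
  (φ : L →+* v.Completion) (hφ : φ.comp (algebraMap K L) = v.embed)

/-- The place of an extension of `K` given by an embedding into the completion `K_v`. -/
def ofEmbedding : Place L where
  val := (Valued.v : Valuation v.Completion ℤᵐ⁰).comap φ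
  surjective γ := by
    obtain ⟨k, hk⟩ := v.surjective γ
    refine ⟨algebraMap K L k, ?_⟩
    rw [Valuation.comap_apply, ← RingHom.comp_apply, hφ, valued_embed, hk]

lemma ofEmbedding_val (x : L) : (v.ofEmbedding φ hφ).val x = Valued.v (φ x) := rfl

lemma ofEmbedding_val_algebraMap (k : K) :
    (v.ofEmbedding φ hφ).val (algebraMap K L k) = v.val k := by
  rw [ofEmbedding_val, ← RingHom.comp_apply, hφ, valued_embed]

variable (Fq : Type*) [Field Fq] [Fintype Fq] [Algebra Fq K] [Algebra Fq L] [IsScalarTower Fq K L]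

/-- `K` is dense in `K_v`, so every integral element of `L` is congruent to an element of `K`, and
the residue field does not grow. -/
lemma deg_ofEmbedding : (v.ofEmbedding φ hφ).deg Fq = v.deg Fq := by
  set w := v.ofEmbedding φ hφ
  have hw := v.ofEmbedding_val_algebraMap φ hφ
  let i : v.val.valuationSubring →+* w.val.valuationSubring :=
    ((algebraMap K L).comp v.val.valuationSubring.subtype).codRestrict
      w.val.valuationSubring.toSubring (fun x => (hw x).trans_le x.2)
  have hi : ∀ x, ((i x : w.val.valuationSubring) : L) = algebraMap K L x := fun _ => rfl
  have : IsLocalHom i := ⟨fun x hx => by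
    by_contra hn
    have h1 : v.val x < 1 := (residue_eq_zero_iff v x).1 ((IsLocalRing.residue_eq_zero_iff x).2 hn)
    rw [← hw] at h1
    exact (IsLocalRing.residue_eq_zero_iff (i x)).1 ((residue_eq_zero_iff w (i x)).2 h1) hx⟩
  let f : v.Residue →ₐ[Fq] w.Residue :=
    { IsLocalRing.ResidueField.map i with
      commutes' := fun c => by
        change IsLocalRing.ResidueField.map i (IsLocalRing.residue _ (v.constants Fq c)) =
          IsLocalRing.residue _ (w.constants Fq c)
        rw [IsLocalRing.ResidueField.map_residue]
        congr 1
        apply Subtype.ext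
        exact (IsScalarTower.algebraMap_apply Fq K L c).symm }
  refine (LinearEquiv.finrank_eq (LinearEquiv.ofBijective f.toLinearMap
    ⟨f.toRingHom.injective, fun y => ?_⟩)).symm
  obtain ⟨⟨x, hx⟩, rfl⟩ := IsLocalRing.residue_surjective y
  obtain ⟨k, hk⟩ := v.exists_valued_sub_embed_lt (φ x) 0
  rw [exp_zero] at hk
  have hk1 : w.val (algebraMap K L k - x) < 1 := by
    rw [ofEmbedding_val, map_sub, ← RingHom.comp_apply, hφ]; exact hk
  have hk2 : v.val k ≤ 1 := by
    rw [← hw, ← sub_add_cancel (algebraMap K L k) x]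
    exact w.val.map_add_le hk1.le hx
  refine ⟨IsLocalRing.residue _ ⟨k, hk2⟩, ?_⟩
  change IsLocalRing.ResidueField.map i (IsLocalRing.residue _ ⟨k, hk2⟩) = _
  rw [IsLocalRing.ResidueField.map_residue, ← sub_eq_zero, ← map_sub, residue_eq_zero_iff]
  exact hk1

end

section
variable {K : Type*} [Field K] {Fq : Type*} [Field Fq] [Fintype Fq] [Algebra Fq K]
  [IsFunctionFieldOfCurve Fq K] (v : Place K)

/-- Two distinct roots of `p` in `κ(v)` lift to `K_v` and give two embeddings of `K[X]/(p)`. The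
places differ because the adjoined root has distinct residues under them. -/
lemma exists_two_places_adjoinRoot {p : Polynomial Fq} (hp : Irreducible p)
    (h1 : 1 < p.natDegree) (hdvd : p.natDegree ∣ v.deg Fq)
    [Fact (Irreducible (p.map (algebraMap Fq K)))] :
    ∃ w₁ w₂ : Place (AdjoinRoot (p.map (algebraMap Fq K))),
      (∀ k : K, w₁.val (algebraMap _ _ k) = v.val k) ∧
      (∀ k : K, w₂.val (algebraMap _ _ k) = v.val k) ∧
      w₁.deg Fq = v.deg Fq ∧ w₂.deg Fq = v.deg Fq ∧ w₁ ≠ w₂ := by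
  have : Finite v.Residue := Module.finite_of_finite Fq
  obtain ⟨α, β, hne, hα, hβ⟩ := exists_roots_ne (κ := v.Residue) hp h1 hdvd
  obtain ⟨⟨a, ha⟩, rfl⟩ := IsLocalRing.residue_surjective α
  obtain ⟨⟨b, hb⟩, rfl⟩ := IsLocalRing.residue_surjective β
  obtain ⟨σ, hσ, hσa⟩ := v.exists_root_lift p ha hα
  obtain ⟨τ, hτ, hτb⟩ := v.exists_root_lift p hb hβ
  have h : ∀ τ : v.Completion, p.eval₂ (v.embed.comp (algebraMap Fq K)) τ = 0 →
      (p.map (algebraMap Fq K)).eval₂ v.embed τ = 0 := fun τ h => by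
    rw [Polynomial.eval₂_map, h]
  have hc : ∀ τ h, (AdjoinRoot.lift v.embed τ h).comp
    (algebraMap K (AdjoinRoot (p.map (algebraMap Fq K)))) = v.embed := fun τ h => by
    rw [AdjoinRoot.algebraMap_eq, AdjoinRoot.lift_comp_of]
  refine ⟨v.ofEmbedding _ (hc σ (h σ hσ)), v.ofEmbedding _ (hc τ (h τ hτ)),
    v.ofEmbedding_val_algebraMap _ _, v.ofEmbedding_val_algebraMap _ _,
    v.deg_ofEmbedding _ _ Fq, v.deg_ofEmbedding _ _ Fq, fun heq => hne ?_⟩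
  rw [← sub_eq_zero, ← map_sub, residue_eq_zero_iff]
  change v.val (a - b) < 1
  have e1 : (v.ofEmbedding _ (hc σ (h σ hσ))).val (AdjoinRoot.root _ - algebraMap K _ a) < 1 := by
    rw [ofEmbedding_val, map_sub, AdjoinRoot.lift_root, ← RingHom.comp_apply, hc]
    exact hσa
  have e2 : (v.ofEmbedding _ (hc τ (h τ hτ))).val (AdjoinRoot.root _ - algebraMap K _ b) < 1 := by
    rw [ofEmbedding_val, map_sub, AdjoinRoot.lift_root, ← RingHom.comp_apply, hc]
    exact hτb
  rw [heq] at e1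
  have e3 := Valuation.map_sub_lt _ e2 e1
  rwa [sub_sub_sub_cancel_left, ← map_sub, ofEmbedding_val_algebraMap] at e3

end

end Place

/-- **F. K. Schmidt**: the degrees of the places of a curve have no common factor, when the
constants are geometrically irreducible in the function field. -/
theorem exists_not_dvd_deg {Fq K : Type*} [Field Fq] [Fintype Fq] [Field K] [Algebra Fq K]
    [IsFunctionFieldOfCurve Fq K]
    (hgeom : ∀ p : Polynomial Fq, Irreducible p → Irreducible (p.map (algebraMap Fq K)))
    {ℓ : ℕ} (hℓ : 1 < ℓ) : ∃ v : Place K, ¬ ℓ ∣ v.deg Fq := by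
  by_contra! hdvd
  obtain ⟨p, hp, rfl⟩ := exists_irreducible_natDegree_eq Fq (n := ℓ) (by omega)
  have := Fact.mk (hgeom p hp)
  choose w₁ w₂ h₁ h₂ d₁ d₂ hne using fun v : Place K =>
    v.exists_two_places_adjoinRoot hp hℓ (hdvd v)
  have : Module.Finite K (AdjoinRoot (p.map (algebraMap Fq K))) :=
    (AdjoinRoot.powerBasis (hgeom p hp).ne_zero).finite
  have : IsFunctionFieldOfCurve Fq (AdjoinRoot (p.map (algebraMap Fq K))) :=
    .of_finite Fq (K := K)
  -- A place of the extension remembers its restriction to `K`, so only the two places over the same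
  -- `v` could collide.
  have key : ∀ {v v' : Place K} {w w' : Place (AdjoinRoot (p.map (algebraMap Fq K)))},
      (∀ k : K, w.val (algebraMap _ _ k) = v.val k) →
      (∀ k : K, w'.val (algebraMap _ _ k) = v'.val k) → w = w' → v = v' := by
    rintro v v' w _ h h' rfl
    exact Place.eq_of_le_one_iff fun f => by rw [← h, ← h']
  refine Divisor.not_injective_sumElim Fq w₁ w₂ d₁ d₂ ?_
  rintro (v | v) (v' | v') heq
  · exact congrArg _ (key (h₁ v) (h₁ v') heq)
  · obtain rfl := key (h₁ v) (h₂ v') heq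
    exact (hne v heq).elim
  · obtain rfl := key (h₂ v) (h₁ v') heq
    exact (hne v heq.symm).elim
  · exact congrArg _ (key (h₂ v) (h₂ v') heq)

open WithZero

lemma zpow_sum {G ι : Type*} [CommGroup G] (g : G) (s : Finset ι) (f : ι → ℤ) :
    g ^ ∑ i ∈ s, f i = ∏ i ∈ s, g ^ f i := by
  classical
  induction s using Finset.induction_on with
  | empty => simp
  | insert i s hi ih => rw [Finset.sum_insert hi, Finset.prod_insert hi, zpow_add, ih]

/-! ### Powers of `q` and the local norm groups -/

section QUnit
variable (Fq : Type*) [Field Fq] [Fintype Fq]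

lemma qUnit_zpow_injective : Function.Injective fun n : ℤ => qUnit Fq ^ n := by
  intro m n h
  have h1 := congrArg (fun u : ℝ≥0ˣ => (u : ℝ≥0)) h
  simp only [Units.val_zpow_eq_zpow_val] at h1
  refine zpow_right_injective₀ (a := (Fintype.card Fq : ℝ≥0)) ?_ ?_ h1
  · exact_mod_cast Fintype.card_pos
  · exact_mod_cast Fintype.one_lt_card.ne'

lemma zpowers_quotient (n : ℕ) : Nonempty ((Subgroup.zpowers (qUnit Fq) ⧸
    (Subgroup.zpowers (qUnit Fq ^ n)).subgroupOf (Subgroup.zpowers (qUnit Fq))) ≃*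
      Multiplicative (ZMod n)) := by
  set G := Subgroup.zpowers (qUnit Fq)
  set H := (Subgroup.zpowers (qUnit Fq ^ n)).subgroupOf G
  let g : G := ⟨qUnit Fq, Subgroup.mem_zpowers _⟩
  let φ : ℤ →+ Additive (G ⧸ H) := (zmultiplesHom _) (Additive.ofMul (QuotientGroup.mk' H g))
  have hφ : ∀ m : ℤ, φ m = Additive.ofMul (QuotientGroup.mk' H (g ^ m)) := fun m => by
    rw [zmultiplesHom_apply, map_zpow, ofMul_zpow]
  have hsurj : Function.Surjective φ := fun x => by
    obtain ⟨⟨_, m, rfl⟩, hy⟩ := QuotientGroup.mk'_surjective H x.toMul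
    exact ⟨m, (hφ m).trans (congrArg Additive.ofMul hy)⟩
  have hker : φ.ker = AddSubgroup.zmultiples (n : ℤ) := by
    ext m
    rw [AddMonoidHom.mem_ker, hφ, Int.mem_zmultiples_iff]
    change QuotientGroup.mk' H (g ^ m) = 1 ↔ _
    rw [QuotientGroup.mk'_apply, QuotientGroup.eq_one_iff, Subgroup.mem_subgroupOf,
      Subgroup.mem_zpowers_iff]
    refine exists_congr fun k => ?_
    rw [eq_comm, ← zpow_natCast, ← zpow_mul]
    exact (qUnit_zpow_injective Fq).eq_iff
  exact ⟨AddEquiv.toMultiplicativeRight (((QuotientAddGroup.quotientKerEquivOfSurjective φ hsurj).symm.trans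
    (QuotientAddGroup.quotientAddEquivOfEq hker)).trans (Int.quotientZMultiplesNatEquivZMod n))⟩

end QUnit

namespace Place
variable {K : Type*} [Field K] (v : Place K) (Fq : Type*) [Field Fq] [Fintype Fq] [Algebra Fq K]

lemma absVal_eq {x : v.Completion} (hx : x ≠ 0) :
    v.absVal Fq x = ((qUnit Fq ^ (v.deg Fq * log (Valued.v x : ℤᵐ⁰)) : ℝ≥0ˣ) : ℝ≥0) := by
  have h : (Valued.v x : ℤᵐ⁰) ≠ 0 := (Valuation.ne_zero_iff _).2 hx
  rw [zpow_mul, zpow_natCast, Units.val_zpow_eq_zpow_val, Units.val_pow_eq_pow_val]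
  change WithZeroMulInt.toNNReal (pow_ne_zero _ (Nat.cast_ne_zero.2 Fintype.card_ne_zero))
    (Valued.v x : ℤᵐ⁰) = _
  rw [WithZeroMulInt.toNNReal_neg_apply (pow_ne_zero _ (Nat.cast_ne_zero.2 Fintype.card_ne_zero)) h]
  have h1 : ∀ (γ : ℤᵐ⁰) (h : γ ≠ 0), Multiplicative.toAdd (unzero h) = log γ := fun γ h => by
    obtain ⟨n, rfl⟩ : ∃ n, γ = exp n := ⟨_, (exp_log h).symm⟩
    rw [log_exp]
    rfl
  rw [h1]
  rfl

lemma normRange_eq : v.normRange Fq = Subgroup.zpowers (qUnit Fq ^ v.deg Fq) := by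
  have key : ∀ x : v.Completionˣ, Units.map (v.absVal Fq : v.Completion →* ℝ≥0) x =
      (qUnit Fq ^ v.deg Fq) ^ log (Valued.v (x : v.Completion) : ℤᵐ⁰) := fun x => by
    ext1
    rw [Units.coe_map, ← zpow_natCast, ← zpow_mul]
    exact v.absVal_eq Fq x.ne_zero
  ext y
  rw [normRange, MonoidHom.mem_range, Subgroup.mem_zpowers_iff]
  constructor
  · rintro ⟨x, rfl⟩
    exact ⟨_, (key x).symm⟩
  · rintro ⟨n, rfl⟩
    obtain ⟨x, hx⟩ := v.valued_surjective (exp n)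
    have h0 : x ≠ 0 := (Valuation.ne_zero_iff _).1 (hx ▸ exp_ne_zero)
    refine ⟨Units.mk0 x h0, ?_⟩
    rw [key, Units.val_mk0, hx, log_exp]

end Place

/-! ### Concentrated ideles, the idele norm and principal ideles -/

section Ideles
variable {K : Type*} [Field K]

lemma Idele.apply_ne_zero (a : Idele K) (v : Place K) : (a : Adele K) v ≠ 0 :=
  left_ne_zero_of_mul_eq_one (Idele.mul_inv_apply K a v)

lemma Idele.ext {a b : Idele K} (h : ∀ v, (a : Adele K) v = (b : Adele K) v) : a = b :=
  Units.ext (DFunLike.ext _ _ h)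

open Classical in
/-- The adele with component `x` at `v` and `1` at all other places. -/
def Adele.concentrated (v : Place K) (x : v.Completion) : Adele K :=
  ⟨Function.update (fun _ => 1) v x, by
    refine (Set.finite_singleton v).subset fun w hw => ?_
    by_contra h
    refine hw ?_
    change Function.update (fun _ => 1) v x w ∈ w.integers
    rw [Function.update_of_ne h]
    exact one_mem w.integers⟩

lemma Adele.concentrated_self (v : Place K) (x : v.Completion) :
    Adele.concentrated v x v = x := by
  classical exact Function.update_self v x (fun _ => 1)

lemma Adele.concentrated_of_ne {v w : Place K} (h : w ≠ v) (x : v.Completion) :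
    Adele.concentrated v x w = 1 := by
  classical exact Function.update_of_ne h x (fun _ => 1)

lemma Adele.concentrated_mul (v : Place K) (x y : v.Completion) :
    Adele.concentrated v x * Adele.concentrated v y = Adele.concentrated v (x * y) := by
  refine DFunLike.ext _ _ fun w => ?_
  rw [Adele.mul_apply]
  rcases eq_or_ne w v with rfl | h
  · simp only [Adele.concentrated_self]
  · simp only [Adele.concentrated_of_ne h, mul_one]

lemma Adele.concentrated_one (v : Place K) : Adele.concentrated v 1 = 1 := by
  refine DFunLike.ext _ _ fun w => ?_
  rcases eq_or_ne w v with rfl | h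
  · rw [Adele.concentrated_self, Adele.one_apply]
  · rw [Adele.concentrated_of_ne h, Adele.one_apply]

/-- The idele with component `x` at `v` and `1` at all other places. -/
def Idele.concentrated (v : Place K) (x : v.Completionˣ) : Idele K where
  val := Adele.concentrated v x
  inv := Adele.concentrated v ↑x⁻¹
  val_inv := by rw [Adele.concentrated_mul, Units.mul_inv, Adele.concentrated_one]
  inv_val := by rw [Adele.concentrated_mul, Units.inv_mul, Adele.concentrated_one]

lemma puncturedOne_self (v : Place K) : puncturedOne v v = 0 := if_pos rfl

lemma puncturedOne_of_ne {v w : Place K} (h : w ≠ v) : puncturedOne v w = 1 := if_neg h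

lemma concentrated_smul_puncturedOne (v : Place K) (x : v.Completionˣ) :
    Idele.concentrated v x • puncturedOne v = puncturedOne v := by
  refine DFunLike.ext _ _ fun w => ?_
  rw [Units.smul_def, smul_eq_mul, Adele.mul_apply]
  rcases eq_or_ne w v with rfl | h
  · rw [puncturedOne_self, mul_zero]
  · rw [puncturedOne_of_ne h, mul_one]
    exact Adele.concentrated_of_ne h _

variable (Fq : Type*) [Field Fq] [Fintype Fq] [Algebra Fq K]

lemma coe_ideleNorm (a : Idele K) :
    (ideleNorm K Fq a : ℝ≥0) = ∏ᶠ v : Place K, v.absVal Fq ((a : Adele K) v) := rfl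

lemma ideleNorm_concentrated (v : Place K) (x : v.Completionˣ) :
    ideleNorm K Fq (Idele.concentrated v x) =
      Units.map (v.absVal Fq : v.Completion →* ℝ≥0) x := by
  ext1
  rw [coe_ideleNorm, finprod_eq_single _ v]
  · exact congrArg _ (Adele.concentrated_self v x.1)
  · intro w hw
    refine (congrArg _ (Adele.concentrated_of_ne hw x.1)).trans (map_one _)

/-- Allowing every larger finite set lets the sum be compared with the degree of a divisor whose
support is different. -/
lemma exists_ideleNorm_eq (a : Idele K) : ∃ s : Finset (Place K), ∀ t, s ⊆ t →
    ideleNorm K Fq a =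
      qUnit Fq ^ ∑ v ∈ t, (v.deg Fq * log (Valued.v ((a : Adele K) v) : ℤᵐ⁰)) := by
  refine ⟨(finite_mulSupport_absVal K Fq a).toFinset, fun t ht => ?_⟩
  ext1
  rw [coe_ideleNorm, finprod_eq_prod_of_mulSupport_subset (s := t), zpow_sum,
    Units.coe_prod]
  · exact Finset.prod_congr rfl fun v _ => v.absVal_eq Fq (Idele.apply_ne_zero a v)
  · intro v hv
    exact ht ((Set.Finite.mem_toFinset _).2 hv)

lemma ideleNorm_mem_zpowers (a : Idele K) : ideleNorm K Fq a ∈ Subgroup.zpowers (qUnit Fq) := by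
  obtain ⟨s, hs⟩ := exists_ideleNorm_eq Fq a
  exact ⟨_, (hs s subset_rfl).symm⟩

variable [IsFunctionFieldOfCurve Fq K]

include Fq in
/-- Nonzero functions are ideles. -/
lemma exists_principal_idele (k : Kˣ) :
    ∃ u : Idele K, ∀ v : Place K, (u : Adele K) v = ((k : K) : v.Completion) := by
  have h : ∀ k : Kˣ, ∃ a : Adele K, ∀ v : Place K, a v = v.embed k := fun k => by
    refine ⟨⟨fun v => v.embed k, (finite_val_ne_one Fq k.ne_zero).subset fun v hv h => hv ?_⟩,
      fun v => rfl⟩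
    exact (v.valued_embed k).trans_le h.le
  obtain ⟨a, ha⟩ := h k
  obtain ⟨b, hb⟩ := h k⁻¹
  have hab : a * b = 1 := DFunLike.ext _ _ fun v => by
    rw [Adele.mul_apply, ha, hb, ← map_mul, Units.mul_inv, map_one, Adele.one_apply]
  exact ⟨⟨a, b, hab, (mul_comm _ _).trans hab⟩, ha⟩

/-- The product formula. -/
lemma ideleNorm_principal {a : Idele K} (ha : a ∈ principal K) : ideleNorm K Fq a = 1 := by
  obtain ⟨k, hk⟩ := ha
  obtain ⟨s, hs⟩ := exists_ideleNorm_eq Fq a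
  have hval : ∀ v : Place K, (Valued.v ((a : Adele K) v) : ℤᵐ⁰) = v.val k := fun v => by
    rw [hk]; exact v.valued_embed k
  classical
  rw [hs (s ∪ (Divisor.div Fq (k : K)).support) Finset.subset_union_left, ← zpow_zero (qUnit Fq)]
  congr 1
  have hdeg := Divisor.degree_div Fq (k : K)
  rw [Divisor.degree, Finsupp.linearCombination_apply,
    Finsupp.sum_of_support_subset _ (Finset.subset_union_right (s₁ := s)) _ (by simp)] at hdeg
  rw [← neg_eq_zero, ← hdeg, ← Finset.sum_neg_distrib]
  refine Finset.sum_congr rfl fun v _ => ?_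
  rw [hval, Divisor.div_apply, smul_eq_mul]
  ring

end Ideles

open WithZero

/-! ### The norm on idele classes and the stabilizers of the base points -/

section Classes
variable {K : Type*} [Field K] (Fq : Type*) [Field Fq] [Fintype Fq] [Algebra Fq K]
  [IsFunctionFieldOfCurve Fq K]

/-- The norm of idele classes. -/
def IdeleClass.norm : IdeleClass K →* ℝ≥0ˣ :=
  QuotientGroup.lift (principal K) (ideleNorm K Fq) fun _ ha => ideleNorm_principal Fq ha

lemma IdeleClass.norm_mk (a : Idele K) : IdeleClass.norm Fq (a : IdeleClass K) = ideleNorm K Fq a :=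
  rfl

lemma IdeleClass.ker_norm : (IdeleClass.norm Fq).ker = normOne K Fq := by
  ext c
  obtain ⟨a, rfl⟩ := QuotientGroup.mk_surjective c
  constructor
  · exact fun h => ⟨a, h, rfl⟩
  · rintro ⟨b, hb, hab⟩
    rw [MonoidHom.mem_ker, ← hab]
    exact hb

/-- The exponents of the norms form a subgroup `dℤ` containing every `n_v`, by concentrated ideles.
Positivity of the degrees excludes `d = 0`, and the absence of a common factor excludes `|d| > 1`.
-/
lemma IdeleClass.range_norm (hdeg : ∀ ℓ : ℕ, 1 < ℓ → ∃ v : Place K, ¬ ℓ ∣ v.deg Fq) :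
    (IdeleClass.norm Fq (K := K)).range = Subgroup.zpowers (qUnit Fq) := by
  refine le_antisymm ?_ ?_
  · rintro _ ⟨c, rfl⟩
    obtain ⟨a, rfl⟩ := QuotientGroup.mk_surjective c
    exact ideleNorm_mem_zpowers Fq a
  · let S : AddSubgroup ℤ := (((IdeleClass.norm Fq (K := K)).range.comap
      (zpowersHom ℝ≥0ˣ (qUnit Fq)))).toAddSubgroup'
    have hS : ∀ n, n ∈ S ↔ qUnit Fq ^ n ∈ (IdeleClass.norm Fq (K := K)).range := fun n => Iff.rfl
    have hmem : ∀ v : Place K, (v.deg Fq : ℤ) ∈ S := fun v => by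
      rw [hS, zpow_natCast]
      have : qUnit Fq ^ v.deg Fq ∈ v.normRange Fq := v.normRange_eq Fq ▸ Subgroup.mem_zpowers _
      obtain ⟨x, hx⟩ := this
      exact ⟨(Idele.concentrated v x : Idele K), (ideleNorm_concentrated Fq v x).trans hx⟩
    obtain ⟨d, hd⟩ := Int.subgroup_cyclic S
    rw [← AddSubgroup.zmultiples_eq_closure] at hd
    have hdvd : ∀ v : Place K, d.natAbs ∣ v.deg Fq := fun v => by
      have := hmem v
      rw [hd, Int.mem_zmultiples_iff] at this
      exact Int.natAbs_dvd_natAbs.2 this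
    have h1 : d.natAbs = 1 := by
      by_contra hne
      rcases Nat.eq_zero_or_pos d.natAbs with h0 | h0
      · obtain ⟨v, -⟩ := hdeg 2 (by norm_num)
        have h2 := hdvd v
        rw [h0, zero_dvd_iff] at h2
        exact (v.deg_pos Fq).ne' h2
      · obtain ⟨v, hv⟩ := hdeg d.natAbs (by omega)
        exact hv (hdvd v)
    have h2 : (1 : ℤ) ∈ S := by
      rw [hd, Int.mem_zmultiples_iff]
      exact Int.natAbs_dvd.1 (by simp [h1])
    rw [Subgroup.zpowers_le]
    simpa [hS] using h2

lemma Place.exists_norm_eq (v : Place K) {y : ℝ≥0ˣ} (hy : y ∈ v.normRange Fq) :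
    ∃ x : v.Completionˣ, IdeleClass.norm Fq (Idele.concentrated v x : IdeleClass K) = y := by
  obtain ⟨x, hx⟩ := hy
  exact ⟨x, (ideleNorm_concentrated Fq v x).trans hx⟩

lemma concentrated_smul_puncturedClass (v : Place K) (x : v.Completionˣ) :
    (Idele.concentrated v x : IdeleClass K) • puncturedClass v = puncturedClass v :=
  congrArg (Quotient.mk _) (concentrated_smul_puncturedOne v x)

/-- Ideles have no zero components, so the place where the adele vanishes is preserved. Elsewhere
`a` coincides with the principal idele `k`, hence `k⁻¹ a` is concentrated at `v`. -/
lemma exists_of_smul_puncturedClass_eq {c : IdeleClass K} {v w : Place K}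
    (h : c • puncturedClass v = puncturedClass w) :
    v = w ∧ ∃ x : v.Completionˣ, c = (Idele.concentrated v x : IdeleClass K) := by
  obtain ⟨a, rfl⟩ := QuotientGroup.mk_surjective c
  obtain ⟨⟨k, hk⟩, hka⟩ := Quotient.exact h
  have hka' : k * puncturedOne w = a * puncturedOne v := hka
  have hcomp : ∀ z : Place K, (k : Adele K) z * puncturedOne w z = (a : Adele K) z * puncturedOne v z :=
    fun z => by rw [← Adele.mul_apply, hka', Adele.mul_apply]
  have hvw : v = w := by
    by_contra hne
    have := hcomp v
    rw [puncturedOne_self, mul_zero, puncturedOne_of_ne hne, mul_one] at this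
    exact Idele.apply_ne_zero k v this
  subst hvw
  refine ⟨rfl, Units.mk0 (((k⁻¹ * a : Idele K) : Adele K) v) (Idele.apply_ne_zero _ v), ?_⟩
  have heq : k⁻¹ * a = Idele.concentrated v (Units.mk0 (((k⁻¹ * a : Idele K) : Adele K) v)
      (Idele.apply_ne_zero _ v)) := by
    refine Idele.ext fun z => ?_
    rcases eq_or_ne z v with rfl | hz
    · exact (Adele.concentrated_self z _).symm
    · refine Eq.trans ?_ (Adele.concentrated_of_ne hz _).symm
      have h1 := hcomp z
      rw [puncturedOne_of_ne hz, mul_one, mul_one] at h1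
      rw [Units.val_mul, Adele.mul_apply, ← h1, ← Adele.mul_apply, Units.inv_mul, Adele.one_apply]
  rw [← heq, QuotientGroup.eq, mul_comm, mul_inv_cancel_right]
  exact inv_mem hk

namespace XiQuotient

omit [IsFunctionFieldOfCurve Fq K] in
lemma smul_base (c : IdeleClass K) (v : Place K) :
    c • base Fq v = (Quotient.mk _ (c • Xi.base v) : XiQuotient K Fq) := rfl

omit [IsFunctionFieldOfCurve Fq K] in
lemma exists_eq_smul_base (x : XiQuotient K Fq) : ∃ (v : Place K) (c : IdeleClass K),
    x = c • base Fq v := by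
  induction x using Quotient.inductionOn with
  | _ x =>
    obtain ⟨v, c, hc⟩ := Set.mem_iUnion.1 x.2
    exact ⟨v, c, congrArg (Quotient.mk _) (Subtype.ext hc.symm)⟩

lemma eq_of_smul_base_eq {c : IdeleClass K} {v w : Place K}
    (h : c • base Fq v = base Fq w) : v = w ∧ IdeleClass.norm Fq c ∈ v.normRange Fq := by
  rw [smul_base] at h
  obtain ⟨⟨d, hd⟩, hdc⟩ := Quotient.exact h
  have h1 : d • puncturedClass w = c • puncturedClass v := congrArg Subtype.val hdc
  rw [← inv_smul_eq_iff, smul_smul] at h1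
  obtain ⟨rfl, x, hx⟩ := exists_of_smul_puncturedClass_eq h1
  refine ⟨rfl, x⁻¹, ?_⟩
  rw [map_inv, ← ideleNorm_concentrated, ← IdeleClass.norm_mk, ← hx, map_mul, map_inv]
  rw [← IdeleClass.ker_norm] at hd
  rw [MonoidHom.mem_ker.1 hd, mul_one, inv_inv]

/-- An idele concentrated at `v` with the norm of `c` fixes `a^(v)`, and dividing `c` by it leaves a
class of norm one, which acts trivially on the quotient. -/
lemma smul_base_eq {c : IdeleClass K} {v : Place K} (h : IdeleClass.norm Fq c ∈ v.normRange Fq) :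
    c • base Fq v = base Fq v := by
  obtain ⟨x, hx⟩ := v.exists_norm_eq Fq h
  rw [smul_base]
  refine Quotient.sound ⟨⟨c * (Idele.concentrated v x : IdeleClass K)⁻¹, ?_⟩, ?_⟩
  · rw [← IdeleClass.ker_norm, MonoidHom.mem_ker, map_mul, map_inv, hx, mul_inv_cancel]
  · refine Subtype.ext ?_
    change (c * (Idele.concentrated v x : IdeleClass K)⁻¹) • puncturedClass v = c • puncturedClass v
    rw [mul_smul, inv_smul_eq_iff.2 (concentrated_smul_puncturedClass v x).symm]

lemma stabilizer_base (v : Place K) : MulAction.stabilizer (IdeleClass K) (base Fq v) =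
    (v.normRange Fq).comap (IdeleClass.norm Fq) :=
  SetLike.ext fun _ => ⟨fun h => (eq_of_smul_base_eq Fq h).2, fun h => smul_base_eq Fq h⟩

end XiQuotient

end Classes

/-- Two sets whose orbits are matched by the same index set and have the same stabilizers: there is
exactly one equivariant bijection between them that matches given base points. -/
theorem existsUnique_equivariant_equiv {G H Y X I : Type*} [Group G] [Group H] [MulAction G Y]
    (N : G → H → Prop) (hN : ∀ g, ∃ h, N g h) (hN' : ∀ h, ∃ g, N g h)
    [MulAction H X] (b : I → Y) (s : I → X)
    (hb : ∀ y, ∃ i, ∃ g : G, y = g • b i) (hs : ∀ x, ∃ i, ∃ h : H, x = h • s i)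
    (hbs : ∀ g g' h h' i j, N g h → N g' h' → (g • b i = g' • b j ↔ h • s i = h' • s j))
    (hmul : ∀ g g' h h', N g h → N g' h' → N (g * g') (h * h')) (hone : N 1 1) :
    ∃! Φ : Y ≃ X, (∀ g h, N g h → ∀ y, Φ (g • y) = h • Φ y) ∧ ∀ i, Φ (b i) = s i := by
  choose i g hig using hb
  choose j k hjk using hs
  choose e he using hN
  choose f hf using hN'
  -- Each point is written as a translate of a base point and the translation is carried across by
  -- `N`; `hbs` makes the result independent of the choices, in both directions.
  refine ⟨⟨fun y => e (g y) • s (i y), fun x => f (k x) • b (j x), fun y => ?_, fun x => ?_⟩,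
    ⟨fun a h ha y => ?_, fun l => ?_⟩, fun Ψ hΨ => ?_⟩
  · conv_rhs => rw [hig y]
    rw [hbs _ _ _ _ _ _ (hf _) (he _), ← hjk]
  · change e (g (f (k x) • b (j x))) • s (i (f (k x) • b (j x))) = x
    conv_rhs => rw [hjk x]
    rw [← hbs _ _ _ _ _ _ (he _) (hf _), ← hig]
  · change e (g (a • y)) • s (i (a • y)) = h • e (g y) • s (i y)
    rw [smul_smul, ← hbs _ _ _ _ _ _ (he _) (hmul _ _ _ _ ha (he _)), ← hig, mul_smul, ← hig]
  · change e (g (b l)) • s (i (b l)) = s l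
    rw [← one_smul H (s l), ← hbs _ _ _ _ _ _ (he _) hone, ← hig, one_smul]
  · ext y
    change Ψ y = e (g y) • s (i y)
    conv_lhs => rw [hig y]
    rw [hΨ.1 _ _ (he _), hΨ.2]

/-! ### Equivariant bijections from the quotient of the periodic points -/

section Equivariant
variable {K : Type*} [Field K] (Fq : Type*) [Field Fq] [Fintype Fq] [Algebra Fq K]
  [IsFunctionFieldOfCurve Fq K]

/-- The two actions are related by `|c| = q ^ n`. By `hdeg` every `n` occurs, so the adelic orbit of
`v` is a full copy of `ℤ/n_v`, like the orbit of `s v` under `F`. -/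
theorem existsUnique_equivariant (hdeg : ∀ ℓ : ℕ, 1 < ℓ → ∃ v : Place K, ¬ ℓ ∣ v.deg Fq)
    {X : Type*} (F : Equiv.Perm X) (s : Place K → X)
    (hs : ∀ x, ∃ v, ∃ n : ℤ, x = (F ^ n) (s v))
    (hs' : ∀ (v w : Place K) (n : ℤ), (F ^ n) (s v) = s w ↔ v = w ∧ (v.deg Fq : ℤ) ∣ n) :
    ∃! Φ : XiQuotient K Fq ≃ X,
      (∀ (c : IdeleClass K) (n : ℤ), IdeleClass.norm Fq c = qUnit Fq ^ n →
        ∀ x : XiQuotient K Fq, Φ (c • x) = (F ^ n) (Φ x)) ∧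
      ∀ v : Place K, Φ (XiQuotient.base Fq v) = s v := by
  have hrange := IdeleClass.range_norm Fq hdeg
  let act : MulAction (Multiplicative ℤ) X := MulAction.compHom X (zpowersHom (Equiv.Perm X) F)
  have hact : ∀ (n : ℤ) x, Multiplicative.ofAdd n • x = (F ^ n) x := fun _ _ => rfl
  have key := existsUnique_equivariant_equiv (G := IdeleClass K) (H := Multiplicative ℤ)
    (Y := XiQuotient K Fq) (X := X)
    (fun c n => IdeleClass.norm Fq c = qUnit Fq ^ n.toAdd) (fun c => ?_) (fun n => ?_)
    (XiQuotient.base Fq) s (XiQuotient.exists_eq_smul_base Fq) hs ?_ ?_ ?_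
  · exact key
  · obtain ⟨n, hn⟩ := hrange.le ⟨c, rfl⟩
    exact ⟨Multiplicative.ofAdd n, hn.symm⟩
  · exact hrange.ge ⟨n.toAdd, rfl⟩
  · intro c c' m n v w hm hn
    rw [← inv_smul_eq_iff (g := c'), smul_smul, ← inv_smul_eq_iff (g := n), smul_smul]
    have hc : IdeleClass.norm Fq (c'⁻¹ * c) = qUnit Fq ^ (n⁻¹ * m).toAdd := by
      rw [map_mul, map_inv, hm, hn, toAdd_mul, toAdd_inv, zpow_add, zpow_neg]
    have hiff : IdeleClass.norm Fq (c'⁻¹ * c) ∈ v.normRange Fq ↔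
        (v.deg Fq : ℤ) ∣ (n⁻¹ * m).toAdd := by
      rw [hc, v.normRange_eq, Subgroup.mem_zpowers_iff]
      refine exists_congr fun k => ?_
      rw [eq_comm, ← zpow_natCast, ← zpow_mul]
      exact (qUnit_zpow_injective Fq).eq_iff
    refine Iff.trans ?_ (hs' v w (n⁻¹ * m).toAdd).symm
    rw [← hiff]
    constructor
    · exact fun h => XiQuotient.eq_of_smul_base_eq Fq h
    · rintro ⟨rfl, h⟩
      exact XiQuotient.smul_base_eq Fq h
  · intro c c' m n hm hn
    rw [map_mul, hm, hn, toAdd_mul, zpow_add]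
  · rw [map_one]; rfl

end Equivariant

/-! ### Algebra of smooth curves: function fields and local rings -/

section SmoothCurves
open Algebra

/-- A smooth algebra of relative dimension one is étale over a polynomial ring in one variable. -/
lemma exists_etale_polynomial (F A : Type u) [Field F] [CommRing A] [Algebra F A]
    [IsStandardSmoothOfRelativeDimension 1 F A] : ∃ g : Polynomial F →ₐ[F] A, g.toRingHom.Etale := by
  obtain ⟨g, hg⟩ := IsStandardSmoothOfRelativeDimension.exists_etale_mvPolynomial (n := 1) F A
  let e : Polynomial F ≃ₐ[F] MvPolynomial (Fin 1) F := (MvPolynomial.uniqueAlgEquiv F (Fin 1)).symm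
  refine ⟨g.comp e.toAlgHom, ?_⟩
  exact RingHom.Etale.respectsIso.2 g.toRingHom e.toRingEquiv hg

/-- The function field of a smooth curve. -/
lemma IsFunctionFieldOfCurve.of_smooth (F A : Type u) {K : Type u} [Field F] [CommRing A]
    [IsDomain A] [Field K] [Algebra F A] [Algebra F K] [Algebra A K] [IsScalarTower F A K]
    [IsFractionRing A K] [IsStandardSmoothOfRelativeDimension 1 F A] : IsFunctionFieldOfCurve F K := by
  obtain ⟨g, hg⟩ := exists_etale_polynomial F A
  let := g.toRingHom.toAlgebra
  have : IsScalarTower F (Polynomial F) A := .of_algebraMap_eq' g.comp_algebraMap.symm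
  have : Algebra.Etale (Polynomial F) A := hg
  let : Algebra (Polynomial F) K := ((algebraMap A K).comp g.toRingHom).toAlgebra
  have : IsScalarTower (Polynomial F) A K := .of_algebraMap_eq' rfl
  have : IsScalarTower F (Polynomial F) K := .to₁₂₄ _ _ A _
  have h1 : EssFiniteType A K := .of_isLocalization K (nonZeroDivisors A)
  have h2 : FormallyUnramified A K := .of_isLocalization (nonZeroDivisors A)
  have h3 : EssFiniteType (Polynomial F) K := .comp _ A _
  have h4 : FormallyUnramified (Polynomial F) K := .comp _ A _
  have hinj : Function.Injective (algebraMap (Polynomial F) K) := by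
    have : Module.Flat (Polynomial F) A := inferInstance
    rw [IsScalarTower.algebraMap_eq (Polynomial F) A K]
    exact (IsFractionRing.injective A K).comp (FaithfulSMul.algebraMap_injective (Polynomial F) A)
  have : FaithfulSMul (Polynomial F) K := (faithfulSMul_iff_algebraMap_injective _ _).2 hinj
  let : Algebra (FractionRing (Polynomial F)) K := FractionRing.liftAlgebra (Polynomial F) K
  have : IsScalarTower (Polynomial F) (FractionRing (Polynomial F)) K := inferInstance
  have h5 : EssFiniteType (FractionRing (Polynomial F)) K := .of_comp (Polynomial F) _ _
  have h6 : FormallyUnramified (FractionRing (Polynomial F)) K := .of_restrictScalars (Polynomial F) _ _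
  -- An unramified, essentially finite type field extension is separable algebraic, so `K` has the
  -- transcendence degree of `F(X)`.
  have h7 : Algebra.IsSeparable (FractionRing (Polynomial F)) K :=
    FormallyUnramified.isSeparable _ _
  have h8 : Algebra.IsAlgebraic (Polynomial F) K :=
    (IsFractionRing.comap_isAlgebraic_iff (K := FractionRing (Polynomial F))).2 inferInstance
  refine { toEssFiniteType := ?_, trdeg_eq_one := ?_ }
  · have : EssFiniteType F A := .comp F (Polynomial F) A
    exact .comp F A K
  · have := trdeg_add_eq F (Polynomial F) (A := K)
    rw [trdeg_eq_zero (R := Polynomial F), add_zero] at this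
    rw [← this]
    exact Polynomial.trdeg_of_isDomain

/-- The local rings of a smooth curve are discrete valuation rings. -/
lemma isDiscreteValuationRing_of_smooth (F : Type u) {A : Type u} [Field F] [CommRing A]
    [IsDomain A] [Algebra F A] [IsStandardSmoothOfRelativeDimension 1 F A] (q : Ideal A) [q.IsPrime] (hq : q ≠ ⊥) (O : Type u)
    [CommRing O] [IsDomain O] [IsLocalRing O] [Algebra A O] [IsLocalization.AtPrime O q] :
    IsDiscreteValuationRing O := by
  obtain ⟨g, hg⟩ := exists_etale_polynomial F A
  let := g.toRingHom.toAlgebra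
  have : Algebra.Etale (Polynomial F) A := hg
  have : IsNoetherianRing A := FiniteType.isNoetherianRing (Polynomial F) A
  have : IsNoetherianRing O := IsLocalization.isNoetherianRing q.primeCompl O inferInstance
  let := Localization.AtPrime.algebraOfLiesOver (q.under (Polynomial F)) q
  -- Being étale over `F[X]`, the local ring has its maximal ideal generated by that of the prime
  -- below, which is principal.
  have h1 := ((isUnramifiedAt_iff_map_eq (Polynomial F) (q.under (Polynomial F)) q).1 inferInstance).2
  have h2 : (IsLocalRing.maximalIdeal O).IsPrincipal := by
    let e := (IsLocalization.algEquiv q.primeCompl (Localization.AtPrime q) O).toRingEquiv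
    rw [← IsLocalRing.map_ringEquiv_maximalIdeal e, ← h1]
    exact ((IsPrincipalIdealRing.principal _).map_ringHom _).map_ringHom _
  exact ((IsDiscreteValuationRing.TFAE O
      (IsLocalization.AtPrime.not_isField A hq O)).out 4 0).mp h2

end SmoothCurves

/-! ### Irreducible polynomials that stay irreducible over the function field -/

section GeomIrreducible
open Polynomial TensorProduct

variable {F A K : Type*} [Field F] [CommRing A] [Field K] [Algebra F A] [Algebra F K] [Algebra A K]
  [IsScalarTower F A K]

/-- As `h` divides `p`, there is a homomorphism from `A ⊗ F[X]/(p)` to `K[X]/(h)` taking root to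
root. It turns nilpotency of `G` at the root into `g ^ n = 0` modulo `h`, up to the unit `b ^ n`. -/
lemma exists_dvd_pow_of_isNilpotent {p : F[X]} {g h : K[X]} (hp : h ∣ p.map (algebraMap F K))
    {G : A[X]} {b : A} (hb : algebraMap A K b ≠ 0) (hG : G.map (algebraMap A K) = b • g)
    (hnil : IsNilpotent (aeval (1 ⊗ₜ[F] AdjoinRoot.root p : A ⊗[F] AdjoinRoot p) G)) :
    ∃ n, h ∣ g ^ n := by
  have hroot : aeval (AdjoinRoot.root h) p = 0 := by
    obtain ⟨k, hk⟩ := hp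
    rw [← aeval_map_algebraMap K, hk, map_mul, AdjoinRoot.aeval_eq, AdjoinRoot.mk_self, zero_mul]
  let ψ : A ⊗[F] AdjoinRoot p →ₐ[A] AdjoinRoot h :=
    Algebra.TensorProduct.lift (Algebra.ofId A (AdjoinRoot h))
      (AdjoinRoot.liftAlgHom p (Algebra.ofId F (AdjoinRoot h)) (AdjoinRoot.root h) hroot)
      fun _ _ => .all ..
  have hψ : ψ (1 ⊗ₜ[F] AdjoinRoot.root p) = AdjoinRoot.root h := by
    rw [Algebra.TensorProduct.lift_tmul, map_one, one_mul]
    exact AdjoinRoot.liftAlgHom_root ..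
  obtain ⟨n, hn⟩ := hnil
  refine ⟨n, ?_⟩
  have h1 := congrArg ψ hn
  rw [map_pow, map_zero, ← aeval_algHom_apply, hψ, ← aeval_map_algebraMap K, hG,
    AdjoinRoot.aeval_eq, ← map_pow, AdjoinRoot.mk_eq_zero, ← algebraMap_smul K b g, _root_.smul_pow,
    smul_eq_C_mul, IsUnit.dvd_mul_left] at h1
  · exact h1
  · exact isUnit_C.2 (pow_ne_zero _ hb).isUnit

/-- A separable irreducible polynomial stays irreducible over the fraction field of `A`, if the
spectrum of `A ⊗ F[X] / (p)` is irreducible. -/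
lemma irreducible_map_of_isNilpotent [IsDomain A] [IsFractionRing A K] {p : F[X]}
    (hp : Irreducible p) (hsep : p.Separable)
    (hnil : ∀ a b : A ⊗[F] AdjoinRoot p, a * b = 0 → IsNilpotent a ∨ IsNilpotent b) :
    Irreducible (p.map (algebraMap F K)) := by
  have hsep' : (p.map (algebraMap F K)).Separable := hsep.map
  -- Separability makes the two factors coprime.
  have key : ∀ {g h : K[X]}, p.map (algebraMap F K) = g * h → ∀ n, h ∣ g ^ n → IsUnit h := by
    intro g h hgh n hn
    rw [hgh] at hsep'
    exact (hsep'.isCoprime.pow_left (m := n)).isUnit_of_dvd' hn dvd_rfl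
  refine ⟨fun hu => ?_, fun g h hgh => ?_⟩
  · exact hp.natDegree_pos.ne' (by rw [← natDegree_map (algebraMap F K), natDegree_eq_zero_of_isUnit hu])
  obtain ⟨b, hbA, hb⟩ := IsLocalization.integerNormalization_spec (nonZeroDivisors A) g
  obtain ⟨c, hcA, hc⟩ := IsLocalization.integerNormalization_spec (nonZeroDivisors A) h
  set G := IsLocalization.integerNormalization (nonZeroDivisors A) g
  set H := IsLocalization.integerNormalization (nonZeroDivisors A) h
  have hGH : G * H = C (b * c) * p.map (algebraMap F A) := by
    apply map_injective _ (IsFractionRing.injective A K)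
    rw [Polynomial.map_mul, hb, hc, Polynomial.map_mul, Polynomial.map_map, ← IsScalarTower.algebraMap_eq, hgh,
      map_C, ← algebraMap_smul K b g, ← algebraMap_smul K c h, smul_eq_C_mul,
      smul_eq_C_mul, map_mul, C_mul]
    ring
  have hb0 : algebraMap A K b ≠ 0 := IsFractionRing.to_map_ne_zero_of_mem_nonZeroDivisors hbA
  have hc0 : algebraMap A K c ≠ 0 := IsFractionRing.to_map_ne_zero_of_mem_nonZeroDivisors hcA
  have hr : aeval (1 ⊗ₜ[F] AdjoinRoot.root p : A ⊗[F] AdjoinRoot p) p = 0 := by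
    have := aeval_algHom_apply (Algebra.TensorProduct.includeRight : _ →ₐ[F] A ⊗[F] AdjoinRoot p)
      (AdjoinRoot.root p) p
    rw [Algebra.TensorProduct.includeRight_apply] at this
    rw [this, AdjoinRoot.aeval_eq, AdjoinRoot.mk_self, map_zero]
  have h0 : aeval (1 ⊗ₜ[F] AdjoinRoot.root p : A ⊗[F] AdjoinRoot p) G *
      aeval (1 ⊗ₜ[F] AdjoinRoot.root p : A ⊗[F] AdjoinRoot p) H = 0 := by
    rw [← map_mul, hGH, map_mul, aeval_map_algebraMap, hr, mul_zero]
  rcases hnil _ _ h0 with hn | hn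
  · obtain ⟨n, hn⟩ := exists_dvd_pow_of_isNilpotent (hgh ▸ dvd_mul_left h g) hb0 hb hn
    exact .inr (key hgh n hn)
  · obtain ⟨n, hn⟩ := exists_dvd_pow_of_isNilpotent (hgh ▸ dvd_mul_right g h) hc0 hc hn
    exact .inl (key (hgh.trans (mul_comm g h)) n hn)

end GeomIrreducible

/-! ### From the scheme to its affine charts and function field -/

section Scheme
variable (Fq : Type u) [Field Fq] (C : Scheme.{u}) [C.Over (Spec (.of Fq))]

/-- The constants, as functions on an open set. -/
def openConstants (U : C.Opens) : CommRingCat.of Fq ⟶ Γ(C, U) :=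
  (Scheme.ΓSpecIso (.of Fq)).inv ≫ (C ↘ Spec (.of Fq)).appLE ⊤ U le_top

variable {C}

lemma fromSpec_comp_over {U : C.Opens} (hU : IsAffineOpen U) :
    hU.fromSpec ≫ (C ↘ Spec (.of Fq)) = Spec.map (openConstants Fq C U) := by
  rw [openConstants, Spec.map_comp,
    ← IsAffineOpen.SpecMap_appLE_fromSpec (C ↘ Spec (.of Fq)) (isAffineOpen_top _) hU le_top]
  congr 1
  rw [IsAffineOpen.fromSpec_top, Scheme.isoSpec_Spec_inv]

lemma algebraMap_functionField_eq [IsIntegral C] (U : C.Opens) [Nonempty U] (c : Fq) :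
    algebraMap Fq C.functionField c = algebraMap Γ(C, U) C.functionField (openConstants Fq C U c) := by
  change _ = (C.presheaf.germ U (genericPoint C) _).hom _
  have : openConstants Fq C U ≫ C.presheaf.germ U (genericPoint C) (((genericPoint_spec
      C).mem_open_set_iff U.isOpen).mpr (by simpa using ‹Nonempty U›)) =
      (Scheme.ΓSpecIso (.of Fq)).inv ≫ (C ↘ Spec (.of Fq)).appTop ≫
        C.presheaf.germ ⊤ (genericPoint C) trivial := by
    have h : (C ↘ Spec (.of Fq)).appLE ⊤ U le_top =
      (C ↘ Spec (.of Fq)).appTop ≫ C.presheaf.map (homOfLE le_top).op := rfl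
    rw [openConstants, h, Category.assoc, Category.assoc]
    congr 2
    exact TopCat.Presheaf.germ_res ..
  exact (congrArg (fun f => f.hom c) this).symm

lemma exists_isStandardSmooth [SmoothOfRelativeDimension 1 (C ↘ Spec (.of Fq))] (x : C) :
    ∃ U : C.Opens, IsAffineOpen U ∧ x ∈ U ∧
      (openConstants Fq C U).hom.IsStandardSmoothOfRelativeDimension 1 := by
  obtain ⟨V, hV, U, hU, hx, e, hf⟩ :=
    SmoothOfRelativeDimension.exists_isStandardSmoothOfRelativeDimension (n := 1)
      (f := C ↘ Spec (.of Fq)) x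
  refine ⟨U, hU, hx, ?_⟩
  -- The spectrum of a field has a single point, so the nonempty open `V` is everything.
  obtain rfl : V = ⊤ := by
    ext y
    have : y = (C ↘ Spec (.of Fq)) x := Subsingleton.elim (α := PrimeSpectrum Fq) _ _
    rw [this]
    exact ⟨fun _ => trivial, fun _ => e hx⟩
  exact RingHom.isStandardSmoothOfRelativeDimension_respectsIso.2 _
    (Scheme.ΓSpecIso (.of Fq)).symm.commRingCatIsoToRingEquiv hf

variable [IsIntegral C]

/-- The base change of an affine open to `F_q[X]/(p)` is irreducible, so the nilradical of the
tensor product is prime; and `p` is separable because finite fields are perfect. -/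
theorem irreducible_map_functionField [Finite Fq] [GeometricallyIrreducible (C ↘ Spec (.of Fq))]
    {p : Polynomial Fq} (hp : Irreducible p) :
    Irreducible (p.map (algebraMap Fq C.functionField)) := by
  obtain ⟨U, hU, hxU⟩ : ∃ U : C.Opens, IsAffineOpen U ∧ genericPoint C ∈ U := by
    obtain ⟨_, ⟨U, hU, rfl⟩, hxU, -⟩ := C.isBasis_affineOpens.exists_subset_of_mem_open
      (Set.mem_univ (genericPoint C)) isOpen_univ
    exact ⟨U, hU, hxU⟩
  have : Nonempty U := ⟨⟨_, hxU⟩⟩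
  let : Algebra Fq Γ(C, U) := (openConstants Fq C U).hom.toAlgebra
  have : IsScalarTower Fq Γ(C, U) C.functionField :=
    .of_algebraMap_eq fun c => algebraMap_functionField_eq Fq U c
  have : IsFractionRing Γ(C, U) C.functionField := functionField_isFractionRing_of_isAffineOpen C U hU
  refine irreducible_map_of_isNilpotent (A := Γ(C, U)) hp
    (PerfectField.separable_of_irreducible hp) fun a b hab => ?_
  have := Fact.mk hp
  have hsurj : Surjective (hU.fromSpec ≫ (C ↘ Spec (.of Fq))) :=
    ⟨fun y => ⟨Nonempty.some inferInstance, Subsingleton.elim (α := PrimeSpectrum Fq) _ _⟩⟩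
  have hgeom : GeometricallyIrreducible (hU.fromSpec ≫ (C ↘ Spec (.of Fq))) := inferInstance
  rw [fromSpec_comp_over] at hgeom
  have hirr := hgeom.geometrically_irreducibleSpace (K := AdjoinRoot p) _ _ _
    (isPullback_SpecMap_of_isPushout _ _ _ _
      (CommRingCat.isPushout_tensorProduct Fq Γ(C, U) (AdjoinRoot p)))
  have hprime := PrimeSpectrum.irreducibleSpace_iff_isPrime_nilradical.1 hirr
  simp only [← mem_nilradical]
  exact hprime.mem_or_mem (hab ▸ zero_mem _)

end Scheme

section FunctionField
variable (Fq : Type u) [Field Fq] (C : Scheme.{u}) [C.Over (Spec (.of Fq))] [IsIntegral C]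

instance isFunctionFieldOfCurve_functionField [SmoothOfRelativeDimension 1 (C ↘ Spec (.of Fq))] :
    IsFunctionFieldOfCurve Fq C.functionField := by
  obtain ⟨U, hU, hx, hs⟩ := exists_isStandardSmooth Fq (genericPoint C)
  have : Nonempty U := ⟨⟨_, hx⟩⟩
  let : Algebra Fq Γ(C, U) := (openConstants Fq C U).hom.toAlgebra
  have : Algebra.IsStandardSmoothOfRelativeDimension 1 Fq Γ(C, U) := hs
  have : IsScalarTower Fq Γ(C, U) C.functionField :=
    .of_algebraMap_eq fun c => algebraMap_functionField_eq Fq U c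
  have : IsFractionRing Γ(C, U) C.functionField := functionField_isFractionRing_of_isAffineOpen C U hU
  exact .of_smooth Fq Γ(C, U)

variable {C}

include Fq in
lemma isDiscreteValuationRing_stalk [SmoothOfRelativeDimension 1 (C ↘ Spec (.of Fq))] {x : C}
    (hx : x ≠ genericPoint C) : IsDiscreteValuationRing (C.presheaf.stalk x) := by
  obtain ⟨U, hU, hxU, hs⟩ := exists_isStandardSmooth Fq x
  have : Nonempty U := ⟨⟨_, hxU⟩⟩
  let : Algebra Fq Γ(C, U) := (openConstants Fq C U).hom.toAlgebra
  have : Algebra.IsStandardSmoothOfRelativeDimension 1 Fq Γ(C, U) := hs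
  let : Algebra Γ(C, U) (C.presheaf.stalk x) :=
    TopCat.Presheaf.algebra_section_stalk C.presheaf ⟨x, hxU⟩
  have h1 : IsLocalization.AtPrime (C.presheaf.stalk x) (hU.primeIdealOf ⟨x, hxU⟩).asIdeal :=
    hU.isLocalization_stalk ⟨x, hxU⟩
  refine isDiscreteValuationRing_of_smooth Fq (hU.primeIdealOf ⟨x, hxU⟩).asIdeal (fun h => hx ?_) _
  have h2 : hU.primeIdealOf ⟨x, hxU⟩ = genericPoint (Spec Γ(C, U)) := by
    rw [genericPoint_eq_bot_of_affine]
    exact PrimeSpectrum.ext h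
  rw [← hU.primeIdealOf_genericPoint] at h2
  have h3 := congrArg hU.fromSpec h2
  rwa [hU.fromSpec_primeIdealOf, hU.fromSpec_primeIdealOf] at h3

end FunctionField

/-! ### Local rings and centers of places -/

section StalkConstants

variable (Fq : Type u) [Field Fq] {C : Scheme.{u}} [C.Over (Spec (.of Fq))]

variable (C) in
/-- The constants, as elements of the local ring of a point. -/
def stalkConstants (x : C) : CommRingCat.of Fq ⟶ C.presheaf.stalk x :=
  (Scheme.ΓSpecIso (.of Fq)).inv ≫ (C ↘ Spec (.of Fq)).appTop ≫ C.presheaf.germ ⊤ x trivial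

lemma fromSpecStalk_comp_over (x : C) :
    C.fromSpecStalk x ≫ (C ↘ Spec (.of Fq)) = Spec.map (stalkConstants Fq C x) := by
  obtain ⟨U, hU, hxU⟩ : ∃ U : C.Opens, IsAffineOpen U ∧ x ∈ U := by
    obtain ⟨_, ⟨U, hU, rfl⟩, hxU, -⟩ := C.isBasis_affineOpens.exists_subset_of_mem_open
      (Set.mem_univ x) isOpen_univ
    exact ⟨U, hU, hxU⟩
  rw [← hU.fromSpecStalk_eq_fromSpecStalk hxU, IsAffineOpen.fromSpecStalk, Category.assoc,
    fromSpec_comp_over, ← Spec.map_comp]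
  congr 1
  have h : (C ↘ Spec (.of Fq)).appLE ⊤ U le_top =
    (C ↘ Spec (.of Fq)).appTop ≫ C.presheaf.map (homOfLE le_top).op := rfl
  rw [openConstants, h, stalkConstants, Category.assoc, Category.assoc]
  congr 2
  exact TopCat.Presheaf.germ_res ..

lemma algebraMap_stalkConstants [IsIntegral C] (x : C) (c : Fq) :
    algebraMap (C.presheaf.stalk x) C.functionField (stalkConstants Fq C x c) =
      algebraMap Fq C.functionField c := by
  have : stalkConstants Fq C x ≫
      C.presheaf.stalkSpecializes ((genericPoint_spec C).specializes (Set.mem_univ x)) =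
      stalkConstants Fq C (genericPoint C) := by
    rw [stalkConstants, stalkConstants, Category.assoc, Category.assoc]
    congr 2
    exact TopCat.Presheaf.germ_stalkSpecializes ..
  exact congrArg (fun f => f.hom c) this

end StalkConstants

section Centers
variable {C : Scheme.{u}} [IsIntegral C]

lemma algebraMap_stalk_surjective {c : C} (hc : c = genericPoint C) :
    Function.Surjective (algebraMap (C.presheaf.stalk c) C.functionField) := by
  subst hc
  exact fun k => ⟨k, congrArg (fun f => f.hom k)
    (TopCat.Presheaf.stalkSpecializes_refl C.presheaf (genericPoint C))⟩

/-- The point `c` is the center of the place `v`: its local ring is the valuation ring of `v`. -/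
def Place.IsCenter (v : Place C.functionField) (c : C) : Prop :=
  ∀ f : C.functionField, v.val f ≤ 1 ↔
    f ∈ Set.range (algebraMap (C.presheaf.stalk c) C.functionField)

namespace Place.IsCenter

variable {v : Place C.functionField} {c : C} (h : v.IsCenter c)

/-- The local ring of the center of `v` is the valuation ring of `v`. -/
def ringEquiv : C.presheaf.stalk c ≃+* v.val.valuationSubring :=
  RingEquiv.ofBijective
    ((algebraMap (C.presheaf.stalk c) C.functionField).codRestrict
      v.val.valuationSubring.toSubring fun y => (h _).2 ⟨y, rfl⟩)
    ⟨fun x y hxy => IsFractionRing.injective (C.presheaf.stalk c) C.functionField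
      (congrArg Subtype.val hxy), fun f => by
        obtain ⟨y, hy⟩ := (h f).1 f.2
        exact ⟨y, Subtype.ext hy⟩⟩

/-- The morphism to the curve from the spectrum of the valuation ring of `v`. -/
def toHom : Spec (.of v.val.valuationSubring) ⟶ C :=
  Spec.map (CommRingCat.ofHom h.ringEquiv.toRingHom) ≫ C.fromSpecStalk c

instance isIso_specMap : IsIso (Spec.map (CommRingCat.ofHom h.ringEquiv.toRingHom)) :=
  inferInstanceAs (IsIso (Scheme.Spec.mapIso h.ringEquiv.toCommRingCatIso.op).hom)

instance mono_toHom : Mono h.toHom := by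
  rw [toHom]; infer_instance

lemma toHom_closedPoint : h.toHom (IsLocalRing.closedPoint v.val.valuationSubring) = c := by
  have : IsLocalHom (CommRingCat.ofHom h.ringEquiv.toRingHom).hom :=
    inferInstanceAs (IsLocalHom (RingHomClass.toRingHom h.ringEquiv))
  have h1 : Spec.map (CommRingCat.ofHom h.ringEquiv.toRingHom)
    (IsLocalRing.closedPoint v.val.valuationSubring) = IsLocalRing.closedPoint _ :=
    Spec_closedPoint ..
  exact (congrArg (C.fromSpecStalk c) h1).trans Scheme.fromSpecStalk_closedPoint

lemma specMap_algebraMap_toHom :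
    Spec.map (CommRingCat.ofHom (algebraMap v.val.valuationSubring C.functionField)) ≫ h.toHom =
      C.fromSpecStalk (genericPoint C) := by
  rw [toHom, ← Category.assoc, ← Spec.map_comp, ← Scheme.SpecMap_stalkSpecializes_fromSpecStalk
    ((genericPoint_spec C).specializes (Set.mem_univ c))]
  rfl

variable (Fq : Type u) [Field Fq] [Fintype Fq] [C.Over (Spec (.of Fq))]

lemma ringEquiv_stalkConstants (a : Fq) :
    h.ringEquiv (stalkConstants Fq C c a) = v.constants Fq a :=
  Subtype.ext (algebraMap_stalkConstants Fq c a)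

lemma toHom_comp_over :
    h.toHom ≫ (C ↘ Spec (.of Fq)) = Spec.map (CommRingCat.ofHom (v.constants Fq)) := by
  rw [toHom, Category.assoc, fromSpecStalk_comp_over, ← Spec.map_comp]
  congr 1
  ext a
  exact congrArg Subtype.val (h.ringEquiv_stalkConstants Fq a)

end Place.IsCenter

namespace Place
variable (v : Place C.functionField) (Fq : Type u) [Field Fq] [Fintype Fq] [C.Over (Spec (.of Fq))]

/-- The square of the valuative criterion at a place of the function field. -/
def valuativeCommSq : ValuativeCommSq (C ↘ Spec (.of Fq)) where
  R := v.val.valuationSubring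
  K := C.functionField
  i₁ := C.fromSpecStalk (genericPoint C)
  i₂ := Spec.map (CommRingCat.ofHom (v.constants Fq))
  commSq := ⟨by
    rw [fromSpecStalk_comp_over, ← Spec.map_comp]
    rfl⟩

variable {v} in
include Fq in
-- Both morphisms fill the same valuative square, and separatedness allows only one filler.
lemma IsCenter.toHom_eq [IsSeparated (C ↘ Spec (.of Fq))] {c d : C} (hc : v.IsCenter c)
    (hd : v.IsCenter d) : hc.toHom = hd.toHom := by
  have h := (IsSeparated.valuativeCriterion (C ↘ Spec (.of Fq))) (v.valuativeCommSq Fq)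
  let lift : ∀ {c : C} (h : v.IsCenter c), (v.valuativeCommSq Fq).commSq.LiftStruct := fun h =>
    ⟨h.toHom, h.specMap_algebraMap_toHom, h.toHom_comp_over Fq⟩
  exact congrArg CommSq.LiftStruct.l (h.elim (lift hc) (lift hd))

/-- Properness extends the generic point to the spectrum of `𝒪_v ∩ K`, and `c` is the image of the
closed point. Its local ring is dominated by the valuation ring of `v`; being itself a valuation
ring, it is equal to it. -/
lemma exists_isCenter [IsProper (C ↘ Spec (.of Fq))]
    [SmoothOfRelativeDimension 1 (C ↘ Spec (.of Fq))] : ∃ c : C, v.IsCenter c := by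
  have hp : ValuativeCriterion (C ↘ Spec (.of Fq)) := by
    have : IsProper (C ↘ Spec (.of Fq)) := inferInstance
    rw [IsProper.eq_valuativeCriterion] at this
    exact this.1.1.1
  obtain ⟨⟨⟨l, hl₁, hl₂⟩⟩⟩ := hp.existence (v.valuativeCommSq Fq)
  change Spec (.of v.val.valuationSubring) ⟶ C at l
  set c : C := l (IsLocalRing.closedPoint v.val.valuationSubring)
  let φ : C.presheaf.stalk c ⟶ .of v.val.valuationSubring := Scheme.stalkClosedPointTo l
  have hlocal : IsLocalHom φ.hom := inferInstanceAs (IsLocalHom (Scheme.stalkClosedPointTo l).hom)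
  have hφl : Spec.map φ ≫ C.fromSpecStalk c = l := Scheme.Spec_stalkClosedPointTo_fromSpecStalk l
  have hcomp : φ ≫ CommRingCat.ofHom (algebraMap v.val.valuationSubring C.functionField) =
      C.presheaf.stalkSpecializes ((genericPoint_spec C).specializes (Set.mem_univ c)) := by
    apply Spec.map_injective
    rw [← cancel_mono (C.fromSpecStalk c), Spec.map_comp, Category.assoc, hφl,
      Scheme.SpecMap_stalkSpecializes_fromSpecStalk]
    exact hl₁
  have hφ : ∀ y, ((φ.hom y : v.val.valuationSubring) : C.functionField) =
      algebraMap (C.presheaf.stalk c) C.functionField y :=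
    fun y => congrArg (fun f => f.hom y) hcomp
  -- At the generic point the local ring is all of `K`, which would make every function integral at
  -- `v`.
  have hne : c ≠ genericPoint C := fun hc => by
    obtain ⟨k, hk⟩ := v.surjective (WithZero.exp 1)
    obtain ⟨y, rfl⟩ : ∃ y, algebraMap (C.presheaf.stalk c) C.functionField y = k :=
      algebraMap_stalk_surjective hc k
    have h1 : v.val _ ≤ 1 := (φ.hom y).2
    rw [hφ, hk, ← WithZero.exp_zero, WithZero.exp_le_exp] at h1
    omega
  have := isDiscreteValuationRing_stalk Fq hne
  refine ⟨c, fun f => ⟨fun hf => ?_, ?_⟩⟩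
  · rcases ValuationRing.isInteger_or_isInteger (C.presheaf.stalk c) f with h | ⟨y, hy⟩
    · exact h
    rcases eq_or_ne f 0 with rfl | hf0
    · exact ⟨0, map_zero _⟩
    -- Here `f⁻¹ = y` lies in the local ring while `f` is integral at `v`. So `y` becomes a unit,
    -- and since `φ` is local it already was one.
    have hu : IsUnit (φ.hom y) := by
      refine IsUnit.of_mul_eq_one (⟨f, hf⟩ : v.val.valuationSubring) (Subtype.ext ?_)
      change ((φ.hom y : v.val.valuationSubring) : C.functionField) * f = 1
      rw [hφ, hy, inv_mul_cancel₀ hf0]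
    obtain ⟨z, rfl⟩ := hlocal.map_nonunit _ hu
    refine ⟨↑z⁻¹, ?_⟩
    rw [← inv_inv f, ← hy]
    exact eq_inv_of_mul_eq_one_left (by rw [← map_mul, Units.inv_mul, map_one])
  · rintro ⟨y, rfl⟩
    rw [← hφ]
    exact (φ.hom y).2

end Place

end Centers

/-! ### Embeddings of a finite field and powers of Frobenius -/

section FiniteFields
variable {F κ L : Type*} [Field F] [Fintype F] [Field κ] [Field L] [Algebra F κ] [Algebra F L]
  [Module.Finite F κ] [Algebra.IsAlgebraic F L]

lemma frobenius_zpow_apply (φ : κ →ₐ[F] L) (n : ℤ) (x : κ) :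
    (FiniteField.frobeniusAlgEquivOfAlgebraic F L ^ n) (φ x) =
      φ ((FiniteField.frobeniusAlgEquivOfAlgebraic F κ ^ n) x) := by
  have h1 : ∀ x, FiniteField.frobeniusAlgEquivOfAlgebraic F L (φ x) =
      φ (FiniteField.frobeniusAlgEquivOfAlgebraic F κ x) := fun x => by
    simp
  have h2 : ∀ (n : ℕ) (x : κ), (FiniteField.frobeniusAlgEquivOfAlgebraic F L ^ n) (φ x) =
      φ ((FiniteField.frobeniusAlgEquivOfAlgebraic F κ ^ n) x) := by
    intro n
    induction n with
    | zero => exact fun x => rfl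
    | succ n ih => exact fun x => by rw [pow_succ, pow_succ, AlgEquiv.mul_apply, h1, ih]; rfl
  obtain ⟨n, rfl | rfl⟩ := n.eq_nat_or_neg
  · rw [zpow_natCast, zpow_natCast, h2]
  · rw [zpow_neg, zpow_neg, zpow_natCast, zpow_natCast]
    apply (FiniteField.frobeniusAlgEquivOfAlgebraic F L ^ n).injective
    rw [h2, ← AlgEquiv.mul_apply, ← AlgEquiv.mul_apply, mul_inv_cancel, mul_inv_cancel]
    rfl

/-- A finite field is normal over `F`, so two embeddings differ by an automorphism of `κ`, which is
a power of Frobenius. -/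
lemma exists_eq_frobenius_zpow (φ ψ : κ →ₐ[F] L) : ∃ n : ℤ, ∀ x,
    ψ x = (FiniteField.frobeniusAlgEquivOfAlgebraic F L ^ n) (φ x) := by
  have := Module.finite_of_finite F (M := κ)
  let := φ.toRingHom.toAlgebra
  have : IsScalarTower F κ L := .of_algebraMap_eq' φ.comp_algebraMap.symm
  let σ := Normal.algHomEquivAut F L κ ψ
  have hσ : ∀ x, ψ x = φ (σ x) := fun x =>
    (DFunLike.congr_fun ((Normal.algHomEquivAut F L κ).symm_apply_apply ψ) x).symm
  obtain ⟨n, hn⟩ := (FiniteField.bijective_frobeniusAlgEquivOfAlgebraic_pow F κ).2 σ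
  refine ⟨n, fun x => ?_⟩
  rw [hσ, ← hn, frobenius_zpow_apply, zpow_natCast]

lemma frobenius_zpow_comp_eq_self_iff (φ : κ →ₐ[F] L) (n : ℤ) :
    (∀ x, (FiniteField.frobeniusAlgEquivOfAlgebraic F L ^ n) (φ x) = φ x) ↔
      (Module.finrank F κ : ℤ) ∣ n := by
  have := Module.finite_of_finite F (M := κ)
  simp only [frobenius_zpow_apply]
  rw [← FiniteField.orderOf_frobeniusAlgEquivOfAlgebraic F κ, orderOf_dvd_iff_zpow_eq_one,
    AlgEquiv.ext_iff]
  exact forall_congr' fun x => φ.toRingHom.injective.eq_iff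

end FiniteFields

/-! ### Geometric points over a place as embeddings of its residue field -/

namespace GeomPoint

variable {Fq : Type u} [Field Fq] {C : Scheme.{u}} [C.Over (Spec (.of Fq))]

variable (Fq C) in
/-- The action of the Galois group on the geometric points. -/
def galoisHom : (AlgebraicClosure Fq ≃ₐ[Fq] AlgebraicClosure Fq) →* Equiv.Perm (GeomPoint Fq C) where
  toFun σ := ⟨galois σ, galois σ.symm,
    fun x => by rw [galois_galois, AlgEquiv.self_trans_symm, galois_refl],
    fun x => by rw [galois_galois, AlgEquiv.symm_trans_self, galois_refl]⟩
  map_one' := Equiv.ext galois_refl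
  map_mul' σ τ := Equiv.ext fun x => (galois_galois σ τ x).symm

lemma frobenius_zpow [Fintype Fq] (n : ℤ) (x : GeomPoint Fq C) : (frobenius Fq C ^ n) x =
    galois (FiniteField.frobeniusAlgEquivOfAlgebraic Fq (AlgebraicClosure Fq) ^ n) x := by
  have h : frobenius Fq C =
    galoisHom Fq C (FiniteField.frobeniusAlgEquivOfAlgebraic Fq (AlgebraicClosure Fq)) := rfl
  rw [h, ← map_zpow]
  rfl

/-- The homomorphism from the local ring given by a geometric point. -/
def stalkHom (x : GeomPoint Fq C) : C.presheaf.stalk x.center →+* AlgebraicClosure Fq :=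
  (Scheme.stalkClosedPointTo x.1).hom

instance (x : GeomPoint Fq C) : IsLocalHom x.stalkHom :=
  inferInstanceAs (IsLocalHom (Scheme.stalkClosedPointTo x.1).hom)

lemma specMap_stalkHom (x : GeomPoint Fq C) :
    Spec.map (CommRingCat.ofHom x.stalkHom) ≫ C.fromSpecStalk x.center = x.1 :=
  Scheme.Spec_stalkClosedPointTo_fromSpecStalk x.1

lemma stalkHom_stalkConstants (x : GeomPoint Fq C) (a : Fq) :
    x.stalkHom (stalkConstants Fq C x.center a) = algebraMap Fq (AlgebraicClosure Fq) a := by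
  have h := x.2
  rw [← specMap_stalkHom, Category.assoc, fromSpecStalk_comp_over, ← Spec.map_comp] at h
  exact congrArg (fun f => f.hom a) (Spec.map_injective h)

variable [IsIntegral C] [Fintype Fq]

omit [Fintype Fq] in
/-- A geometric point of a curve over a finite field is not over the generic point. -/
lemma center_ne_genericPoint [SmoothOfRelativeDimension 1 (C ↘ Spec (.of Fq))]
    (x : GeomPoint Fq C) : x.center ≠ genericPoint C := fun hc => by
  obtain ⟨t, ht⟩ := exists_transcendental Fq (K := C.functionField)
  have hsurj := algebraMap_stalk_surjective hc
  have hinj := IsFractionRing.injective (C.presheaf.stalk x.center) C.functionField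
  obtain ⟨y, rfl⟩ := hsurj t
  obtain ⟨p, hp0, hp⟩ := Algebra.IsAlgebraic.isAlgebraic (R := Fq) (x.stalkHom y)
  refine ht ⟨p, hp0, ?_⟩
  -- At the generic point the local ring is a field, so `z`, which the geometric point kills, is
  -- zero. This would be an algebraic relation for the transcendental `t`.
  set z := p.eval₂ (stalkConstants Fq C x.center).hom y
  have hz : algebraMap _ C.functionField z = Polynomial.aeval (algebraMap _ C.functionField y) p := by
    rw [Polynomial.hom_eval₂, Polynomial.aeval_def]
    congr 1
    exact RingHom.ext (algebraMap_stalkConstants Fq x.center)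
  have hz' : x.stalkHom z = 0 := by
    rw [← hp, Polynomial.hom_eval₂, Polynomial.aeval_def]
    congr 1
    exact RingHom.ext x.stalkHom_stalkConstants
  rw [← hz]
  by_contra hne
  obtain ⟨w, hw⟩ := hsurj (algebraMap _ C.functionField z)⁻¹
  have h1 : z * w = 1 := hinj (by rw [map_mul, hw, mul_inv_cancel₀ hne, map_one])
  have h2 := congrArg x.stalkHom h1
  rw [map_mul, hz', zero_mul, map_one] at h2
  exact zero_ne_one h2

omit [Fintype Fq] in
variable (Fq C) in
-- The local ring at the center is a discrete valuation ring, and a place is determined by its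
-- valuation ring.
theorem existsUnique_liesOver [SmoothOfRelativeDimension 1 (C ↘ Spec (.of Fq))]
    (x : GeomPoint Fq C) : ∃! v : Place C.functionField, x.LiesOver v := by
  have := isDiscreteValuationRing_stalk Fq x.center_ne_genericPoint
  refine ⟨Place.ofDVR (C.presheaf.stalk x.center) C.functionField,
    Place.ofDVR_val_le_one_iff _ _, fun w hw => Place.eq_of_le_one_iff fun f => ?_⟩
  exact (hw f).trans (Place.ofDVR_val_le_one_iff _ _ f).symm

section Over
variable {v : Place C.functionField} {c : C} (h : v.IsCenter c)

/-- The geometric point over the place `v` given by an embedding of the residue field. -/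
def ofResidue (φ : v.Residue →ₐ[Fq] AlgebraicClosure Fq) : GeomPoint Fq C :=
  ⟨Spec.map (CommRingCat.ofHom (φ.toRingHom.comp (IsLocalRing.residue v.val.valuationSubring))) ≫
    h.toHom, by
      rw [Category.assoc, h.toHom_comp_over, ← Spec.map_comp]
      congr 1
      ext a
      exact φ.commutes a⟩

lemma center_ofResidue (φ : v.Residue →ₐ[Fq] AlgebraicClosure Fq) : (ofResidue h φ).center = c := by
  have : IsLocalHom (CommRingCat.ofHom
      (φ.toRingHom.comp (IsLocalRing.residue v.val.valuationSubring))).hom :=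
    inferInstanceAs (IsLocalHom (φ.toRingHom.comp (IsLocalRing.residue v.val.valuationSubring)))
  have h1 : Spec.map (CommRingCat.ofHom
      (φ.toRingHom.comp (IsLocalRing.residue v.val.valuationSubring)))
      (IsLocalRing.closedPoint (AlgebraicClosure Fq)) = IsLocalRing.closedPoint _ :=
    Spec_closedPoint ..
  exact (congrArg h.toHom h1).trans h.toHom_closedPoint

lemma liesOver_ofResidue (φ : v.Residue →ₐ[Fq] AlgebraicClosure Fq) : (ofResidue h φ).LiesOver v := by
  have : v.IsCenter (ofResidue h φ).center := (center_ofResidue h φ).symm ▸ h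
  exact this

/-- The morphism from the spectrum of the valuation ring to `C` is a monomorphism, and the residue
map is surjective. -/
lemma ofResidue_injective : Function.Injective (ofResidue (Fq := Fq) h) := fun φ ψ hφψ => by
  have h1 := Spec.map_injective ((cancel_mono h.toHom).1 (congrArg Subtype.val hφψ))
  ext y
  obtain ⟨y, rfl⟩ := IsLocalRing.residue_surjective y
  exact congrArg (fun f => f.hom y) h1

lemma galois_ofResidue (σ : AlgebraicClosure Fq ≃ₐ[Fq] AlgebraicClosure Fq)
    (φ : v.Residue →ₐ[Fq] AlgebraicClosure Fq) :
    galois σ (ofResidue h φ) = ofResidue h (σ.toAlgHom.comp φ) := by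
  apply Subtype.ext
  change _ ≫ _ ≫ _ = _ ≫ _
  rw [← Category.assoc, ← Spec.map_comp]
  rfl

/-- A geometric point is a local homomorphism from the local ring at its center, here the valuation
ring of `v`, so it factors through `κ(v)`. The center of `x` need not be `c` by definition;
uniqueness of the filler identifies the two morphisms. -/
lemma exists_eq_ofResidue [IsSeparated (C ↘ Spec (.of Fq))] (x : GeomPoint Fq C)
    (hx : x.LiesOver v) : ∃ φ : v.Residue →ₐ[Fq] AlgebraicClosure Fq, x = ofResidue h φ := by
  have hx' : v.IsCenter x.center := hx
  let ψ : v.val.valuationSubring →+* AlgebraicClosure Fq :=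
    x.stalkHom.comp hx'.ringEquiv.symm.toRingHom
  have : IsLocalHom ψ :=
    ⟨fun f hf => (isUnit_map_iff hx'.ringEquiv.symm f).1 (isUnit_of_map_unit x.stalkHom _ hf)⟩
  have hψ : ∀ a, ψ (v.constants Fq a) = algebraMap Fq (AlgebraicClosure Fq) a := fun a => by
    rw [← hx'.ringEquiv_stalkConstants, ← x.stalkHom_stalkConstants]
    exact congrArg x.stalkHom (hx'.ringEquiv.symm_apply_apply _)
  let φ : v.Residue →ₐ[Fq] AlgebraicClosure Fq :=
    { IsLocalRing.ResidueField.lift ψ with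
      commutes' := hψ }
  refine ⟨φ, Subtype.ext ?_⟩
  have h1 : h.toHom = hx'.toHom := h.toHom_eq Fq hx'
  have h2 : φ.toRingHom.comp (IsLocalRing.residue v.val.valuationSubring) = ψ := rfl
  change x.1 = Spec.map (CommRingCat.ofHom _) ≫ h.toHom
  rw [h1, h2, Place.IsCenter.toHom, ← Category.assoc, ← Spec.map_comp, ← CommRingCat.ofHom_comp,
    RingHom.comp_assoc]
  have h3 : hx'.ringEquiv.symm.toRingHom.comp hx'.ringEquiv.toRingHom = RingHom.id _ :=
    RingHom.ext hx'.ringEquiv.symm_apply_apply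
  rw [h3, RingHom.comp_id, specMap_stalkHom]

end Over

variable (Fq C) in
theorem exists_liesOver [IsProper (C ↘ Spec (.of Fq))]
    [SmoothOfRelativeDimension 1 (C ↘ Spec (.of Fq))] (v : Place C.functionField) :
    ∃ x : GeomPoint Fq C, x.LiesOver v := by
  obtain ⟨c, h⟩ := v.exists_isCenter Fq
  exact ⟨ofResidue h (IsAlgClosed.lift (R := Fq)), liesOver_ofResidue h _⟩

/-- Frobenius acts on embeddings of `κ(v)` by composition, and any two of them differ by one of its
powers. -/
theorem LiesOver.liesOver_iff [IsProper (C ↘ Spec (.of Fq))]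
    [SmoothOfRelativeDimension 1 (C ↘ Spec (.of Fq))] {v : Place C.functionField}
    {x : GeomPoint Fq C} (hx : x.LiesOver v) (y : GeomPoint Fq C) :
    y.LiesOver v ↔ ∃ n : ℤ, (frobenius Fq C ^ n) x = y := by
  have h : v.IsCenter x.center := hx
  obtain ⟨φ, hφ⟩ := exists_eq_ofResidue h x hx
  constructor
  · intro hy
    obtain ⟨ψ, hψ⟩ := exists_eq_ofResidue h y hy
    obtain ⟨n, hn⟩ := exists_eq_frobenius_zpow φ ψ
    refine ⟨n, ?_⟩
    rw [hψ, frobenius_zpow, congrArg (galois _) hφ, galois_ofResidue]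
    congr 1
    exact AlgHom.ext fun a => (hn a).symm
  · rintro ⟨n, rfl⟩
    rw [frobenius_zpow, congrArg (galois _) hφ, galois_ofResidue]
    exact liesOver_ofResidue h _

/-- A power of Frobenius fixes the embedding exactly when it is trivial on `κ(v)`, where Frobenius
has order `n_v`. -/
theorem LiesOver.frobenius_zpow_eq_self_iff [IsProper (C ↘ Spec (.of Fq))]
    [SmoothOfRelativeDimension 1 (C ↘ Spec (.of Fq))] {v : Place C.functionField}
    {x : GeomPoint Fq C} (hx : x.LiesOver v) (n : ℤ) :
    (frobenius Fq C ^ n) x = x ↔ (v.deg Fq : ℤ) ∣ n := by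
  have h : v.IsCenter x.center := hx
  obtain ⟨φ, hφ⟩ := exists_eq_ofResidue h x hx
  rw [frobenius_zpow, congrArg (galois _) hφ, galois_ofResidue, Place.deg,
    ← frobenius_zpow_comp_eq_self_iff φ]
  conv_lhs => rhs; rw [hφ]
  rw [(ofResidue_injective h).eq_iff, AlgHom.ext_iff]
  rfl

end GeomPoint

lemma ncard_range_zpow_apply {X : Type*} (F : Equiv.Perm X) (x : X) {d : ℕ} (hd : 0 < d)
    (h : ∀ n : ℤ, (F ^ n) x = x ↔ (d : ℤ) ∣ n) :
    (Set.range fun n : ℤ => (F ^ n) x).ncard = d := by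
  have heq : ∀ m n : ℤ, (F ^ m) x = (F ^ n) x ↔ (d : ℤ) ∣ m - n := fun m n => by
    rw [← h, sub_eq_neg_add, zpow_add, Equiv.Perm.mul_apply, zpow_neg, Equiv.Perm.inv_eq_iff_eq]
  have himg : (Set.range fun n : ℤ => (F ^ n) x) =
      (fun n : ℤ => (F ^ n) x) '' (Finset.Ico (0 : ℤ) d : Set ℤ) := by
    refine Set.Subset.antisymm ?_ (Set.image_subset_range _ _)
    rintro _ ⟨n, rfl⟩
    refine ⟨n % d, ?_, (heq _ _).2 ?_⟩
    · rw [Finset.mem_coe, Finset.mem_Ico]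
      exact ⟨Int.emod_nonneg _ (by omega), Int.emod_lt_of_pos _ (by omega)⟩
    · exact Int.dvd_emod_sub_self
  rw [himg, Set.InjOn.ncard_image, Set.ncard_coe_finset, Int.card_Ico]
  · simp
  · intro m hm n hn hmn
    rw [Finset.mem_coe, Finset.mem_Ico] at hm hn
    have h1 := Int.eq_zero_of_abs_lt_dvd ((heq m n).1 hmn) (by rw [abs_lt]; omega)
    omega

end
end AdeleClass

theorem proposition8p9 (Fq : Type u) [Field Fq] [Fintype Fq]
    (C : Scheme.{u}) [C.Over (Spec (.of Fq))] [IsIntegral C]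
    [IsProper (C ↘ Spec (.of Fq))]
    [SmoothOfRelativeDimension 1 (C ↘ Spec (.of Fq))]
    [GeometricallyIrreducible (C ↘ Spec (.of Fq))] :
    -- `K^*` embeds diagonally into the ideles
    (∀ k : C.functionFieldˣ, ∃ u : Idele C.functionField, ∀ v : Place C.functionField,
      (u : Adele C.functionField) v = ((k : C.functionField) : v.Completion)) ∧
    -- the norm of ideles descends to `C_K`; there its kernel is `C_{K,1}` and its range is `q^ℤ`
    ∃ nrm : IdeleClass C.functionField →* ℝ≥0ˣ,
      (∀ a : Idele C.functionField,
        nrm (a : IdeleClass C.functionField) = ideleNorm C.functionField Fq a) ∧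
      nrm.ker = normOne C.functionField Fq ∧
      nrm.range = Subgroup.zpowers (qUnit Fq) ∧
      -- `N_v = q^(n_v ℤ)`, `N / N_v ≃ ℤ / n_v`, and the orbit of `a^(v)` is a copy of `N / N_v`
      (∀ v : Place C.functionField,
        0 < v.deg Fq ∧
        v.normRange Fq = Subgroup.zpowers (qUnit Fq ^ v.deg Fq) ∧
        Nonempty ((nrm.range ⧸ (v.normRange Fq).subgroupOf nrm.range) ≃*
          Multiplicative (ZMod (v.deg Fq))) ∧
        MulAction.stabilizer (IdeleClass C.functionField) (XiQuotient.base Fq v) =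
          (v.normRange Fq).comap nrm) ∧
      -- points and places: the fibre over `v` is one Frobenius orbit, of cardinality `n_v`
      (∀ x : GeomPoint Fq C, ∃! v : Place C.functionField, x.LiesOver v) ∧
      (∀ v : Place C.functionField,
        {x : GeomPoint Fq C | x.LiesOver v}.ncard = v.deg Fq ∧
        ∃ x : GeomPoint Fq C, {y : GeomPoint Fq C | y.LiesOver v} =
          Set.range fun n : ℤ => (GeomPoint.frobenius Fq C ^ n) x) ∧
      -- the equivariant identification, compatible with the places
      (∃ Φ : XiQuotient C.functionField Fq ≃ GeomPoint Fq C,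
        (∀ (c : IdeleClass C.functionField) (n : ℤ), nrm c = qUnit Fq ^ n →
          ∀ x : XiQuotient C.functionField Fq,
            Φ (c • x) = (GeomPoint.frobenius Fq C ^ n) (Φ x)) ∧
        ∀ v : Place C.functionField, (Φ (XiQuotient.base Fq v)).LiesOver v) ∧
      -- it is determined by the choice of a point in each Frobenius orbit, which is arbitrary
      ∀ s : Place C.functionField → GeomPoint Fq C,
        (∀ v : Place C.functionField, (s v).LiesOver v) →
        ∃! Φ : XiQuotient C.functionField Fq ≃ GeomPoint Fq C,
          (∀ (c : IdeleClass C.functionField) (n : ℤ), nrm c = qUnit Fq ^ n →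
            ∀ x : XiQuotient C.functionField Fq,
              Φ (c • x) = (GeomPoint.frobenius Fq C ^ n) (Φ x)) ∧
          ∀ v : Place C.functionField, Φ (XiQuotient.base Fq v) = s v := by
  have hdeg : ∀ ℓ : ℕ, 1 < ℓ → ∃ v : Place C.functionField, ¬ ℓ ∣ v.deg Fq := fun ℓ hℓ =>
    exists_not_dvd_deg (fun p hp => irreducible_map_functionField Fq hp) hℓ
  have hrange := IdeleClass.range_norm Fq hdeg
  have hfiber : ∀ (v : Place C.functionField) (x : GeomPoint Fq C), x.LiesOver v →
      {y : GeomPoint Fq C | y.LiesOver v} =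
        Set.range fun n : ℤ => (GeomPoint.frobenius Fq C ^ n) x :=
    fun v x hx => Set.ext fun y => hx.liesOver_iff y
  have hsec : ∀ s : Place C.functionField → GeomPoint Fq C,
      (∀ v : Place C.functionField, (s v).LiesOver v) →
      ∃! Φ : XiQuotient C.functionField Fq ≃ GeomPoint Fq C,
        (∀ (c : IdeleClass C.functionField) (n : ℤ), IdeleClass.norm Fq c = qUnit Fq ^ n →
          ∀ x : XiQuotient C.functionField Fq,
            Φ (c • x) = (GeomPoint.frobenius Fq C ^ n) (Φ x)) ∧
        ∀ v : Place C.functionField, Φ (XiQuotient.base Fq v) = s v := by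
    intro s hs
    refine existsUnique_equivariant Fq hdeg _ s (fun x => ?_) (fun v w n => ?_)
    · obtain ⟨v, hv, -⟩ := GeomPoint.existsUnique_liesOver Fq C x
      obtain ⟨n, hn⟩ := ((hs v).liesOver_iff x).1 hv
      exact ⟨v, n, hn.symm⟩
    · constructor
      · intro h
        -- A Frobenius translate stays over the same place, so `s w` lies over both `v` and `w`.
        have h1 : (s w).LiesOver v := ((hs v).liesOver_iff _).2 ⟨n, h⟩
        obtain rfl := (GeomPoint.existsUnique_liesOver Fq C (s w)).unique h1 (hs w)
        exact ⟨rfl, ((hs v).frobenius_zpow_eq_self_iff n).1 h⟩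
      · rintro ⟨rfl, h⟩
        exact ((hs v).frobenius_zpow_eq_self_iff n).2 h
  refine ⟨exists_principal_idele Fq, IdeleClass.norm Fq, IdeleClass.norm_mk Fq,
    IdeleClass.ker_norm Fq, hrange, fun v => ⟨v.deg_pos Fq, v.normRange_eq Fq, ?_,
      XiQuotient.stabilizer_base Fq v⟩, GeomPoint.existsUnique_liesOver Fq C, fun v => ?_, ?_, hsec⟩
  · rw [hrange, v.normRange_eq Fq]
    exact zpowers_quotient Fq (v.deg Fq)
  · obtain ⟨x, hx⟩ := GeomPoint.exists_liesOver Fq C v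
    refine ⟨?_, x, hfiber v x hx⟩
    rw [hfiber v x hx]
    exact ncard_range_zpow_apply _ x (v.deg_pos Fq) hx.frobenius_zpow_eq_self_iff
  · choose s hs using GeomPoint.exists_liesOver Fq C
    obtain ⟨Φ, hΦ, -⟩ := hsec s hs
    exact ⟨Φ, hΦ.1, fun v => by rw [hΦ.2]; exact hs v⟩
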